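/- Let $\varphi=(1+\sqrt5)/2$. **Renormalized energy.** Let $\Lambda\subset\mathbb R^2$ be a set whose distinct points are at mutual distance at least some $\delta>0$ (a *uniform* set), and let $m\in\mathbb R$. Let $\mathscr F_\Lambda$ be the set of locally integrable vector fields $j\in L^2_{\rm loc}(\mathbb R^2\setminus\Lambda,\mathbb R^2)$ such that $-\operatorname{div} j=2\pi\big(\sum_{p\in\Lambda}\delta_p-m\big)$ in the sense of distributions in $\mathbb R^2$. Let $(\chi_R)_{R>1}$ be a family of cutoffs: $\chi_R$ is smooth, $\chi_R\ge0$, $\|\nabla\chi_R\|_\infty\le C$ with $C$ independent of $R$, $\chi_R=1$ on $B_{R-1}$ and $\chi_R=0$ outside $B_R$, where $B_R$ is the disc of radius $R$ centred at $0$. Put $$W(j,\chi_R)=\limsup_{\eta\to0^+}\Big(\tfrac12\int_{\mathbb R^2\setminus\bigcup_{p\in\Lambda}B(p,\eta)}\chi_R|j|^2+\pi\log\eta\sum_{p\in\Lambda}\chi_R(p)\Big),\qquad W(j)=\limsup_{R\to\infty}\frac{W(j,\chi_R)}{|B_R|},$$ and $\tilde W(\Lambda)=\inf_{j\in\mathscr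 F_\Lambda}W(j)$ (with $\inf\varnothing=+\infty$). **Construction.** Let $\Omega_1,\Omega_2$ be closed triangles in the plane, with side lengths either $(1,1,\varphi)$ for $\Omega_1$ and $(\varphi,\varphi,1)$ for $\Omega_2$ (the Robinson triangles of the kite and dart tiling), or $(1,1,\varphi^{-1})$ for $\Omega_1$ and $(1,1,\varphi)$ for $\Omega_2$ (those of the rhombus tiling). A *substitution rule* is a decomposition of $\varphi\Omega_1$ into a copy of $\Omega_1$ and a copy of $\Omega_2$, together with a decomposition of $\varphi\Omega_2$ into a copy of $\Omega_1$ and two copies of $\Omega_2$, where in each case the pieces have pairwise disjoint interiors and a copy is the image under an isometry of the plane, possibly orientation-reversing. Fix a substitution rule and points $p_i$ in the interior of $\Omega_i$ ($i=1,2$). Start from $\Omega_1$, translated so that $p_1$ is the origin. At each step scale everything by $\varphi$ about the origin and decompose each scaled tile $\varphi\Omega_i$ by the rule. After $n$ steps $\varphi^n(\Omega_1-p_1)$ is tiled by copies of $\Omega_1$ and $\Omega_2$; let $\Lambda_n$ be the set of the points corresponding to $p_1$, respectively $p_2$, in these copies. A subsequence $\Lambda_{\psi(n)}$ *converges* to $\Lambda$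 if every neighbourhood of each point of $\Lambda$ meets $\Lambda_{\psi(n)}$ for all large $n$, and every point each of whose neighbourhoods meets $\Lambda_{\psi(n)}$ for infinitely many $n$ belongs to $\Lambda$. **Theorem.** For each of the two pairs of triangles a substitution rule exists. For every substitution rule and all points $p_i$ in the interior of $\Omega_i$: 1. some subsequence of $(\Lambda_n)$ converges to a set $\Lambda\subset\mathbb R^2$; 2. for every limit $\Lambda$ of a subsequence of $(\Lambda_n)$, the set $\Lambda$ is uniform, and for every family of cutoffs as above $$\tilde W(\Lambda)<+\infty\qquad\text{with background } m=\frac{1+\varphi}{|\Omega_1|+\varphi|\Omega_2|}.$$ -/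

import Mathlib

open MeasureTheory Filter Set Metric Topology
open scoped ContDiff ENNReal Pointwise

noncomputable section

namespace PenroseLattice

/-- The Euclidean plane. -/
abbrev Plane : Type := EuclideanSpace ℝ (Fin 2)

/-! ### Renormalized energy -/

/-- The class of vector fields `j` in `L²_loc(ℝ² \ Λ, ℝ²)` that solve
`-div j = 2π (∑_{p ∈ Λ} δ_p - m)` in `ℝ²`, in the sense of distributions (`fderiv ℝ f x (j x)` is
`j x · ∇f x`). Local integrability of `j` on `ℝ²` is what gives `div j` a meaning across `Λ`. -/
structure IsAdmissibleField (m : ℝ) (Λ : Set Plane) (j : Plane → Plane) : Prop where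
  locallyIntegrable : LocallyIntegrable j volume
  memLp_two : ∀ K : Set Plane, IsCompact K → K ⊆ Λᶜ → MemLp j 2 (volume.restrict K)
  weak_eq : ∀ f : Plane → ℝ, ContDiff ℝ ∞ f → HasCompactSupport f →
    ∫ x, fderiv ℝ f x (j x) = 2 * Real.pi * ((∑ᶠ p ∈ Λ, f p) - m * ∫ x, f x)

/-- Smooth approximations `χ R` of the indicator functions of the balls `B_R`, `R > 1`, with
gradients bounded independently of `R`. -/
def IsCutoffFamily (χ : ℝ → Plane → ℝ) : Prop :=
  ∃ C : ℝ, ∀ R : ℝ, 1 < R →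
    ContDiff ℝ ∞ (χ R) ∧ (∀ x, 0 ≤ χ R x) ∧ (∀ x, ‖fderiv ℝ (χ R) x‖ ≤ C) ∧
    (∀ x ∈ ball (0 : Plane) (R - 1), χ R x = 1) ∧ (∀ x ∉ ball (0 : Plane) R, χ R x = 0)

/-- `W(j, f)`, the limsup as `η → 0⁺` of
`½ ∫_{ℝ² \ ⋃_{p ∈ Λ} B(p, η)} f |j|² + π log η ∑_{p ∈ Λ} f p`, for a weight `f ≥ 0` of compact
support. -/
def localEnergy (Λ : Set Plane) (f : Plane → ℝ) (j : Plane → Plane) : EReal :=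
  limsup (fun η : ℝ =>
    (((∫⁻ x in (⋃ p ∈ Λ, ball p η)ᶜ, ENNReal.ofReal (f x * ‖j x‖ ^ 2)) / 2 : ℝ≥0∞) : EReal)
      + ((Real.pi * Real.log η * ∑ᶠ p ∈ Λ, f p : ℝ) : EReal)) (𝓝[>] 0)

/-- `W(j) = limsup_{R → ∞} W(j, χ_R) / |B_R|`. -/
def fieldEnergy (χ : ℝ → Plane → ℝ) (Λ : Set Plane) (j : Plane → Plane) : EReal :=
  limsup (fun R : ℝ => localEnergy Λ (χ R) j / ((Real.pi * R ^ 2 : ℝ) : EReal)) atTop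

/-- `W̃(Λ)` for the background `m`: the infimum of `W(j)` over the admissible fields (`⊤` if there
is none). -/
def tildeW (χ : ℝ → Plane → ℝ) (m : ℝ) (Λ : Set Plane) : EReal :=
  ⨅ (j : Plane → Plane) (_ : IsAdmissibleField m Λ j), fieldEnergy χ Λ j

/-- Distinct points of `Λ` stay at distance bounded below by a positive constant. -/
def IsUniformSet (Λ : Set Plane) : Prop :=
  ∃ δ : ℝ, 0 < δ ∧ ∀ x ∈ Λ, ∀ y ∈ Λ, x ≠ y → δ ≤ dist x y

/-! ### Robinson triangles and their substitution -/

/-- `T` is a closed (filled) triangle with side lengths `a, b, c`. -/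
def IsTriangleWithSides (T : Set Plane) (a b c : ℝ) : Prop :=
  ∃ A B C : Plane, dist A B = a ∧ dist A C = b ∧ dist B C = c ∧ T = convexHull ℝ {A, B, C}

/-- The two Robinson triangles `Ω 0, Ω 1`, either those of the kite and dart tiling, or those of
the rhombus tiling. -/
def IsRobinsonPair (Ω : Fin 2 → Set Plane) : Prop :=
  (IsTriangleWithSides (Ω 0) 1 1 Real.goldenRatio ∧
    IsTriangleWithSides (Ω 1) Real.goldenRatio Real.goldenRatio 1) ∨
  (IsTriangleWithSides (Ω 0) 1 1 Real.goldenRatio⁻¹ ∧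
    IsTriangleWithSides (Ω 1) 1 1 Real.goldenRatio)

/-- The kind of the `k`-th piece: in each decomposition piece `0` is a copy of `Ω 0`, and all the
other pieces are copies of `Ω 1`. -/
def pieceKind (k : ℕ) : Fin 2 := if k = 0 then 0 else 1

/-- A decomposition of `φ Ω₀` into a copy of `Ω₀` and a copy of `Ω₁`, and of `φ Ω₁` into a copy of
`Ω₀` and two copies of `Ω₁`, with disjoint interiors (so `φ Ω i` has `i + 2` pieces). Copies are
images under isometries of the plane, reflections included. -/
structure SubstitutionRule (Ω : Fin 2 → Set Plane) where
  place : (i : Fin 2) → Fin (i.val + 2) → (Plane ≃ᵃⁱ[ℝ] Plane)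
  cover : ∀ i, Real.goldenRatio • Ω i = ⋃ k, place i k '' Ω (pieceKind k)
  disjoint_interior : ∀ i k l, k ≠ l →
    Disjoint (interior (place i k '' Ω (pieceKind k))) (interior (place i l '' Ω (pieceKind l)))

variable {Ω : Fin 2 → Set Plane}

/-- The tiles after `n` steps. A tile is a pair `(i, g)` of a kind and a placement map, which is
an isometry; it occupies `g '' Ω i`. One starts from `Ω 0`, translated so that `p 0` is at the
origin; in each step everything is scaled up by `φ`, and every scaled tile
`φ • (g '' Ω i) = (φ g φ⁻¹) '' (φ • Ω i)` is decomposed by the rule. -/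
def tiles (S : SubstitutionRule Ω) (p : Fin 2 → Plane) : ℕ → Set (Fin 2 × (Plane → Plane))
  | 0 => {(0, fun x => x - p 0)}
  | n + 1 => {t | ∃ i g, (i, g) ∈ tiles S p n ∧ ∃ k : Fin (i.val + 2),
      t = (pieceKind k,
        fun x => Real.goldenRatio • g (Real.goldenRatio⁻¹ • S.place i k x))}

/-- The set `Λ_n` of the distinguished points of the tiles after `n` steps. -/
def tilePoints (S : SubstitutionRule Ω) (p : Fin 2 → Plane) (n : ℕ) : Set Plane :=
  {x | ∃ i g, (i, g) ∈ tiles S p n ∧ x = g (p i)}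

/-- Local convergence of subsets of the plane (Painlevé-Kuratowski, or Fell, convergence): every
point of `Λ` is a limit of points of the `L n`, and every point that is approached by points of
infinitely many `L n` lies in `Λ`. -/
def ConvergesLocally (L : ℕ → Set Plane) (Λ : Set Plane) : Prop :=
  (∀ x ∈ Λ, ∀ ε > 0, ∀ᶠ n in atTop, (L n ∩ ball x ε).Nonempty) ∧
  (∀ x, (∀ ε > 0, ∃ᶠ n in atTop, (L n ∩ ball x ε).Nonempty) → x ∈ Λ)

end PenroseLattice

end

open PenroseLattice

namespace PenroseLattice

open scoped NNReal

/-! The energy is finite as soon as one admissible field has energy O(R²) in discs of radius R.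
Around each point of `Λ` place the explicit field of a unit charge screened by a uniformly charged
disc of radius `r`; the discs are disjoint. It remains to solve -div b = 2π(normalized discs - m)
with a bounded field b (`exists_primitive_limit`). The energy of the sum is then an explicit radial
integral per point, whose logarithmic divergence cancels against π log η, plus a bounded density
(`localEnergy_le`).

The bounded field comes from the substitution. Areas satisfy φ²|Ω_i| = sum of the areas of the
pieces, so they form an eigenvector of the substitution matrix with rows (1 1) and (1 2), for the
eigenvalue φ². The background m is the value for which the vector of net charges 1 - m|Ω_i| lies in
the other eigenspace, with eigenvalue φ⁻² (`sum_charge`). Smear the charge of each tile uniformly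
over the tile. After one substitution, the charge density of the pieces of φΩ_i differs from φ⁻⁴
times the dilated density of Ω_i by a density of zero total charge. On a convex body such a neutral
density is the divergence of a bounded field supported in the interior
(`exists_hasBoundedPrimitive_of_integral_eq_zero`). The fields of different tiles have disjoint
supports, so their sum satisfies the same bound however many tiles there are.

Dilation by φ multiplies the bound on a field by φ, and the density carries φ⁻⁴, so the bound K_n on
the field after n steps satisfies K_{n+1} = D + φ⁻³ K_n and stays bounded
(`exists_primitive_total_density`). What remains of the initial charge has density O(φ⁻⁴ⁿ).
Replacing each smeared point by a disc is another neutral correction inside the tiles. Weak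
compactness of bounded fields passes all this to a limit `Λ` (`HasBoundedPrimitive.of_tendsto`).

Limits exist by compactness, and are uniform because the points keep a fixed distance to the
boundaries of their tiles. The rules exist because the golden triangles can be cut by a segment from
a vertex. -/

/-! ### Densities of pushforward measures -/

/-- The pushforward of a bounded nonnegative weight under a map that increases volumes by at most
a constant factor has a bounded density. -/
theorem exists_bounded_density_of_nonneg {α : Type*} [MeasurableSpace α] {μ : Measure α}
    [IsFiniteMeasure μ] {ν : Measure Plane} [SigmaFinite ν] {Φ : α → Plane} (hΦ : Measurable Φ)
    {C : ℝ≥0} (hC : μ.map Φ ≤ C • ν) {w : α → ℝ} (hw : Measurable w) {M : ℝ≥0}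
    (h0 : ∀ a, 0 ≤ w a) (hM : ∀ a, w a ≤ M) :
    ∃ ρ : Plane → ℝ, Measurable ρ ∧ (∀ z, |ρ z| ≤ M * C) ∧
      ∀ g : Plane → ℝ, Measurable g → ∫ a, g (Φ a) * w a ∂μ = ∫ z, g z * ρ z ∂ν := by
  set κ : Measure Plane := (μ.withDensity fun a => ((w a).toNNReal : ℝ≥0∞)).map Φ with hκ
  have hwn : Measurable fun a => (w a).toNNReal := hw.real_toNNReal
  have hle : κ ≤ (M * C : ℝ≥0) • ν := by
    refine Measure.le_iff.2 fun s hs => ?_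
    rw [hκ, Measure.map_apply hΦ hs, withDensity_apply _ (hΦ hs)]
    calc ∫⁻ a in Φ ⁻¹' s, ((w a).toNNReal : ℝ≥0∞) ∂μ ≤ ∫⁻ _ in Φ ⁻¹' s, (M : ℝ≥0∞) ∂μ := by
          refine lintegral_mono fun a => ?_
          exact ENNReal.coe_le_coe.2 (Real.toNNReal_le_iff_le_coe.2 (hM a))
      _ = M * μ.map Φ s := by rw [setLIntegral_const, Measure.map_apply hΦ hs]
      _ ≤ M * (C * ν s) := by
          gcongr
          simpa using hC s
      _ = ((M * C : ℝ≥0) • ν) s := by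
          simp [mul_assoc, ENNReal.smul_def]
  have hfin : IsFiniteMeasure κ := by
    have : IsFiniteMeasure (μ.withDensity fun a => ((w a).toNNReal : ℝ≥0∞)) := by
      refine isFiniteMeasure_withDensity ?_
      refine ((lintegral_mono fun a => ?_ : _ ≤ ∫⁻ _, (M : ℝ≥0∞) ∂μ).trans_lt ?_).ne
      · exact ENNReal.coe_le_coe.2 (Real.toNNReal_le_iff_le_coe.2 (hM a))
      · simpa using ENNReal.mul_lt_top (by simp) (measure_lt_top μ _)
    exact Measure.isFiniteMeasure_map _ _
  have hac : κ ≪ ν := (Measure.absolutelyContinuous_of_le hle).trans Measure.smul_absolutelyContinuous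
  have hbd : ∀ᵐ z ∂ν, κ.rnDeriv ν z ≤ ((M * C : ℝ≥0) : ℝ≥0∞) := by
    refine ae_le_of_forall_setLIntegral_le_of_sigmaFinite (Measure.measurable_rnDeriv _ _)
      fun s _ _ => (Measure.setLIntegral_rnDeriv_le s).trans ?_
    rw [setLIntegral_const]
    simpa [ENNReal.smul_def] using hle s
  -- The Radon-Nikodym derivative is bounded only almost everywhere; the truncation makes the bound
  -- hold at every point.
  refine ⟨fun z => min (κ.rnDeriv ν z).toReal (M * C),
    (Measure.measurable_rnDeriv _ _).ennreal_toReal.min measurable_const, fun z => ?_,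
    fun g hg => ?_⟩
  · rw [abs_of_nonneg (le_min ENNReal.toReal_nonneg (by positivity))]
    exact min_le_right _ _
  · calc ∫ a, g (Φ a) * w a ∂μ = ∫ a, (w a).toNNReal • g (Φ a) ∂μ := by
          refine integral_congr_ae (ae_of_all _ fun a => ?_)
          simp [NNReal.smul_def, h0 a, mul_comm]
      _ = ∫ z, g z ∂κ := by
          rw [← integral_withDensity_eq_integral_smul hwn, hκ,
            integral_map hΦ.aemeasurable hg.aestronglyMeasurable]
      _ = ∫ z, (κ.rnDeriv ν z).toReal • g z ∂ν := by
          rw [integral_rnDeriv_smul hac]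
      _ = _ := by
          refine integral_congr_ae ?_
          filter_upwards [hbd] with z hz
          have := ENNReal.toReal_mono ENNReal.coe_ne_top hz
          rw [min_eq_left (by simpa using this), smul_eq_mul, mul_comm]

/-- The positive and negative parts of the weight are pushed forward separately, which costs the
factor 2. Integrability of `g` is needed to split the integrals. -/
theorem exists_bounded_density {α : Type*} [MeasurableSpace α] {μ : Measure α}
    [IsFiniteMeasure μ] {ν : Measure Plane} [SigmaFinite ν] {Φ : α → Plane} (hΦ : Measurable Φ)
    {C : ℝ≥0} (hC : μ.map Φ ≤ C • ν) {w : α → ℝ} (hw : Measurable w) {M : ℝ≥0}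
    (hM : ∀ a, |w a| ≤ M) :
    ∃ ρ : Plane → ℝ, Measurable ρ ∧ (∀ z, |ρ z| ≤ 2 * (M * C)) ∧
      ∀ g : Plane → ℝ, Measurable g → Integrable g ν →
        ∫ a, g (Φ a) * w a ∂μ = ∫ z, g z * ρ z ∂ν := by
  obtain ⟨ρ₁, h₁m, h₁b, h₁⟩ := exists_bounded_density_of_nonneg hΦ hC (w := fun a => max (w a) 0)
    (hw.max measurable_const) (M := M) (fun a => le_max_right _ _)
    (fun a => max_le ((le_abs_self _).trans (hM a)) M.2)
  obtain ⟨ρ₂, h₂m, h₂b, h₂⟩ := exists_bounded_density_of_nonneg hΦ hC (w := fun a => max (-w a) 0)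
    (hw.neg.max measurable_const) (M := M) (fun a => le_max_right _ _)
    (fun a => max_le ((neg_le_abs _).trans (hM a)) M.2)
  refine ⟨fun z => ρ₁ z - ρ₂ z, h₁m.sub h₂m, fun z => ?_, fun g hg hgi => ?_⟩
  · calc |ρ₁ z - ρ₂ z| ≤ |ρ₁ z| + |ρ₂ z| := abs_sub _ _
      _ ≤ 2 * (M * C) := by linarith [h₁b z, h₂b z]
  · have hgΦ : Integrable (fun a => g (Φ a)) μ := by
      have : Integrable g (μ.map Φ) := Integrable.mono_measure (hgi.smul_measure_nnreal) hC
      exact this.comp_measurable hΦ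
    have hI : ∀ u : α → ℝ, Measurable u → (∀ a, |u a| ≤ M) →
        Integrable (fun a => g (Φ a) * u a) μ := fun u hu hb =>
      hgΦ.mul_bdd (c := M) hu.aestronglyMeasurable (ae_of_all _ hb)
    have hJ : ∀ u : Plane → ℝ, Measurable u → (∀ a, |u a| ≤ M * C) →
        Integrable (fun a => g a * u a) ν := fun u hu hb =>
      hgi.mul_bdd (c := M * C) hu.aestronglyMeasurable (ae_of_all _ hb)
    simp_rw [mul_sub]
    rw [integral_sub (hJ _ h₁m h₁b) (hJ _ h₂m h₂b), ← h₁ g hg, ← h₂ g hg, ← integral_sub]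
    · refine integral_congr_ae (ae_of_all _ fun a => ?_)
      simp only [← mul_sub]
      congr 1
      rcases le_total 0 (w a) with h | h
      · rw [max_eq_left h, max_eq_right (by linarith)]; ring
      · rw [max_eq_right h, max_eq_left (by linarith)]; ring
    · refine hI _ (hw.max measurable_const) fun a => ?_
      rw [abs_of_nonneg (le_max_right _ _)]
      exact max_le ((le_abs_self _).trans (hM a)) M.2
    · refine hI _ (hw.neg.max measurable_const) fun a => ?_
      rw [abs_of_nonneg (le_max_right _ _)]
      exact max_le ((neg_le_abs _).trans (hM a)) M.2

/-! ### Bounded fields for neutral charges on a convex body -/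

/-- `j` is supported in `E`, bounded by `K`, and solves `-div j = h` in the sense of
distributions. -/
structure IsBoundedPrimitive (E : Set Plane) (K : ℝ) (h : Plane → ℝ) (j : Plane → Plane) :
    Prop where
  measurable : Measurable j
  norm_le : ∀ x, ‖j x‖ ≤ K
  eq_zero : ∀ x ∉ E, j x = 0
  weak_eq : ∀ f : Plane → ℝ, ContDiff ℝ ∞ f → HasCompactSupport f →
    ∫ x, fderiv ℝ f x (j x) = ∫ x, f x * h x

/-- `h` is, up to sign, the divergence of a field supported in `E` and bounded by `K`. -/
def HasBoundedPrimitive (E : Set Plane) (K : ℝ) (h : Plane → ℝ) : Prop :=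
  ∃ j, IsBoundedPrimitive E K h j

/-- The segments between the points of a bounded convex set sweep it out with bounded density. -/
theorem map_segment_le {T : Set Plane} (hT : Convex ℝ T) (hTc : IsCompact T) :
    ((((volume.restrict T).prod (volume.restrict T)).prod
      (volume.restrict (Icc (0 : ℝ) 1))).map fun a => a.1.2 + a.2 • (a.1.1 - a.1.2)) ≤
      (4 * volume T).toNNReal • volume.restrict (interior T) := by
  have hΦ : Measurable fun a : (Plane × Plane) × ℝ => a.1.2 + a.2 • (a.1.1 - a.1.2) := by fun_prop
  have hfin : Fact (volume T < ⊤) := ⟨hTc.measure_lt_top⟩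
  have hTm : MeasurableSet T := hTc.measurableSet
  have hslice : ∀ (A : Set Plane) (t : ℝ), 1 / 2 ≤ t → ∀ y : Plane,
      volume {x : Plane | y + t • x ∈ A} ≤ 4 * volume A := by
    intro A t ht y
    have : {x : Plane | y + t • x ∈ A} = (fun x => t • x) ⁻¹' ((fun x => y + x) ⁻¹' A) := rfl
    rw [this, Measure.addHaar_preimage_smul _ (by linarith), measure_preimage_add]
    gcongr
    rw [show (4 : ℝ≥0∞) = ENNReal.ofReal 4 by simp]
    refine ENNReal.ofReal_le_ofReal ?_
    rw [finrank_euclideanSpace, Fintype.card_fin, abs_of_nonneg (by positivity),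
      inv_le_comm₀ (by positivity) (by norm_num)]
    nlinarith
  have hpair : ∀ A : Set Plane, MeasurableSet A → ∀ t ∈ Icc (0 : ℝ) 1,
      ((volume.restrict T).prod (volume.restrict T)) {q : Plane × Plane |
        q.2 + t • (q.1 - q.2) ∈ A} ≤ 4 * volume A * volume T := by
    intro A hA t ht
    have hm : MeasurableSet {q : Plane × Plane | q.2 + t • (q.1 - q.2) ∈ A} :=
      (show Measurable fun q : Plane × Plane => q.2 + t • (q.1 - q.2) by fun_prop) hA
    -- One of `t`, `1 - t` is at least 1/2. Freezing the other endpoint leaves a homothety of that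
    -- ratio, whose Jacobian is at least 1/4; hence the constant 4, uniformly in `t`.
    rcases le_total (1 / 2) t with h | h
    · rw [Measure.prod_apply_symm hm]
      calc _ ≤ ∫⁻ _ in T, 4 * volume A := by
            refine lintegral_mono fun y => (Measure.restrict_apply_le _ _).trans ?_
            refine le_trans (le_of_eq ?_) (hslice A t h (y - t • y))
            congr 1
            ext x
            simp only [mem_preimage, mem_ofPred_eq]
            rw [show y + t • (x - y) = y - t • y + t • x by rw [smul_sub]; abel]
        _ = _ := by simp
    · rw [Measure.prod_apply hm]
      calc _ ≤ ∫⁻ _ in T, 4 * volume A := by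
            refine lintegral_mono fun x => (Measure.restrict_apply_le _ _).trans ?_
            refine le_trans (le_of_eq ?_) (hslice A (1 - t) (by linarith) (t • x))
            congr 1
            ext y
            simp only [mem_preimage, mem_ofPred_eq]
            rw [show y + t • (x - y) = t • x + (1 - t) • y by
              rw [smul_sub, sub_smul, one_smul]; abel]
        _ = _ := by simp
  refine Measure.le_iff.2 fun A hA => ?_
  rw [Measure.map_apply hΦ hA]
  have hsub : ((((volume.restrict T).prod (volume.restrict T)).prod
      (volume.restrict (Icc (0 : ℝ) 1)))) ((fun a => a.1.2 + a.2 • (a.1.1 - a.1.2)) ⁻¹' A) ≤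
      ((((volume.restrict T).prod (volume.restrict T)).prod
      (volume.restrict (Icc (0 : ℝ) 1)))) ((fun a => a.1.2 + a.2 • (a.1.1 - a.1.2)) ⁻¹' (A ∩ T)) := by
    refine measure_mono_ae ?_
    rw [Measure.prod_restrict, Measure.prod_restrict]
    filter_upwards [ae_restrict_mem ((hTm.prod hTm).prod measurableSet_Icc)] with a ha haA
    refine ⟨haA, ?_⟩
    have := hT ha.1.1 ha.1.2 ha.2.1 (sub_nonneg.2 ha.2.2) (by ring)
    convert this using 1
    change a.1.2 + a.2 • (a.1.1 - a.1.2) = _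
    rw [smul_sub, sub_smul, one_smul]; abel
  refine hsub.trans ?_
  rw [Measure.prod_apply_symm (hΦ (hA.inter hTm))]
  calc _ ≤ ∫⁻ _ in Icc (0 : ℝ) 1, 4 * volume (A ∩ T) * volume T := by
        refine setLIntegral_mono measurable_const fun t ht => ?_
        exact hpair _ (hA.inter hTm) t ht
    _ = 4 * volume T * volume (A ∩ T) := by simp; ring
    -- The boundary of a convex set is null, so the density can be taken on the interior. This
    -- matters later: tiles are disjoint only up to their boundaries.
    _ ≤ 4 * volume T * volume (A ∩ interior T) := by
        refine mul_le_mul_right ?_ _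
        have : A ∩ T ⊆ A ∩ interior T ∪ frontier T := fun x hx => by
          by_cases h : x ∈ interior T
          · exact Or.inl ⟨hx.1, h⟩
          · exact Or.inr ⟨subset_closure hx.2, h⟩
        refine (measure_mono this).trans ((measure_union_le _ _).trans ?_)
        rw [hT.addHaar_frontier volume, add_zero]
    _ = _ := by
        have : 4 * volume T ≠ ⊤ := ENNReal.mul_ne_top (by simp) hfin.1.ne
        rw [Measure.smul_apply, Measure.restrict_apply hA, ENNReal.smul_def,
          ENNReal.coe_toNNReal this, smul_eq_mul]

theorem integral_fderiv_segment {f : Plane → ℝ} (hf : ContDiff ℝ ∞ f) (y v : Plane) :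
    ∫ t in Icc (0 : ℝ) 1, fderiv ℝ f (y + t • v) v = f (y + v) - f y := by
  rw [integral_Icc_eq_integral_Ioc, ← intervalIntegral.integral_of_le zero_le_one]
  have hd : Differentiable ℝ f := hf.differentiable (by simp)
  have h : ∀ t : ℝ, HasDerivAt (fun t : ℝ => f (y + t • v)) (fderiv ℝ f (y + t • v) v) t := by
    intro t
    have h1 : HasDerivAt (fun t : ℝ => y + t • v) v t := by
      simpa using ((hasDerivAt_id t).smul_const v).const_add y
    exact (hd (y + t • v)).hasFDerivAt.comp_hasDerivAt t h1
  rw [intervalIntegral.integral_eq_sub_of_hasDerivAt (fun t _ => h t)]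
  · simp
  · refine Continuous.intervalIntegrable ?_ _ _
    have := hf.continuous_fderiv (by simp)
    fun_prop

theorem continuous_fderiv_apply {f : Plane → ℝ} (hf : ContDiff ℝ ∞ f) (v : Plane) :
    Continuous fun z => fderiv ℝ f z v := by
  have := hf.continuous_fderiv (by simp)
  fun_prop

theorem hasCompactSupport_fderiv_apply {f : Plane → ℝ} (hc : HasCompactSupport f) (v : Plane) :
    HasCompactSupport fun z => fderiv ℝ f z v :=
  (hc.fderiv ℝ).comp_left (g := fun L : Plane →L[ℝ] ℝ => L v) (by simp)

theorem integrable_fderiv_apply {f : Plane → ℝ} (hf : ContDiff ℝ ∞ f) (hc : HasCompactSupport f)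
    (v : Plane) : Integrable fun z => fderiv ℝ f z v :=
  (continuous_fderiv_apply hf v).integrable_of_hasCompactSupport
    (hasCompactSupport_fderiv_apply hc v)

/-- Reduces pairings of a gradient with a vector field to the scalar density lemmas. -/
theorem fderiv_apply_eq_sum (f : Plane → ℝ) (z v : Plane) :
    fderiv ℝ f z v = ∑ i, fderiv ℝ f z (EuclideanSpace.single i 1) * v i := by
  conv_lhs => rw [← (EuclideanSpace.basisFun (Fin 2) ℝ).sum_repr v]
  simp [mul_comm]

/-- A bounded density of zero total mass on a compact convex set is the divergence of a bounded
field supported in its interior. -/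
theorem exists_hasBoundedPrimitive_of_integral_eq_zero {T : Set Plane} (hT : Convex ℝ T)
    (hTc : IsCompact T) (hpos : 0 < volume.real T) {h : Plane → ℝ} (hm : Measurable h) {M : ℝ}
    (hb : ∀ x, |h x| ≤ M) (h0 : ∀ x ∉ T, h x = 0) (hI : ∫ x, h x = 0) :
    ∃ K, HasBoundedPrimitive (interior T) K h := by
  have hTm : MeasurableSet T := hTc.measurableSet
  have hfin : Fact (volume T < ⊤) := ⟨hTc.measure_lt_top⟩
  have hM : 0 ≤ M := (abs_nonneg _).trans (hb 0)
  set V := volume.real T with hV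
  set μ₂ : Measure (Plane × Plane) := (volume.restrict T).prod (volume.restrict T) with hμ₂
  set μ := μ₂.prod (volume.restrict (Icc (0 : ℝ) 1)) with hμ
  let Φ : (Plane × Plane) × ℝ → Plane := fun a => a.1.2 + a.2 • (a.1.1 - a.1.2)
  have hΦ : Measurable Φ := by fun_prop
  -- The charge `h x` is transported from `x` along the segment to every `y` in `T`: this is a
  -- current with velocity `x - y` and weight `h x`. The indicator keeps the weight bounded outside
  -- `T`.
  let w : Fin 2 → (Plane × Plane) × ℝ → ℝ := fun i =>
    indicator ((T ×ˢ T) ×ˢ univ) fun a => h a.1.1 * (a.1.1 - a.1.2) i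
  have hw : ∀ i, Measurable (w i) := fun i =>
    Measurable.indicator (by fun_prop) ((hTm.prod hTm).prod MeasurableSet.univ)
  have hwb : ∀ i a, |w i a| ≤ (M * diam T).toNNReal := by
    intro i a
    rw [Real.coe_toNNReal _ (by positivity)]
    by_cases ha : a ∈ (T ×ˢ T) ×ˢ (univ : Set ℝ)
    · simp only [w, indicator_of_mem ha, abs_mul]
      refine mul_le_mul (hb _) ?_ (abs_nonneg _) hM
      have h1 := PiLp.norm_apply_le (a.1.1 - a.1.2) i
      rw [← dist_eq_norm, Real.norm_eq_abs] at h1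
      exact h1.trans (dist_le_diam_of_mem hTc.isBounded ha.1.1 ha.1.2)
    · simp only [w, indicator_of_notMem ha, abs_zero]
      positivity
  have hseg := map_segment_le hT hTc
  choose ρ hρm hρb hρ using fun i => exists_bounded_density hΦ hseg (hw i) (hwb i)
  set D : ℝ := 2 * ((M * diam T).toNNReal * (4 * volume T).toNNReal) with hD
  -- The field is the average over the endpoint `y` of these currents, with components given by the
  -- pushforward densities `ρ i`. Each is at most `D` in absolute value, so the norm is at most `D +
  -- D` before division by the area.
  refine ⟨V⁻¹ * (D + D), indicator (interior T) fun z => V⁻¹ • WithLp.toLp 2 fun i => ρ i z, ?_, ?_, ?_, ?_⟩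
  · refine Measurable.indicator ?_ isOpen_interior.measurableSet
    have : Measurable fun z => fun i => ρ i z := measurable_pi_iff.2 hρm
    exact Measurable.const_smul ((WithLp.measurable_toLp 2 (Fin 2 → ℝ)).comp this) (V⁻¹ : ℝ)
  · intro z
    refine (norm_indicator_le_norm_self _ _).trans ?_
    rw [norm_smul, norm_inv, Real.norm_of_nonneg hpos.le]
    gcongr
    refine (EuclideanSpace.norm_eq _).trans_le ?_
    have h1 := hρb 0 z
    have h2 := hρb 1 z
    have hD0 : 0 ≤ D := by positivity
    rw [Real.sqrt_le_left (by positivity), Fin.sum_univ_two]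
    simp only [Real.norm_eq_abs]
    have := abs_nonneg (ρ 0 z)
    have := abs_nonneg (ρ 1 z)
    nlinarith
  · intro z hz
    simp [hz]
  · intro f hf hc
    have hg := fun i => integrable_fderiv_apply hf hc (EuclideanSpace.single i 1)
    have hgc := fun i => continuous_fderiv_apply hf (EuclideanSpace.single i 1)
    have hgb : ∀ i, ∃ C, ∀ z, ‖fderiv ℝ f z (EuclideanSpace.single i 1)‖ ≤ C := fun i =>
      (hgc i).bounded_above_of_compact_support (hasCompactSupport_fderiv_apply hc _)
    have hwi : ∀ i, Integrable (w i) μ := fun i =>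
      Integrable.of_bound (hw i).aestronglyMeasurable _ (ae_of_all _ (hwb i))
    have hint : ∀ i, Integrable
        (fun a => fderiv ℝ f (Φ a) (EuclideanSpace.single i 1) * w i a) μ := fun i => by
      obtain ⟨C, hC⟩ := hgb i
      exact (hwi i).bdd_mul (((hgc i).measurable.comp hΦ).aestronglyMeasurable)
        (ae_of_all _ fun a => hC (Φ a))
    have hsum : ∀ᵐ a ∂μ, ∑ i, fderiv ℝ f (Φ a) (EuclideanSpace.single i 1) * w i a =
        h a.1.1 * fderiv ℝ f (Φ a) (a.1.1 - a.1.2) := by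
      rw [hμ, hμ₂, Measure.prod_restrict, Measure.prod_restrict]
      filter_upwards [ae_restrict_mem ((hTm.prod hTm).prod measurableSet_Icc)] with a ha
      have ha' : a ∈ (T ×ˢ T) ×ˢ (univ : Set ℝ) := ⟨ha.1, trivial⟩
      rw [fderiv_apply_eq_sum f _ (a.1.1 - a.1.2), Finset.mul_sum]
      refine Finset.sum_congr rfl fun i _ => ?_
      simp only [w, indicator_of_mem ha']
      ring
    have hfi : Integrable f := hf.continuous.integrable_of_hasCompactSupport hc
    have hhi : IntegrableOn h T :=
      Measure.integrableOn_of_bounded hfin.1.ne hm.aestronglyMeasurable (M := M) (ae_of_all _ hb)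
    obtain ⟨B, hB⟩ := hf.continuous.bounded_above_of_compact_support hc
    have hfh : IntegrableOn (fun x => h x * f x) T :=
      hhi.mul_bdd hf.continuous.aestronglyMeasurable (ae_of_all _ hB)
    have hT0 : ∀ u : Plane → ℝ, (∀ x ∉ T, u x = 0) → ∫ x in T, u x = ∫ x, u x := fun u hu =>
      setIntegral_eq_integral_of_forall_compl_eq_zero hu
    calc ∫ x, fderiv ℝ f x ((indicator (interior T) fun z => V⁻¹ • WithLp.toLp 2 fun i => ρ i z) x)
        = ∫ x in interior T, V⁻¹ * ∑ i, fderiv ℝ f x (EuclideanSpace.single i 1) * ρ i x := by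
          rw [← integral_indicator isOpen_interior.measurableSet]
          congr 1
          ext x
          by_cases hx : x ∈ interior T
          · simp only [indicator_of_mem hx, map_smul, smul_eq_mul]
            rw [fderiv_apply_eq_sum f]
          · simp [indicator_of_notMem hx]
      _ = V⁻¹ * ∑ i, ∫ a, fderiv ℝ f (Φ a) (EuclideanSpace.single i 1) * w i a ∂μ := by
          rw [integral_const_mul, integral_finsetSum]
          · congr 1
            refine Finset.sum_congr rfl fun i _ => ?_
            exact (hρ i _ (hgc i).measurable (hg i).integrableOn).symm
          · intro i _
            exact (hg i).integrableOn.mul_bdd (hρm i).aestronglyMeasurable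
              (ae_of_all _ (hρb i))
      _ = V⁻¹ * ∫ a, h a.1.1 * fderiv ℝ f (Φ a) (a.1.1 - a.1.2) ∂μ := by
          rw [← integral_finsetSum _ fun i _ => hint i, integral_congr_ae hsum]
      -- Integrating in `t` along the segment gives the difference of the values of `f` at its ends.
      _ = V⁻¹ * ∫ q, h q.1 * (f q.1 - f q.2) ∂μ₂ := by
          have hi : Integrable (fun a => h a.1.1 * fderiv ℝ f (Φ a) (a.1.1 - a.1.2)) μ :=
            (integrable_finsetSum _ fun i _ => hint i).congr hsum
          rw [hμ, integral_prod _ hi]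
          congr 1
          refine integral_congr_ae (ae_of_all _ fun q => ?_)
          simp only [Φ, integral_const_mul, integral_fderiv_segment hf, add_sub_cancel]
      _ = V⁻¹ * (∫ x in T, ∫ y in T, (h x * f x - h x * f y)) := by
          rw [hμ₂, integral_prod]
          · simp only [mul_sub]
          · simp only [mul_sub]
            exact (hfh.mul_prod (integrable_const (1 : ℝ)) |>.congr
              (ae_of_all _ fun q => by simp)).sub (hhi.mul_prod hfi.integrableOn)
      -- The term with `f y` factors through the total charge, which is zero.
      _ = V⁻¹ * (V * ∫ x, f x * h x) := by
          congr 1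
          have : ∀ x, ∫ y in T, (h x * f x - h x * f y) =
              V * (h x * f x) - h x * ∫ y in T, f y := fun x => by
            rw [integral_sub (integrable_const _) (hfi.integrableOn.const_mul _)]
            simp only [integral_const_mul, setIntegral_const, smul_eq_mul, hV]
            ring
          simp only [this]
          rw [integral_sub (hfh.const_mul _) (hhi.mul_const _), integral_const_mul,
            integral_mul_const, hT0 h h0, hI, zero_mul, sub_zero, hT0 _ fun x hx => by simp [h0 x hx]]
          simp only [mul_comm]
      _ = ∫ x, f x * h x := by
          rw [← mul_assoc, inv_mul_cancel₀ hpos.ne', one_mul]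

/-! ### Operations on bounded primitives -/

theorem integral_comp_isometry (e : Plane ≃ᵃⁱ[ℝ] Plane) (u : Plane → ℝ) :
    ∫ x, u (e x) = ∫ x, u x := by
  have h : ∀ x, e x = e.linearIsometryEquiv x + e 0 := fun x => by
    have := e.map_vadd 0 x
    simpa using this
  rw [show (fun x => u (e x)) = fun x => u (e.linearIsometryEquiv x + e 0) from
    funext fun x => by rw [← h x], (e.linearIsometryEquiv.measurePreserving).integral_comp
    e.linearIsometryEquiv.toHomeomorph.measurableEmbedding (fun y => u (y + e 0)),
    integral_add_right_eq_self]

theorem measure_image_isometry (e : Plane ≃ᵃⁱ[ℝ] Plane) (s : Set Plane) :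
    volume (e '' s) = volume s := by
  have h : ∀ x, e x = e 0 + e.linearIsometryEquiv x := fun x => by
    have := e.map_vadd 0 x
    rw [add_comm]
    simpa using this
  rw [show e '' s = (fun y => e 0 + y) '' (e.linearIsometryEquiv '' s) by
    rw [image_image]; exact image_congr fun x _ => h x, image_add_left, measure_preimage_add]
  have := (e.linearIsometryEquiv.symm.measurePreserving).measure_preimage_equiv
    (f := e.linearIsometryEquiv.symm.toHomeomorph.toMeasurableEquiv) s
  rw [← this]
  congr 1
  exact e.linearIsometryEquiv.toEquiv.image_eq_preimage_symm s

theorem IsBoundedPrimitive.integrable {E : Set Plane} {K : ℝ} {h : Plane → ℝ} {j : Plane → Plane}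
    (H : IsBoundedPrimitive E K h j) {f : Plane → ℝ} (hf : ContDiff ℝ ∞ f)
    (hc : HasCompactSupport f) : Integrable fun x => fderiv ℝ f x (j x) := by
  simp_rw [fun x => fderiv_apply_eq_sum f x (j x)]
  refine integrable_finsetSum _ fun i _ => ?_
  refine (integrable_fderiv_apply hf hc _).mul_bdd (c := K) ?_ (ae_of_all _ fun x => ?_)
  · have := H.measurable
    exact Measurable.aestronglyMeasurable (by fun_prop)
  · exact (PiLp.norm_apply_le (j x) i).trans (H.norm_le x)

theorem integrable_mul_of_locallyIntegrable {f h : Plane → ℝ} (hf : Continuous f)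
    (hc : HasCompactSupport f) (hh : LocallyIntegrable h) : Integrable fun x => f x * h x := by
  simpa using hh.integrable_smul_left_of_hasCompactSupport hf hc

namespace HasBoundedPrimitive

variable {E : Set Plane} {K L : ℝ} {h k : Plane → ℝ}

theorem congr_ae (H : HasBoundedPrimitive E K h) (hk : h =ᵐ[volume] k) :
    HasBoundedPrimitive E K k := by
  obtain ⟨j, hj⟩ := H
  refine ⟨j, hj.measurable, hj.norm_le, hj.eq_zero, fun f hf hc => ?_⟩
  rw [hj.weak_eq f hf hc]
  exact integral_congr_ae (hk.mono fun x hx => by simp only [hx])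

theorem mono (H : HasBoundedPrimitive E K h) (hKL : K ≤ L) : HasBoundedPrimitive E L h := by
  obtain ⟨j, hj⟩ := H
  exact ⟨j, hj.measurable, fun x => (hj.norm_le x).trans hKL, hj.eq_zero, hj.weak_eq⟩

theorem zero (E : Set Plane) : HasBoundedPrimitive E 0 0 :=
  ⟨0, measurable_const, by simp, by simp, by simp⟩

theorem add (H : HasBoundedPrimitive E K h) (H' : HasBoundedPrimitive E L k)
    (hh : LocallyIntegrable h) (hk : LocallyIntegrable k) :
    HasBoundedPrimitive E (K + L) (fun x => h x + k x) := by
  obtain ⟨j, hj⟩ := H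
  obtain ⟨l, hl⟩ := H'
  refine ⟨fun x => j x + l x, hj.measurable.add hl.measurable,
    fun x => (norm_add_le _ _).trans (add_le_add (hj.norm_le x) (hl.norm_le x)),
    fun x hx => by simp [hj.eq_zero x hx, hl.eq_zero x hx], fun f hf hc => ?_⟩
  simp only [map_add, mul_add]
  rw [integral_add (hj.integrable hf hc) (hl.integrable hf hc), hj.weak_eq f hf hc,
    hl.weak_eq f hf hc, integral_add (integrable_mul_of_locallyIntegrable hf.continuous hc hh)
      (integrable_mul_of_locallyIntegrable hf.continuous hc hk)]

theorem const_mul (H : HasBoundedPrimitive E K h) (c : ℝ) :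
    HasBoundedPrimitive E (|c| * K) (fun x => c * h x) := by
  obtain ⟨j, hj⟩ := H
  refine ⟨fun x => c • j x, hj.measurable.const_smul c, fun x => ?_,
    fun x hx => by simp [hj.eq_zero x hx], fun f hf hc => ?_⟩
  · rw [norm_smul, Real.norm_eq_abs]
    exact mul_le_mul_of_nonneg_left (hj.norm_le x) (abs_nonneg c)
  · simp only [map_smul, smul_eq_mul, mul_left_comm _ c]
    rw [integral_const_mul, integral_const_mul, hj.weak_eq f hf hc]

/-- The field `s • j (s⁻¹ • x)` has as divergence that of `j` evaluated at `s⁻¹ • x`. The price of a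
dilation is one factor `s` in the bound, to be beaten by the decay of the charge density. -/
theorem dilate (H : HasBoundedPrimitive univ K h) {s : ℝ} (hs : 0 < s) :
    HasBoundedPrimitive univ (s * K) (fun x => h (s⁻¹ • x)) := by
  obtain ⟨j, hj⟩ := H
  refine ⟨fun x => s • j (s⁻¹ • x),
    (hj.measurable.comp (measurable_const_smul (s⁻¹ : ℝ))).const_smul s, fun x => ?_, by simp,
    fun f hf hc => ?_⟩
  · rw [norm_smul, Real.norm_of_nonneg hs.le]
    exact mul_le_mul_of_nonneg_left (hj.norm_le _) hs.le
  · have hf' : ContDiff ℝ ∞ fun x => f (s • x) := hf.comp (contDiff_const_smul s)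
    have hc' : HasCompactSupport fun x => f (s • x) := hc.comp_smul hs.ne'
    have hd : ∀ x v, fderiv ℝ (fun x => f (s • x)) x v = fderiv ℝ f (s • x) (s • v) := fun x v => by
      have h1 : HasFDerivAt f (fderiv ℝ f (s • x)) (s • x) :=
        (hf.differentiable (by simp) _).hasFDerivAt
      have h2 : HasFDerivAt (fun x : Plane => s • x) (s • ContinuousLinearMap.id ℝ Plane) x :=
        (hasFDerivAt_id x).const_smul s
      have h3 : fderiv ℝ (fun x => f (s • x)) x = _ := (h1.comp x h2).fderiv
      rw [h3]
      simp
    have key := hj.weak_eq _ hf' hc'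
    simp only [hd] at key
    have e1 := Measure.integral_comp_inv_smul volume
      (fun x => fderiv ℝ f (s • x) (s • j x)) s
    have e2 := Measure.integral_comp_inv_smul volume (fun x => f (s • x) * h x) s
    simp only [smul_inv_smul₀ hs.ne'] at e1 e2
    rw [e1, e2, key]

/-- The field is carried along and turned by the linear part of the isometry, which preserves norms
and divergences, also when orientation is reversed. -/
theorem image_isometry (H : HasBoundedPrimitive E K h) (e : Plane ≃ᵃⁱ[ℝ] Plane) :
    HasBoundedPrimitive (e '' E) K (fun x => h (e.symm x)) := by
  obtain ⟨j, hj⟩ := H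
  refine ⟨fun x => e.linearIsometryEquiv (j (e.symm x)),
    e.linearIsometryEquiv.continuous.measurable.comp
      (hj.measurable.comp e.symm.continuous.measurable), fun x => ?_, fun x hx => ?_,
    fun f hf hc => ?_⟩
  · simpa using hj.norm_le _
  · rw [hj.eq_zero, map_zero]
    exact fun h' => hx ⟨_, h', by simp⟩
  · have he : ∀ x, e x = e.linearIsometryEquiv x + e 0 := fun x => by
      simpa using e.map_vadd 0 x
    have hd0 : ∀ x, HasFDerivAt e
        (e.linearIsometryEquiv.toContinuousLinearEquiv : Plane →L[ℝ] Plane) x := fun x => by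
      have h2 := (e.linearIsometryEquiv.toContinuousLinearEquiv.hasFDerivAt (x := x)).add_const (e 0)
      exact h2.congr_of_eventuallyEq (Eventually.of_forall he)
    have hce : ContDiff ℝ ∞ e := by
      have : (e : Plane → Plane) = fun x => e.linearIsometryEquiv x + e 0 := funext he
      rw [this]
      exact e.linearIsometryEquiv.contDiff.add contDiff_const
    have hf' : ContDiff ℝ ∞ fun x => f (e x) := hf.comp hce
    have hc' : HasCompactSupport fun x => f (e x) :=
      hc.comp_homeomorph e.toHomeomorph
    have hd : ∀ x v, fderiv ℝ (fun x => f (e x)) x v =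
        fderiv ℝ f (e x) (e.linearIsometryEquiv v) := fun x v => by
      have h1 : HasFDerivAt f (fderiv ℝ f (e x)) (e x) :=
        (hf.differentiable (by simp) _).hasFDerivAt
      have h3 : fderiv ℝ (fun x => f (e x)) x = _ := (h1.comp x (hd0 x)).fderiv
      rw [h3]
      simp
    have key := hj.weak_eq _ hf' hc'
    simp only [hd] at key
    rw [← integral_comp_isometry e, ← integral_comp_isometry e (fun x => f x * h (e.symm x))]
    simpa using key

/-- Primitives supported in pairwise disjoint sets can be added without loss in the bound. -/
theorem sum_of_disjoint {ι : Type*} [Fintype ι] {E : ι → Set Plane} {h : ι → Plane → ℝ}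
    (hK : 0 ≤ K) (hE : Pairwise fun a b => Disjoint (E a) (E b))
    (hh : ∀ a, LocallyIntegrable (h a)) (H : ∀ a, HasBoundedPrimitive (E a) K (h a)) :
    HasBoundedPrimitive univ K (fun x => ∑ a, h a x) := by
  choose j hj using H
  refine ⟨fun x => ∑ a, j a x, Finset.measurable_sum _ fun a _ => (hj a).measurable, fun x => ?_,
    by simp, fun f hf hc => ?_⟩
  · by_cases hx : ∃ a, x ∈ E a
    · obtain ⟨a, ha⟩ := hx
      rw [Finset.sum_eq_single a (fun b _ hb => (hj b).eq_zero x fun hxb =>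
        (hE hb).le_bot ⟨hxb, ha⟩) (by simp)]
      exact (hj a).norm_le x
    · push Not at hx
      rw [Finset.sum_eq_zero fun a _ => (hj a).eq_zero x (hx a), norm_zero]
      exact hK
  · simp only [map_sum, Finset.mul_sum]
    rw [integral_finsetSum _ fun a _ => (hj a).integrable hf hc, integral_finsetSum _ fun a _ =>
      integrable_mul_of_locallyIntegrable hf.continuous hc (hh a)]
    exact Finset.sum_congr rfl fun a _ => (hj a).weak_eq f hf hc

end HasBoundedPrimitive

/-! ### Weak limits of bounded fields -/

/-- A bounded sequence in a Hilbert space has a weak limit along the hyperfilter. -/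
theorem exists_weak_limit {H : Type*} [NormedAddCommGroup H] [InnerProductSpace ℝ H]
    [CompleteSpace H] (u : ℕ → H) {C : ℝ} (hu : ∀ n, ‖u n‖ ≤ C) :
    ∃ v, ∀ y, Tendsto (fun n => inner ℝ (u n) y) (hyperfilter ℕ) (𝓝 (inner ℝ v y)) := by
  -- Banach-Alaoglu applied to an ultrafilter: convergence holds along the hyperfilter for all test
  -- vectors at once, with no separability and no extraction of subsequences.
  let g : ℕ → WeakDual ℝ H := fun n => StrongDual.toWeakDual (InnerProductSpace.toDual ℝ H (u n))
  obtain ⟨l, -, hl⟩ := (WeakDual.isCompact_closedBall (𝕜 := ℝ) (E := H) 0 C).ultrafilter_le_nhds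
    ((hyperfilter ℕ).map g) (by
      refine le_principal_iff.2 (Filter.mem_map.2 (Filter.mem_of_superset univ_mem fun n _ => ?_))
      simpa [g] using hu n)
  refine ⟨(InnerProductSpace.toDual ℝ H).symm (WeakDual.toStrongDual l), fun y => ?_⟩
  have h1 : Tendsto g (hyperfilter ℕ) (𝓝 l) := hl
  have h2 := ((WeakDual.eval_continuous y).tendsto l).comp h1
  rw [InnerProductSpace.toDual_symm_apply]
  exact h2

/-- Weak limits of divergences of uniformly bounded fields are divergences of bounded fields. -/
theorem HasBoundedPrimitive.of_tendsto {K : ℝ} {h : ℕ → Plane → ℝ} {h' : Plane → ℝ}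
    (hn : ∀ n, HasBoundedPrimitive univ K (h n))
    (hlim : ∀ f : Plane → ℝ, ContDiff ℝ ∞ f → HasCompactSupport f →
      Tendsto (fun n => ∫ x, f x * h n x) atTop (𝓝 (∫ x, f x * h' x))) :
    HasBoundedPrimitive univ K h' := by
  choose j hj using hn
  have hK : 0 ≤ K := (norm_nonneg _).trans ((hj 0).norm_le 0)
  -- The exponent exceeds the dimension 2, so the weighted measure is finite and bounded fields form
  -- a bounded set in its L² space. The weight is positive, so null sets are the same as for
  -- Lebesgue measure.
  let w : Plane → ℝ := fun x => (1 + ‖x‖) ^ (-3 : ℝ)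
  have hw0 : ∀ x, 0 < w x := fun x => Real.rpow_pos_of_pos (by positivity) _
  have hwc : Continuous w := by
    refine Continuous.rpow_const (by fun_prop) fun x => Or.inl ?_
    positivity
  have hwi : Integrable w :=
    integrable_one_add_norm (by rw [finrank_euclideanSpace, Fintype.card_fin]; norm_num)
  let wn : Plane → ℝ≥0 := fun x => (w x).toNNReal
  have hwn : Measurable wn := hwc.measurable.real_toNNReal
  have hwnw : ∀ x, (wn x : ℝ) = w x := fun x => Real.coe_toNNReal _ (hw0 x).le
  let μ : Measure Plane := volume.withDensity fun x => (wn x : ℝ≥0∞)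
  have hfin : IsFiniteMeasure μ := by
    refine isFiniteMeasure_withDensity ?_
    have := hwi.lintegral_lt_top
    exact this.ne
  have hac : volume ≪ μ := withDensity_absolutelyContinuous' (by fun_prop) (ae_of_all _ fun x => by
    have := hw0 x
    simp [wn, this])
  have hint : ∀ u : Plane → ℝ, ∫ x, u x ∂μ = ∫ x, w x * u x := fun u => by
    rw [integral_withDensity_eq_integral_smul hwn]
    simp [NNReal.smul_def, hwnw]
  have hJm : ∀ n, MemLp (j n) 2 μ := fun n =>
    MemLp.of_bound (hj n).measurable.aestronglyMeasurable K (ae_of_all _ (hj n).norm_le)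
  let J : ℕ → Lp Plane 2 μ := fun n => (hJm n).toLp (j n)
  have hJ : ∀ n, J n =ᵐ[μ] j n := fun n => (hJm n).coeFn_toLp
  have hJb : ∀ n, ‖J n‖ ≤ (measureUnivNNReal μ : ℝ) ^ (2 : ℝ≥0∞).toReal⁻¹ * K := fun n => by
    refine Lp.norm_le_of_ae_bound hK (f := J n) ?_
    filter_upwards [hJ n] with x hx
    rw [hx]; exact (hj n).norm_le x
  obtain ⟨V, hV⟩ := exists_weak_limit J hJb
  have hVsm := Lp.stronglyMeasurable V
  have hVm : Measurable V := hVsm.measurable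
  have hinner : ∀ {y : Plane → Plane} (hy : MemLp y 2 μ) (v : Lp Plane 2 μ),
      inner ℝ v (hy.toLp y) = ∫ x, inner ℝ (v x) (y x) ∂μ := fun {y} hy v => by
    rw [L2.inner_def]
    refine integral_congr_ae ?_
    filter_upwards [hy.coeFn_toLp] with x hx
    rw [hx]
  have hinner_int : ∀ {y : Plane → Plane} (_ : MemLp y 2 μ) (v : Lp Plane 2 μ),
      Integrable (fun x => inner ℝ (v x) (y x)) μ := fun {y} hy v => by
    refine (L2.integrable_inner (𝕜 := ℝ) v (hy.toLp y)).congr ?_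
    filter_upwards [hy.coeFn_toLp] with x hx
    rw [hx]
  let A : Set Plane := {x | K < ‖V x‖}
  have hA : MeasurableSet A := measurableSet_lt measurable_const hVm.norm
  -- Testing against the direction of `V` on the set where its norm exceeds `K` shows that this set
  -- is null, so the pointwise bound survives the weak limit.
  let y : Plane → Plane := A.indicator fun x => ‖V x‖⁻¹ • V x
  have hyn : ∀ x, ‖y x‖ ≤ A.indicator 1 x := fun x => by
    by_cases hx : x ∈ A
    · have : 0 < ‖V x‖ := hK.trans_lt hx
      simp [y, hx, norm_smul, this.ne']
    · simp [y, hx]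
  have hym : Measurable y := (hVm.norm.inv.smul hVm).indicator hA
  have hy : MemLp y 2 μ := MemLp.of_bound hym.aestronglyMeasurable 1 (ae_of_all _ fun x =>
    (hyn x).trans (indicator_le_self' (by simp) x))
  have hbd : inner ℝ V (hy.toLp y) ≤ K * μ.real A := by
    refine le_of_tendsto (hV (hy.toLp y)) (Eventually.of_forall fun n => ?_)
    rw [hinner]
    calc ∫ x, inner ℝ (J n x) (y x) ∂μ ≤ ∫ x, A.indicator (fun _ => K) x ∂μ := by
          refine integral_mono_ae (hinner_int hy _) ((integrable_const K).indicator hA) ?_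
          filter_upwards [hJ n] with x hx
          rw [hx]
          refine (real_inner_le_norm _ _).trans ?_
          refine (mul_le_mul ((hj n).norm_le x) (hyn x) (norm_nonneg _) hK).trans (le_of_eq ?_)
          by_cases hxA : x ∈ A <;> simp [hxA]
      _ = K * μ.real A := by
          rw [integral_indicator hA]; simp [mul_comm]
  rw [hinner] at hbd
  have hVy : ∀ x, inner ℝ (V x) (y x) = A.indicator (fun x => ‖V x‖) x := fun x => by
    by_cases hx : x ∈ A
    · have : 0 < ‖V x‖ := hK.trans_lt hx
      simp only [y, indicator_of_mem hx, inner_smul_right, real_inner_self_eq_norm_sq]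
      field_simp
    · simp [y, hx]
  have hVAi : Integrable (A.indicator fun x => ‖V x‖) μ :=
    (hinner_int hy V).congr (ae_of_all _ hVy)
  have hμA : μ A = 0 := by
    have h1 : ∫ x, A.indicator (fun x => ‖V x‖ - K) x ∂μ ≤ 0 := by
      have : (A.indicator fun x => ‖V x‖ - K) =
          fun x => A.indicator (fun x => ‖V x‖) x - A.indicator (fun _ => K) x := by
        ext x; by_cases hx : x ∈ A <;> simp [hx]
      rw [this, integral_sub hVAi ((integrable_const K).indicator hA), integral_indicator hA
        (f := fun _ => K)]
      simp only [hVy] at hbd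
      simpa [mul_comm] using hbd
    have h0 : ∀ x, 0 ≤ A.indicator (fun x => ‖V x‖ - K) x := fun x =>
      indicator_nonneg (fun x hx => sub_nonneg.2 (le_of_lt hx)) x
    have hi : Integrable (A.indicator fun x => ‖V x‖ - K) μ := by
      refine (hVAi.sub ((integrable_const K).indicator hA)).congr (ae_of_all _ fun x => ?_)
      by_cases hx : x ∈ A <;> simp [hx]
    have h2 := (integral_eq_zero_iff_of_nonneg h0 hi).1 (le_antisymm h1 (integral_nonneg h0))
    refine measure_mono_null (fun x hx => ?_) (ae_iff.1 h2)
    change ¬ A.indicator (fun x => ‖V x‖ - K) x = 0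
    rw [indicator_of_mem hx]
    exact (sub_pos.2 hx).ne'
  have hvA : ∀ᵐ x, x ∉ A := measure_eq_zero_iff_ae_notMem.1 (hac hμA)
  refine ⟨Aᶜ.indicator V, hVm.indicator hA.compl, fun x => ?_, by simp, fun f hf hc => ?_⟩
  · by_cases hx : x ∈ A
    · simpa [hx] using hK
    · simpa [hx] using not_lt.1 hx
  -- The gradient of `f` divided by the weight: its inner product in the weighted space is the
  -- unweighted pairing of the gradient with the field.
  · let G : Plane → Plane := fun x =>
      (w x)⁻¹ • WithLp.toLp 2 fun i => fderiv ℝ f x (EuclideanSpace.single i 1)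
    have hGc : Continuous G := by
      refine (hwc.inv₀ fun x => (hw0 x).ne').smul ?_
      exact (PiLp.continuous_toLp 2 _).comp
        (continuous_pi fun i => continuous_fderiv_apply hf (EuclideanSpace.single i 1))
    have hGs : HasCompactSupport G := by
      refine (hc.fderiv ℝ).mono fun x hx => ?_
      contrapose! hx
      simp only [Function.mem_support, ne_eq, not_not] at hx ⊢
      simp only [G, hx]
      ext i; simp
    obtain ⟨B, hB⟩ := hGc.bounded_above_of_compact_support hGs
    have hG : MemLp G 2 μ := MemLp.of_bound hGc.aestronglyMeasurable B (ae_of_all _ hB)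
    have hGi : ∀ x v, w x * inner ℝ v (G x) = fderiv ℝ f x v := fun x v => by
      have := (hw0 x).ne'
      rw [fderiv_apply_eq_sum, inner_smul_right, mul_inv_cancel_left₀ this, PiLp.inner_apply]
      simp
    have hlimit := hV (hG.toLp G)
    have e1 : ∀ n, inner ℝ (J n) (hG.toLp G) = ∫ x, f x * h n x := fun n => by
      rw [hinner, ← (hj n).weak_eq f hf hc]
      simp only [← hGi]
      rw [← hint]
      refine integral_congr_ae ?_
      filter_upwards [hJ n] with x hx
      rw [hx]
    have e2 : inner ℝ V (hG.toLp G) = ∫ x, fderiv ℝ f x (Aᶜ.indicator V x) := by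
      rw [hinner, hint]
      refine integral_congr_ae ?_
      filter_upwards [hvA] with x hx
      rw [hGi, indicator_of_mem (by exact hx)]
    simp only [e1] at hlimit
    rw [← e2]
    -- The right-hand sides converge along the whole sequence, hence along the hyperfilter, and the
    -- two limits agree.
    exact tendsto_nhds_unique hlimit ((hlim f hf hc).mono_left Nat.hyperfilter_le_atTop)

/-! ### The tilings as indexed families of isometries -/

/-- The isometry obtained from `g` by conjugation with the homothety of ratio `s`. -/
noncomputable def rescale (s : ℝ) (g : Plane ≃ᵃⁱ[ℝ] Plane) : Plane ≃ᵃⁱ[ℝ] Plane :=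
  g.linearIsometryEquiv.toAffineIsometryEquiv.trans (AffineIsometryEquiv.vaddConst ℝ (s • g 0))

theorem rescale_smul (s : ℝ) (g : Plane ≃ᵃⁱ[ℝ] Plane) (x : Plane) :
    rescale s g (s • x) = s • g x := by
  have he : g x = g.linearIsometryEquiv x + g 0 := by simpa using g.map_vadd 0 x
  simp [rescale, he]

theorem rescale_apply {s : ℝ} (hs : s ≠ 0) (g : Plane ≃ᵃⁱ[ℝ] Plane) (x : Plane) :
    rescale s g x = s • g (s⁻¹ • x) := by
  rw [← rescale_smul, smul_inv_smul₀ hs]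

/-- Compares a dilated density, read in the coordinates of the parent tile, with the densities of
the pieces, read in the coordinates of the scaled parent. -/
theorem symm_inv_smul {s : ℝ} (hs : s ≠ 0) (g : Plane ≃ᵃⁱ[ℝ] Plane) (x : Plane) :
    g.symm (s⁻¹ • x) = s⁻¹ • (rescale s g).symm x := by
  rw [AffineIsometryEquiv.symm_apply_eq]
  apply smul_right_injective Plane hs
  simp only [smul_inv_smul₀ hs]
  rw [← rescale_smul, smul_inv_smul₀ hs, AffineIsometryEquiv.apply_symm_apply]

theorem rescale_image_smul (s : ℝ) (g : Plane ≃ᵃⁱ[ℝ] Plane) (A : Set Plane) :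
    rescale s g '' (s • A) = s • (g '' A) := by
  rw [← image_smul, ← image_smul, image_image, image_image]
  exact image_congr fun x _ => rescale_smul s g x

theorem image_interior_isometry (g : Plane ≃ᵃⁱ[ℝ] Plane) (A : Set Plane) :
    g '' interior A = interior (g '' A) :=
  g.toHomeomorph.image_interior A

/-- A finite family of tiles, each given by its kind and its placement. -/
structure Patch where
  Index : Type
  fintype : Fintype Index
  kind : Index → Fin 2
  place : Index → Plane ≃ᵃⁱ[ℝ] Plane

attribute [instance] Patch.fintype

variable {Ω : Fin 2 → Set Plane}

namespace Patch

/-- The patch that is obtained by scaling up by the golden ratio and subdividing each tile. -/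
noncomputable def inflate (S : SubstitutionRule Ω) (P : Patch) : Patch where
  Index := Σ a : P.Index, Fin ((P.kind a).val + 2)
  fintype := inferInstance
  kind b := pieceKind b.2
  place b := (S.place (P.kind b.1) b.2).trans (rescale Real.goldenRatio (P.place b.1))

/-- The set occupied by a tile. -/
def tile (P : Patch) (Ω : Fin 2 → Set Plane) (a : P.Index) : Set Plane := P.place a '' Ω (P.kind a)

/-- The sum over the tiles of a function that depends on the kind of the tile. -/
noncomputable def total (P : Patch) (h : Fin 2 → Plane → ℝ) (x : Plane) : ℝ :=
  ∑ a, h (P.kind a) ((P.place a).symm x)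

end Patch

/-- The tiles after `n` steps. -/
noncomputable def patch (S : SubstitutionRule Ω) (p : Fin 2 → Plane) : ℕ → Patch
  | 0 => ⟨Unit, inferInstance, fun _ => 0, fun _ => (AffineIsometryEquiv.vaddConst ℝ (p 0)).symm⟩
  | n + 1 => (patch S p n).inflate S

/-- Links the sets of bare placement maps to finite families of invertible isometries, over which
charges can be summed. -/
theorem mem_tiles_iff (S : SubstitutionRule Ω) (p : Fin 2 → Plane) (n : ℕ) (i : Fin 2)
    (g : Plane → Plane) :
    (i, g) ∈ tiles S p n ↔ ∃ a, (patch S p n).kind a = i ∧ ⇑((patch S p n).place a) = g := by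
  induction n generalizing i g with
  | zero =>
    simp only [tiles, mem_singleton_iff, Prod.mk.injEq, patch]
    constructor
    · rintro ⟨rfl, rfl⟩
      exact ⟨(), rfl, by ext1 x; simp⟩
    · rintro ⟨-, rfl, rfl⟩
      exact ⟨rfl, by ext1 x; simp⟩
  | succ n ih =>
    have hφ : Real.goldenRatio ≠ 0 := Real.goldenRatio_ne_zero
    constructor
    · rintro ⟨i', g', h, k, hk⟩
      obtain ⟨a, rfl, rfl⟩ := (ih i' g').1 h
      obtain ⟨rfl, rfl⟩ := Prod.mk.inj hk
      refine ⟨⟨a, k⟩, rfl, ?_⟩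
      ext1 x
      change rescale _ _ _ = _
      rw [rescale_apply hφ]
      rfl
    · rintro ⟨⟨a, k⟩, rfl, rfl⟩
      refine ⟨_, _, (ih _ _).2 ⟨a, rfl, rfl⟩, k, Prod.ext rfl ?_⟩
      ext1 x
      change rescale _ _ _ = _
      rw [rescale_apply hφ]
      rfl

theorem tilePoints_eq (S : SubstitutionRule Ω) (p : Fin 2 → Plane) (n : ℕ) :
    tilePoints S p n = range fun a => (patch S p n).place a (p ((patch S p n).kind a)) := by
  ext x
  constructor
  · rintro ⟨i, g, h, rfl⟩
    obtain ⟨a, rfl, rfl⟩ := (mem_tiles_iff S p n i g).1 h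
    exact ⟨a, rfl⟩
  · rintro ⟨a, rfl⟩
    exact ⟨_, _, (mem_tiles_iff S p n _ _).2 ⟨a, rfl, rfl⟩, rfl⟩

namespace Patch

theorem iUnion_tile_inflate (S : SubstitutionRule Ω) (P : Patch) (a : P.Index) :
    ⋃ k, (P.inflate S).tile Ω ⟨a, k⟩ = Real.goldenRatio • P.tile Ω a := by
  rw [tile, ← rescale_image_smul, S.cover, image_iUnion]
  refine iUnion_congr fun k => ?_
  simp [tile, inflate, image_image]

theorem iUnion_inflate (S : SubstitutionRule Ω) (P : Patch) :
    ⋃ b, (P.inflate S).tile Ω b = Real.goldenRatio • ⋃ a, P.tile Ω a := by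
  rw [smul_set_iUnion]
  simp only [← iUnion_tile_inflate S P]
  exact iUnion_sigma _

/-- Two pieces of the same parent are separated by the rule. Pieces of different parents lie in
scaled parents whose interiors are already disjoint. -/
theorem disjoint_inflate (S : SubstitutionRule Ω) (P : Patch)
    (hP : Pairwise fun a b => Disjoint (interior (P.tile Ω a)) (interior (P.tile Ω b))) :
    Pairwise fun a b =>
      Disjoint (interior ((P.inflate S).tile Ω a)) (interior ((P.inflate S).tile Ω b)) := by
  have hφ : Real.goldenRatio ≠ 0 := Real.goldenRatio_ne_zero
  rintro ⟨a, k⟩ ⟨b, l⟩ hne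
  by_cases hab : a = b
  · subst hab
    have hkl : k ≠ l := fun h => hne (by rw [h])
    have h := S.disjoint_interior (P.kind a) k l hkl
    have h' := (disjoint_image_iff (rescale Real.goldenRatio (P.place a)).injective).2 h
    rw [image_interior_isometry, image_interior_isometry, image_image, image_image] at h'
    exact h'
  · have hsub : ∀ a k, interior ((P.inflate S).tile Ω ⟨a, k⟩) ⊆
        Real.goldenRatio • interior (P.tile Ω a) := fun a k => by
      rw [← interior_smul₀ hφ, ← iUnion_tile_inflate S]
      exact interior_mono (subset_iUnion (fun k => (P.inflate S).tile Ω ⟨a, k⟩) k)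
    exact ((disjoint_image_iff (smul_right_injective Plane hφ)).2 (hP hab)).mono (hsub a k)
      (hsub b l)

theorem total_inflate (S : SubstitutionRule Ω) (P : Patch) (h : Fin 2 → Plane → ℝ) (x : Plane) :
    (P.inflate S).total h x = ∑ a, ∑ k : Fin ((P.kind a).val + 2),
      h (pieceKind k) ((S.place (P.kind a) k).symm
        ((rescale Real.goldenRatio (P.place a)).symm x)) := by
  simp only [total]
  exact Fintype.sum_sigma _

end Patch

theorem iUnion_tile_patch (S : SubstitutionRule Ω) (p : Fin 2 → Plane) (n : ℕ) :
    ⋃ a, (patch S p n).tile Ω a = Real.goldenRatio ^ n • (fun x => x - p 0) '' Ω 0 := by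
  induction n with
  | zero =>
    rw [pow_zero, one_smul]
    change (⋃ _ : Unit, (AffineIsometryEquiv.vaddConst ℝ (p 0)).symm '' Ω 0) = _
    rw [iUnion_const]
    rfl
  | succ n ih =>
    rw [patch, Patch.iUnion_inflate, ih, smul_smul, pow_succ']

theorem disjoint_tile_patch (S : SubstitutionRule Ω) (p : Fin 2 → Plane) (n : ℕ) :
    Pairwise fun a b => Disjoint (interior ((patch S p n).tile Ω a))
      (interior ((patch S p n).tile Ω b)) := by
  induction n with
  | zero => exact fun a b h => (h (Subsingleton.elim (α := Unit) a b)).elim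
  | succ n ih => exact Patch.disjoint_inflate S _ ih

/-- Sums over the tiles of charges supported in the tiles. -/
theorem Patch.hasBoundedPrimitive_total {P : Patch} {K : ℝ} (hK : 0 ≤ K)
    (hP : Pairwise fun a b => Disjoint (interior (P.tile Ω a)) (interior (P.tile Ω b)))
    {h : Fin 2 → Plane → ℝ}
    (H : ∀ i, HasBoundedPrimitive (interior (Ω i)) K (h i))
    (hl : ∀ a, LocallyIntegrable fun x => h (P.kind a) ((P.place a).symm x)) :
    HasBoundedPrimitive univ K (P.total h) := by
  refine HasBoundedPrimitive.sum_of_disjoint hK hP hl fun a => ?_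
  rw [Patch.tile, ← image_interior_isometry]
  exact (H _).image_isometry _

/-! ### Areas and total charges of the tiles -/

theorem aedisjoint_of_disjoint_interior {A B : Set Plane} (hA : Convex ℝ A) (hB : Convex ℝ B)
    (h : Disjoint (interior A) (interior B)) : AEDisjoint volume A B := by
  refine measure_mono_null (t := frontier A ∪ frontier B) (fun x hx => ?_)
    (measure_union_null (hA.addHaar_frontier volume) (hB.addHaar_frontier volume))
  by_cases hxA : x ∈ interior A
  · exact Or.inr ⟨subset_closure hx.2, fun hxB => h.le_bot ⟨hxA, hxB⟩⟩
  · exact Or.inl ⟨subset_closure hx.1, hxA⟩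

theorem convex_image_isometry (g : Plane ≃ᵃⁱ[ℝ] Plane) {A : Set Plane} (hA : Convex ℝ A) :
    Convex ℝ (g '' A) :=
  hA.affine_image g.toAffineEquiv.toAffineMap

theorem volume_real_rule (S : SubstitutionRule Ω) (hcv : ∀ i, Convex ℝ (Ω i))
    (hcp : ∀ i, IsCompact (Ω i)) (i : Fin 2) :
    Real.goldenRatio ^ 2 * volume.real (Ω i) =
      ∑ k : Fin (i.val + 2), volume.real (Ω (pieceKind k)) := by
  have h1 : volume (Real.goldenRatio • Ω i) = ∑ k : Fin (i.val + 2), volume (Ω (pieceKind k)) := by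
    rw [S.cover, measure_iUnion₀, tsum_fintype]
    · exact Finset.sum_congr rfl fun k _ => measure_image_isometry _ _
    · exact fun k l hkl => aedisjoint_of_disjoint_interior (convex_image_isometry _ (hcv _))
        (convex_image_isometry _ (hcv _)) (S.disjoint_interior i k l hkl)
    · exact fun k => ((hcp _).image (S.place i k).continuous).measurableSet.nullMeasurableSet
  have h2 := congrArg ENNReal.toReal h1
  rw [ENNReal.toReal_sum fun k _ => (hcp _).measure_lt_top.ne, Measure.addHaar_smul,
    ENNReal.toReal_mul, ENNReal.toReal_ofReal (abs_nonneg _), finrank_euclideanSpace,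
    Fintype.card_fin, abs_of_nonneg (by positivity)] at h2
  exact h2

theorem sum_pieces (F : Fin 2 → ℝ) (i : Fin 2) :
    ∑ k : Fin (i.val + 2), F (pieceKind k) = F 0 + (i.val + 1) * F 1 := by
  fin_cases i
  · simp [Fin.sum_univ_succ, pieceKind]
  · simp [Fin.sum_univ_succ, pieceKind]
    exact Or.inl (by ring)

/-- The rule for the first tile gives φ²|Ω₀| = |Ω₀| + |Ω₁|, and φ² = φ + 1. The ratio is thus forced
by the mere existence of a rule, without computing areas, and both pairs of triangles are treated at
once. -/
theorem volume_real_one (S : SubstitutionRule Ω) (hcv : ∀ i, Convex ℝ (Ω i))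
    (hcp : ∀ i, IsCompact (Ω i)) :
    volume.real (Ω 1) = Real.goldenRatio * volume.real (Ω 0) := by
  have h := volume_real_rule S hcv hcp 0
  rw [sum_pieces fun i => volume.real (Ω i)] at h
  simp at h
  linarith

/-- The mean number of tiles per unit of area. -/
noncomputable def background (Ω : Fin 2 → Set Plane) : ℝ :=
  (1 + Real.goldenRatio) / (volume.real (Ω 0) + Real.goldenRatio * volume.real (Ω 1))

/-- The total charges of the tiles, counting one point per tile and the uniform background, are
contracted by substitution. -/
theorem sum_charge (S : SubstitutionRule Ω) (hcv : ∀ i, Convex ℝ (Ω i))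
    (hcp : ∀ i, IsCompact (Ω i)) (hpos : 0 < volume.real (Ω 0)) (i : Fin 2) :
    ∑ k : Fin (i.val + 2), (1 - background Ω * volume.real (Ω (pieceKind k))) =
      (Real.goldenRatio⁻¹) ^ 2 * (1 - background Ω * volume.real (Ω i)) := by
  have h1 := volume_real_one S hcv hcp
  rw [sum_pieces fun i => 1 - background Ω * volume.real (Ω i)]
  have hφ := Real.goldenRatio_sq
  have hφ0 := Real.goldenRatio_pos
  -- With |Ω₁| = φ|Ω₀| the product is (1 + φ)/(2 + φ), and (2 + φ)² = 5(1 + φ). The charges are then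
  -- (3 - φ)/5 and (4 - 3φ)/5, an eigenvector of the substitution matrix for φ⁻².
  have hb : background Ω * volume.real (Ω 0) = (2 + Real.goldenRatio) / 5 := by
    rw [background, h1]
    set φ := Real.goldenRatio
    have : volume.real (Ω 0) + φ * (φ * volume.real (Ω 0)) = volume.real (Ω 0) * (2 + φ) := by
      linear_combination volume.real (Ω 0) * hφ
    rw [this]
    field_simp
    linear_combination -hφ
  have hinv : Real.goldenRatio⁻¹ = Real.goldenRatio - 1 :=
    inv_eq_of_mul_eq_one_right (by linear_combination hφ)
  have hb1 : background Ω * volume.real (Ω 1) =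
      Real.goldenRatio * ((2 + Real.goldenRatio) / 5) := by
    rw [h1, ← hb]; ring
  rw [hinv]
  fin_cases i
  · simp only [Fin.zero_eta, hb, hb1]
    simp
    linear_combination (Real.goldenRatio - 5) / 5 * hφ
  · simp only [Fin.mk_one, hb, hb1]
    simp
    linear_combination (Real.goldenRatio ^ 2 + Real.goldenRatio - 8) / 5 * hφ

/-- Bounded and measurable functions. -/
structure IsBoundedMeasurable (h : Plane → ℝ) : Prop where
  measurable : Measurable h
  bounded : ∃ M, ∀ x, |h x| ≤ M

namespace IsBoundedMeasurable

variable {h k : Plane → ℝ}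

theorem locallyIntegrable (H : IsBoundedMeasurable h) : LocallyIntegrable h := by
  obtain ⟨M, hM⟩ := H.bounded
  refine (locallyIntegrable_const M).mono H.measurable.aestronglyMeasurable (ae_of_all _ fun x => ?_)
  exact (hM x).trans (le_abs_self M)

theorem comp (H : IsBoundedMeasurable h) {g : Plane → Plane} (hg : Measurable g) :
    IsBoundedMeasurable fun x => h (g x) :=
  ⟨H.measurable.comp hg, H.bounded.imp fun _ hM x => hM (g x)⟩

theorem const_mul (H : IsBoundedMeasurable h) (c : ℝ) : IsBoundedMeasurable fun x => c * h x := by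
  obtain ⟨M, hM⟩ := H.bounded
  refine ⟨H.measurable.const_mul c, |c| * M, fun x => ?_⟩
  rw [abs_mul]
  exact mul_le_mul_of_nonneg_left (hM x) (abs_nonneg c)

theorem sub (H : IsBoundedMeasurable h) (H' : IsBoundedMeasurable k) :
    IsBoundedMeasurable fun x => h x - k x := by
  obtain ⟨M, hM⟩ := H.bounded
  obtain ⟨N, hN⟩ := H'.bounded
  exact ⟨H.measurable.sub H'.measurable, M + N,
    fun x => (abs_sub _ _).trans (add_le_add (hM x) (hN x))⟩

theorem sum {ι : Type*} [Fintype ι] {h : ι → Plane → ℝ} (H : ∀ a, IsBoundedMeasurable (h a)) :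
    IsBoundedMeasurable fun x => ∑ a, h a x := by
  choose M hM using fun a => (H a).bounded
  exact ⟨Finset.measurable_sum _ fun a _ => (H a).measurable, ∑ a, M a,
    fun x => (Finset.abs_sum_le_sum_abs _ _).trans (Finset.sum_le_sum fun a _ => hM a x)⟩

theorem indicator_const {A : Set Plane} (hA : MeasurableSet A) (c : ℝ) :
    IsBoundedMeasurable (A.indicator fun _ => c) :=
  ⟨measurable_const.indicator hA, |c|, fun x => norm_indicator_le_norm_self (fun _ => c) x⟩

theorem total {h : Fin 2 → Plane → ℝ} (H : ∀ i, IsBoundedMeasurable (h i)) (P : Patch) :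
    IsBoundedMeasurable (P.total h) :=
  sum fun a => (H (P.kind a)).comp (P.place a).symm.continuous.measurable

end IsBoundedMeasurable

/-! ### Smeared charges and the induction over substitution steps -/

/-- The density of charge of a tile of kind `i` when its point is smeared out over the tile. -/
noncomputable def density (Ω : Fin 2 → Set Plane) (i : Fin 2) : Plane → ℝ :=
  (Ω i).indicator fun _ => (volume.real (Ω i))⁻¹ - background Ω

/-- The difference between the charge density of the pieces of a scaled tile, and the multiple of
the scaled charge density of the tile that has the same total charge. -/
noncomputable def childDefect (S : SubstitutionRule Ω) (i : Fin 2) (x : Plane) : ℝ :=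
  ∑ k : Fin (i.val + 2), density Ω (pieceKind k) ((S.place i k).symm x) -
    Real.goldenRatio⁻¹ ^ 4 * density Ω i (Real.goldenRatio⁻¹ • x)

theorem isBoundedMeasurable_density (hcp : ∀ i, IsCompact (Ω i)) (i : Fin 2) :
    IsBoundedMeasurable (density Ω i) :=
  IsBoundedMeasurable.indicator_const (hcp i).measurableSet _

theorem isBoundedMeasurable_childDefect (S : SubstitutionRule Ω) (hcp : ∀ i, IsCompact (Ω i))
    (i : Fin 2) : IsBoundedMeasurable (childDefect S i) :=
  (IsBoundedMeasurable.sum fun k => (isBoundedMeasurable_density hcp _).comp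
    (S.place i k).symm.continuous.measurable).sub
    (((isBoundedMeasurable_density hcp i).comp (measurable_const_smul _)).const_mul _)

theorem integral_density (hcp : ∀ i, IsCompact (Ω i)) (hpos : ∀ i, 0 < volume.real (Ω i))
    (i : Fin 2) : ∫ x, density Ω i x = 1 - background Ω * volume.real (Ω i) := by
  rw [density, integral_indicator_const _ (hcp i).measurableSet, smul_eq_mul, mul_sub,
    mul_inv_cancel₀ (hpos i).ne', mul_comm]

theorem integrable_density (hcp : ∀ i, IsCompact (Ω i)) (i : Fin 2) : Integrable (density Ω i) :=
  (integrable_indicator_iff (hcp i).measurableSet).2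
    (integrableOn_const (hcp i).measure_lt_top.ne)

theorem integrable_comp_isometry (e : Plane ≃ᵃⁱ[ℝ] Plane) {u : Plane → ℝ} (hu : Integrable u) :
    Integrable fun x => u (e x) := by
  have h : ∀ x, e x = e.linearIsometryEquiv x + e 0 := fun x => by
    simpa using e.map_vadd 0 x
  rw [show (fun x => u (e x)) = fun x => u (e.linearIsometryEquiv x + e 0) from
    funext fun x => by rw [← h x]]
  exact ((e.linearIsometryEquiv.measurePreserving).integrable_comp_emb
    e.linearIsometryEquiv.toHomeomorph.measurableEmbedding).2 (hu.comp_add_right (e 0))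

/-- The defect is neutral: dilation by φ multiplies an integral by φ², so the factor φ⁻⁴ leaves φ⁻²
times the charge of the tile, which is the charge of the pieces by `sum_charge`. -/
theorem exists_primitive_childDefect (S : SubstitutionRule Ω) (hcv : ∀ i, Convex ℝ (Ω i))
    (hcp : ∀ i, IsCompact (Ω i)) (hpos : ∀ i, 0 < volume.real (Ω i)) (i : Fin 2) :
    ∃ K, HasBoundedPrimitive (interior (Real.goldenRatio • Ω i)) K (childDefect S i) := by
  have hφ : 0 < Real.goldenRatio := Real.goldenRatio_pos
  obtain ⟨M, hM⟩ := (isBoundedMeasurable_childDefect S hcp i).bounded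
  refine exists_hasBoundedPrimitive_of_integral_eq_zero ((hcv i).smul _)
    ((hcp i).smul Real.goldenRatio) ?_ (isBoundedMeasurable_childDefect S hcp i).measurable hM ?_ ?_
  · rw [Measure.real, Measure.addHaar_smul, ENNReal.toReal_mul]
    refine mul_pos ?_ (hpos i)
    rw [ENNReal.toReal_ofReal (abs_nonneg _)]
    positivity
  · intro x hx
    rw [childDefect, Finset.sum_eq_zero fun k _ => ?_]
    · rw [density, indicator_of_notMem, mul_zero, sub_zero]
      exact fun h => hx ((mem_smul_set_iff_inv_smul_mem₀ hφ.ne' _ _).2 h)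
    · refine indicator_of_notMem (fun h => hx ?_) _
      rw [S.cover]
      exact mem_iUnion.2 ⟨k, _, h, by simp⟩
  · have hi := fun k : Fin (i.val + 2) =>
      integrable_comp_isometry (S.place i k).symm (integrable_density hcp (pieceKind k))
    have hi' := (integrable_density hcp i).comp_smul (inv_ne_zero hφ.ne')
    simp only [childDefect]
    rw [integral_sub (integrable_finsetSum _ fun k _ => hi k) (hi'.const_mul _),
      integral_finsetSum _ fun k _ => hi k, integral_const_mul, Measure.integral_comp_inv_smul]
    simp only [integral_comp_isometry, integral_density hcp hpos]
    rw [sum_charge S hcv hcp (hpos 0), finrank_euclideanSpace, Fintype.card_fin,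
      abs_of_nonneg (by positivity), smul_eq_mul]
    field_simp
    ring

theorem Patch.total_density_inflate (S : SubstitutionRule Ω) (P : Patch) (x : Plane) :
    (P.inflate S).total (density Ω) x =
      ∑ a, childDefect S (P.kind a) ((rescale Real.goldenRatio (P.place a)).symm x) +
      Real.goldenRatio⁻¹ ^ 4 * P.total (density Ω) (Real.goldenRatio⁻¹ • x) := by
  rw [Patch.total_inflate, Patch.total, Finset.mul_sum, ← Finset.sum_add_distrib]
  refine Finset.sum_congr rfl fun a _ => ?_
  rw [childDefect, symm_inv_smul Real.goldenRatio_ne_zero, sub_add_cancel]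

/-- The smeared out charge of the tiling after `n` steps, up to a part which tends to zero, is the
divergence of a field that is bounded independently of `n`. -/
theorem exists_primitive_total_density (S : SubstitutionRule Ω) (p : Fin 2 → Plane)
    (hcv : ∀ i, Convex ℝ (Ω i)) (hcp : ∀ i, IsCompact (Ω i)) (hpos : ∀ i, 0 < volume.real (Ω i)) :
    ∃ K, 0 ≤ K ∧ ∀ n, HasBoundedPrimitive univ K fun x => (patch S p n).total (density Ω) x -
      (Real.goldenRatio⁻¹ ^ 4) ^ n *
        (patch S p 0).total (density Ω) (Real.goldenRatio⁻¹ ^ n • x) := by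
  have hφ : 0 < Real.goldenRatio := Real.goldenRatio_pos
  choose C hC using exists_primitive_childDefect S hcv hcp hpos
  set D := max (max (C 0) (C 1)) 0
  have hCD : ∀ i, C i ≤ D := fun i => by
    fin_cases i
    · exact (le_max_left _ _).trans (le_max_left _ _)
    · exact (le_max_right _ _).trans (le_max_left _ _)
  have hD : 0 ≤ D := le_max_right _ _
  have hq : Real.goldenRatio⁻¹ ^ 3 < 1 :=
    pow_lt_one₀ (by positivity) (inv_lt_one_of_one_lt₀ Real.one_lt_goldenRatio) (by norm_num)
  set q := Real.goldenRatio⁻¹ ^ 3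
  -- The fixed point of K ↦ D + qK. Here q = φ⁻³ combines the factor φ⁻⁴ of the density with the
  -- factor φ lost in the dilation.
  refine ⟨D / (1 - q), div_nonneg hD (by linarith), fun n => ?_⟩
  induction n with
  | zero =>
    refine ((HasBoundedPrimitive.zero univ).mono (div_nonneg hD (by linarith))).congr_ae ?_
    exact ae_of_all _ fun x => by simp
  | succ n ih =>
    -- The new corrections live in the disjoint interiors of the scaled tiles, so the bound `D` does
    -- not depend on the number of tiles.
    have h1 : HasBoundedPrimitive univ D fun x => ∑ a, childDefect S ((patch S p n).kind a)
        ((rescale Real.goldenRatio ((patch S p n).place a)).symm x) := by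
      refine HasBoundedPrimitive.sum_of_disjoint hD ?_ (fun a => ?_) (fun a =>
        ((hC _).mono (hCD _)).image_isometry _)
      · intro a b hab
        rw [image_interior_isometry, image_interior_isometry, rescale_image_smul,
          rescale_image_smul, interior_smul₀ hφ.ne', interior_smul₀ hφ.ne']
        exact (disjoint_image_iff (smul_right_injective Plane hφ.ne')).2
          (disjoint_tile_patch S p n hab)
      · exact ((isBoundedMeasurable_childDefect S hcp _).comp
          (AffineIsometryEquiv.continuous _).measurable).locallyIntegrable
    have hl : IsBoundedMeasurable fun x => (patch S p n).total (density Ω) x -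
        (Real.goldenRatio⁻¹ ^ 4) ^ n *
          (patch S p 0).total (density Ω) (Real.goldenRatio⁻¹ ^ n • x) :=
      (IsBoundedMeasurable.total (isBoundedMeasurable_density hcp) _).sub
        (((IsBoundedMeasurable.total (isBoundedMeasurable_density hcp) _).comp
          (measurable_const_smul _)).const_mul _)
    have h2 := (ih.dilate hφ).const_mul (Real.goldenRatio⁻¹ ^ 4)
    have h3 := h1.add h2 (IsBoundedMeasurable.sum fun a =>
      (isBoundedMeasurable_childDefect S hcp _).comp
          (AffineIsometryEquiv.continuous _).measurable).locallyIntegrable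
      ((hl.comp (measurable_const_smul _)).const_mul _).locallyIntegrable
    refine (h3.mono (le_of_eq ?_)).congr_ae (ae_of_all _ fun x => ?_)
    · have h1q : 1 - q ≠ 0 := by linarith
      have : |Real.goldenRatio⁻¹ ^ 4| * (Real.goldenRatio * (D / (1 - q))) = q * (D / (1 - q)) := by
        rw [abs_of_nonneg (by positivity)]
        simp only [q]
        field_simp
      rw [this]
      field_simp
      ring
    · change _ = ((patch S p n).inflate S).total (density Ω) x - _
      rw [Patch.total_density_inflate]
      simp only [pow_succ, mul_smul]
      ring

/-! ### Separated sets -/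

/-- Distinct points of `Λ` are at distance at least `δ`. -/
def IsSeparatedBy (δ : ℝ) (Λ : Set Plane) : Prop := ∀ x ∈ Λ, ∀ y ∈ Λ, x ≠ y → δ ≤ dist x y

/-- Packing: the discs of radius `r` about the points are disjoint and contained in the disc of
radius `R + r`. -/
theorem IsSeparatedBy.card_le {r R : ℝ} (hr : 0 < r) (hR : 0 ≤ R) {Λ : Set Plane}
    (hΛ : IsSeparatedBy (2 * r) Λ) {F : Finset Plane} (hF : ↑F ⊆ Λ ∩ ball 0 R) :
    (F.card : ℝ) * r ^ 2 ≤ (R + r) ^ 2 := by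
  have hd : (F : Set Plane).PairwiseDisjoint fun q => ball q r := fun x hx y hy hxy =>
    ball_disjoint_ball (by linarith [hΛ x (hF hx).1 y (hF hy).1 hxy])
  have h1 : volume (⋃ q ∈ F, ball q r) ≤ volume (ball (0 : Plane) (R + r)) := by
    refine measure_mono (iUnion₂_subset fun q hq => ball_subset_ball' ?_)
    have := (hF hq).2
    rw [mem_ball] at this
    linarith
  rw [measure_biUnion_finset hd fun _ _ => measurableSet_ball] at h1
  simp only [EuclideanSpace.volume_ball_fin_two, Finset.sum_const, nsmul_eq_mul] at h1
  have h2 := ENNReal.toReal_mono (by finiteness) h1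
  simp only [ENNReal.toReal_mul, ENNReal.toReal_natCast, ENNReal.toReal_pow,
    ENNReal.toReal_ofReal hr.le, ENNReal.toReal_ofReal (add_nonneg hR hr.le)] at h2
  rw [ENNReal.toReal_ofReal Real.pi_pos.le] at h2
  have h3 : (F.card * r ^ 2) * Real.pi ≤ (R + r) ^ 2 * Real.pi := by linarith
  exact le_of_mul_le_mul_right h3 Real.pi_pos

theorem IsSeparatedBy.finite_inter_ball {r : ℝ} (hr : 0 < r) {Λ : Set Plane}
    (hΛ : IsSeparatedBy (2 * r) Λ) (R : ℝ) : (Λ ∩ ball 0 R).Finite := by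
  rcases lt_or_ge R 0 with hR | hR
  · rw [ball_eq_empty.2 hR.le, inter_empty]
    exact finite_empty
  by_contra h
  obtain ⟨N, hN⟩ := exists_nat_gt ((R + r) ^ 2 / r ^ 2)
  obtain ⟨F, hF, hc⟩ := Set.Infinite.exists_subset_card_eq h N
  have := hΛ.card_le hr hR hF
  rw [hc] at this
  rw [div_lt_iff₀ (by positivity)] at hN
  linarith

theorem IsSeparatedBy.countable {r : ℝ} (hr : 0 < r) {Λ : Set Plane}
    (hΛ : IsSeparatedBy (2 * r) Λ) : Λ.Countable := by
  have : Λ = ⋃ N : ℕ, Λ ∩ ball 0 N := by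
    rw [← inter_iUnion, iUnion_ball_nat, inter_univ]
  rw [this]
  exact countable_iUnion fun N => (hΛ.finite_inter_ball hr N).countable

theorem IsSeparatedBy.eq_of_mem_ball {r : ℝ} {Λ : Set Plane} (hΛ : IsSeparatedBy (2 * r) Λ)
    {x q q' : Plane} (hq : q ∈ Λ) (hq' : q' ∈ Λ) (h : x ∈ ball q r) (h' : x ∈ ball q' r) :
    q = q' := by
  by_contra hne
  have h1 := hΛ q hq q' hq' hne
  have h2 := dist_triangle_left q q' x
  rw [mem_ball] at h h'
  linarith

/-! ### Local convergence -/

/-- Every sequence of subsets of the plane has a locally convergent subsequence. -/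
theorem exists_subseq_convergesLocally (L : ℕ → Set Plane) :
    ∃ (ψ : ℕ → ℕ) (Λ : Set Plane), StrictMono ψ ∧ ConvergesLocally (fun n => L (ψ n)) Λ := by
  classical
  let B := TopologicalSpace.countableBasis Plane
  have hBc : Countable B := TopologicalSpace.countable_countableBasis Plane
  -- Record for each set of a countable basis whether `L n` meets it. These 0-1 patterns lie in a
  -- compact metrizable product, so along a subsequence each basic open set is eventually always met
  -- or eventually never met. Then being met infinitely often implies being met eventually.
  obtain ⟨a, ψ, hψ, ha⟩ := CompactSpace.tendsto_subseq
    fun n => fun U : B => decide (L n ∩ U.1).Nonempty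
  refine ⟨ψ, {x | ∀ ε > 0, ∃ᶠ n in atTop, (L (ψ n) ∩ ball x ε).Nonempty}, hψ, ?_, fun x hx => hx⟩
  intro x hx ε hε
  obtain ⟨U, hU, hxU, hUε⟩ := (TopologicalSpace.isBasis_countableBasis Plane).mem_nhds_iff.1
    (ball_mem_nhds x hε)
  obtain ⟨ε', hε', hU'⟩ := Metric.isOpen_iff.1
    ((TopologicalSpace.isBasis_countableBasis Plane).isOpen hU) x hxU
  have h1 : ∃ᶠ n in atTop, (L (ψ n) ∩ U).Nonempty :=
    (hx ε' hε').mono fun n hn => hn.mono (inter_subset_inter_right _ hU')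
  have h2 := tendsto_pi_nhds.1 ha ⟨U, hU⟩
  rw [nhds_discrete, tendsto_pure] at h2
  obtain ⟨n, hn, hn'⟩ := (h1.and_eventually h2).exists
  have h3 : a ⟨U, hU⟩ = true := by
    rw [← hn']
    exact decide_eq_true hn
  filter_upwards [h2] with n hn
  rw [h3] at hn
  exact (of_decide_eq_true hn).mono (inter_subset_inter_right _ hUε)

namespace ConvergesLocally

variable {L : ℕ → Set Plane} {Λ : Set Plane}

theorem isSeparatedBy (H : ConvergesLocally L Λ) {δ : ℝ} (hL : ∀ n, IsSeparatedBy δ (L n)) :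
    IsSeparatedBy δ Λ := by
  intro x hx y hy hxy
  by_contra! hlt
  have hd : 0 < dist x y := dist_pos.2 hxy
  obtain ⟨ε, hε0, hε⟩ := exists_between (lt_min (half_pos hd) (half_pos (sub_pos.2 hlt)))
  obtain ⟨n, ⟨u, hu, hux⟩, v, hv, hvy⟩ := ((H.1 x hx ε hε0).and (H.1 y hy ε hε0)).exists
  rw [lt_min_iff] at hε
  rw [mem_ball] at hux hvy
  have h1 := dist_triangle4 u x y v
  have h2 := dist_triangle4 x u v y
  rw [dist_comm y v] at h1
  rw [dist_comm x u] at h2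
  have huv : u ≠ v := by
    rintro rfl
    rw [dist_self] at h2
    linarith
  linarith [hL n u hu v hv huv]

/-- Each point outside `Λ` has a ball that the `L n` eventually miss; finitely many such balls cover
`K`. -/
theorem eventually_disjoint (H : ConvergesLocally L Λ) {K : Set Plane} (hK : IsCompact K)
    (hd : Disjoint Λ K) : ∀ᶠ n in atTop, Disjoint (L n) K := by
  refine hK.induction_on (p := fun s => ∀ᶠ n in atTop, Disjoint (L n) s) (by simp)
    (fun s t hst h => h.mono fun n hn => hn.mono_right hst)
    (fun s t hs ht => (hs.and ht).mono fun n hn => hn.1.union_right hn.2) fun x hx => ?_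
  have hxΛ : x ∉ Λ := fun h => hd.le_bot ⟨h, hx⟩
  have := mt (H.2 x) hxΛ
  push Not at this
  obtain ⟨ε, hε, h⟩ := this
  refine ⟨ball x ε, mem_nhdsWithin_of_mem_nhds (ball_mem_nhds x hε), h.mono fun n hn => ?_⟩
  exact disjoint_iff_inter_eq_empty.2 hn

/-- The unions of balls around the points converge almost everywhere. -/
theorem ae_tendsto_indicator (H : ConvergesLocally L Λ) (hΛ : Λ.Countable) {r : ℝ} (hr : 0 < r) :
    ∀ᵐ x, Tendsto (fun n => (⋃ q ∈ L n, ball q r).indicator (1 : Plane → ℝ) x) atTop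
      (𝓝 ((⋃ q ∈ Λ, ball q r).indicator 1 x)) := by
  -- Convergence can fail only on the circles bounding the discs, and countably many circles form a
  -- null set.
  have hs : ∀ᵐ x, ∀ q ∈ Λ, x ∉ sphere q r := (ae_ball_iff hΛ).2 fun q _ =>
    measure_eq_zero_iff_ae_notMem.1 (Measure.addHaar_sphere_of_ne_zero _ q hr.ne')
  filter_upwards [hs] with x hx
  refine tendsto_const_nhds.congr' ?_
  by_cases h : x ∈ ⋃ q ∈ Λ, ball q r
  · obtain ⟨q, hq, hxq⟩ := mem_iUnion₂.1 h
    rw [mem_ball] at hxq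
    filter_upwards [H.1 q hq (r - dist x q) (by linarith)] with n hn
    obtain ⟨u, hu, huq⟩ := hn
    have : x ∈ ⋃ q ∈ L n, ball q r := mem_iUnion₂.2 ⟨u, hu, by
      rw [mem_ball] at huq ⊢
      linarith [dist_triangle_right x u q]⟩
    rw [indicator_of_mem h, indicator_of_mem this]
  · have hd : Disjoint Λ (closedBall x r) := by
      rw [Set.disjoint_left]
      intro q hq hqx
      rw [mem_closedBall, dist_comm] at hqx
      rcases hqx.lt_or_eq with h' | h'
      · exact h (mem_iUnion₂.2 ⟨q, hq, h'⟩)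
      · exact hx q hq h'
    filter_upwards [H.eventually_disjoint (isCompact_closedBall x r) hd] with n hn
    have : x ∉ ⋃ q ∈ L n, ball q r := fun h' => by
      obtain ⟨q, hq, hxq⟩ := mem_iUnion₂.1 h'
      exact hn.le_bot ⟨hq, by rw [mem_closedBall, dist_comm]; exact (mem_ball.1 hxq).le⟩
    rw [indicator_of_notMem h, indicator_of_notMem this]

end ConvergesLocally

/-! ### The points of the tiles -/

/-- The point of a tile. -/
noncomputable def Patch.point (P : Patch) (p : Fin 2 → Plane) (a : P.Index) : Plane := P.place a (p (P.kind a))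

theorem Patch.ball_point_subset {P : Patch} {p : Fin 2 → Plane} {r : ℝ}
    (hr : ∀ i, ball (p i) r ⊆ Ω i) (a : P.Index) : ball (P.point p a) r ⊆ interior (P.tile Ω a) := by
  refine interior_maximal (fun x hx => ⟨(P.place a).symm x, hr _ ?_, by simp⟩) isOpen_ball
  rw [mem_ball, ← (P.place a).dist_map]
  simpa [Patch.point] using hx

theorem Patch.le_dist_point {P : Patch} {p : Fin 2 → Plane} {r : ℝ} (hr0 : 0 < r)
    (hr : ∀ i, ball (p i) r ⊆ Ω i)
    (hP : Pairwise fun a b => Disjoint (interior (P.tile Ω a)) (interior (P.tile Ω b)))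
    {a b : P.Index} (hab : a ≠ b) : r ≤ dist (P.point p a) (P.point p b) := by
  by_contra! h
  exact (hP hab).symm.le_bot ⟨P.ball_point_subset hr b (mem_ball_self hr0),
    P.ball_point_subset hr a (by rwa [mem_ball, dist_comm])⟩

theorem isSeparatedBy_tilePoints (S : SubstitutionRule Ω) {p : Fin 2 → Plane} {r : ℝ} (hr0 : 0 < r)
    (hr : ∀ i, ball (p i) r ⊆ Ω i) (n : ℕ) : IsSeparatedBy r (tilePoints S p n) := by
  rw [tilePoints_eq]
  rintro _ ⟨a, rfl⟩ _ ⟨b, rfl⟩ hne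
  exact Patch.le_dist_point hr0 hr (disjoint_tile_patch S p n) fun h => hne (by rw [h])

theorem sum_indicator_one {ι : Type*} [Fintype ι] {A : ι → Set Plane} {x : Plane}
    (h : ∀ a b, x ∈ A a → x ∈ A b → a = b) :
    ∑ a, (A a).indicator (1 : Plane → ℝ) x = (⋃ a, A a).indicator 1 x := by
  by_cases hx : x ∈ ⋃ a, A a
  · obtain ⟨a, ha⟩ := mem_iUnion.1 hx
    rw [Finset.sum_eq_single a (fun b _ hb => indicator_of_notMem (fun hxb => hb (h b a hxb ha)) _)
      (by simp), indicator_of_mem ha, indicator_of_mem hx]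
  · rw [indicator_of_notMem hx]
    exact Finset.sum_eq_zero fun a _ => indicator_of_notMem (fun ha => hx (mem_iUnion.2 ⟨a, ha⟩)) _

/-- The density of a point charge that is smeared out over a disc, minus the one that is smeared
out over the tile. -/
noncomputable def pointDefect (Ω : Fin 2 → Set Plane) (p : Fin 2 → Plane) (r : ℝ) (i : Fin 2)
    (x : Plane) : ℝ :=
  (ball (p i) r).indicator (fun _ => (volume.real (ball (0 : Plane) r))⁻¹) x -
    (Ω i).indicator (fun _ => (volume.real (Ω i))⁻¹) x

theorem isBoundedMeasurable_pointDefect (hcp : ∀ i, IsCompact (Ω i)) (p : Fin 2 → Plane) (r : ℝ)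
    (i : Fin 2) : IsBoundedMeasurable (pointDefect Ω p r i) :=
  (IsBoundedMeasurable.indicator_const measurableSet_ball _).sub
    (IsBoundedMeasurable.indicator_const (hcp i).measurableSet _)

/-- The disc and the tile both carry unit mass, so moving the charge from one to the other is a
neutral correction within the tile. -/
theorem exists_primitive_pointDefect (hcv : ∀ i, Convex ℝ (Ω i)) (hcp : ∀ i, IsCompact (Ω i))
    (hpos : ∀ i, 0 < volume.real (Ω i)) {p : Fin 2 → Plane} {r : ℝ} (hr0 : 0 < r)
    (hr : ∀ i, ball (p i) r ⊆ Ω i) (i : Fin 2) :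
    ∃ K, HasBoundedPrimitive (interior (Ω i)) K (pointDefect Ω p r i) := by
  obtain ⟨M, hM⟩ := (isBoundedMeasurable_pointDefect hcp p r i).bounded
  refine exists_hasBoundedPrimitive_of_integral_eq_zero (hcv i) (hcp i) (hpos i)
    (isBoundedMeasurable_pointDefect hcp p r i).measurable hM (fun x hx => ?_) ?_
  · rw [pointDefect, indicator_of_notMem hx, indicator_of_notMem fun h => hx (hr i h), sub_zero]
  · have hb : 0 < volume.real (ball (0 : Plane) r) :=
      ENNReal.toReal_pos (measure_ball_pos _ _ hr0).ne' measure_ball_lt_top.ne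
    have he : volume.real (ball (p i) r) = volume.real (ball (0 : Plane) r) := by
      simp only [Measure.real, Measure.addHaar_ball_center]
    simp only [pointDefect]
    rw [integral_sub, integral_indicator_const _ measurableSet_ball,
      integral_indicator_const _ (hcp i).measurableSet, he, smul_eq_mul, smul_eq_mul,
      mul_inv_cancel₀ hb.ne', mul_inv_cancel₀ (hpos i).ne', sub_self]
    · exact (integrable_indicator_iff measurableSet_ball).2
        (integrableOn_const measure_ball_lt_top.ne)
    · exact (integrable_indicator_iff (hcp i).measurableSet).2
        (integrableOn_const (hcp i).measure_lt_top.ne)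

/-- The part of the smeared out charge that is left over after `n` steps. -/
noncomputable def residual (S : SubstitutionRule Ω) (p : Fin 2 → Plane) (n : ℕ) (x : Plane) : ℝ :=
  (Real.goldenRatio⁻¹ ^ 4) ^ n * (patch S p 0).total (density Ω) (Real.goldenRatio⁻¹ ^ n • x)

/-- The charge of the discs around the points after `n` steps, minus the background, minus a
residual part, is the divergence of a field that is bounded independently of `n`. -/
theorem exists_primitive_discs (S : SubstitutionRule Ω) (hcv : ∀ i, Convex ℝ (Ω i))
    (hcp : ∀ i, IsCompact (Ω i)) (hpos : ∀ i, 0 < volume.real (Ω i)) {p : Fin 2 → Plane} {r : ℝ}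
    (hr0 : 0 < r) (hr : ∀ i, ball (p i) (2 * r) ⊆ Ω i) :
    ∃ K, 0 ≤ K ∧ ∀ n, HasBoundedPrimitive univ K fun x =>
      (volume.real (ball (0 : Plane) r))⁻¹ *
        (⋃ q ∈ tilePoints S p n, ball q r).indicator 1 x -
      background Ω * (Real.goldenRatio ^ n • (fun x => x - p 0) '' Ω 0).indicator 1 x -
      residual S p n x := by
  have hr' : ∀ i, ball (p i) r ⊆ Ω i := fun i =>
    (ball_subset_ball (by linarith)).trans (hr i)
  obtain ⟨K₁, hK₁, H₁⟩ := exists_primitive_total_density S p hcv hcp hpos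
  choose C hC using exists_primitive_pointDefect hcv hcp hpos hr0 hr'
  set D := max (max (C 0) (C 1)) 0
  have hCD : ∀ i, C i ≤ D := fun i => by
    fin_cases i
    · exact (le_max_left _ _).trans (le_max_left _ _)
    · exact (le_max_right _ _).trans (le_max_left _ _)
  have hD : 0 ≤ D := le_max_right _ _
  refine ⟨D + K₁, by positivity, fun n => ?_⟩
  have hdis := disjoint_tile_patch S p n
  have h2 : HasBoundedPrimitive univ D ((patch S p n).total (pointDefect Ω p r)) :=
    Patch.hasBoundedPrimitive_total hD hdis (fun i => (hC i).mono (hCD i)) fun a =>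
      ((isBoundedMeasurable_pointDefect hcp p r _).comp
        (AffineIsometryEquiv.continuous _).measurable).locallyIntegrable
  have hl : IsBoundedMeasurable fun x => (patch S p n).total (density Ω) x -
      (Real.goldenRatio⁻¹ ^ 4) ^ n *
        (patch S p 0).total (density Ω) (Real.goldenRatio⁻¹ ^ n • x) :=
    (IsBoundedMeasurable.total (isBoundedMeasurable_density hcp) _).sub
      (((IsBoundedMeasurable.total (isBoundedMeasurable_density hcp) _).comp
        (measurable_const_smul _)).const_mul _)
  refine (h2.add (H₁ n) (IsBoundedMeasurable.total
    (isBoundedMeasurable_pointDefect hcp p r) _).locallyIntegrable hl.locallyIntegrable).congr_ae ?_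
  -- Away from the null set of tile boundaries a point lies in at most one tile, so indicators of
  -- unions are sums of indicators.
  have hfr : ∀ᵐ x, ∀ a, x ∉ frontier ((patch S p n).tile Ω a) := ae_all_iff.2 fun a =>
    measure_eq_zero_iff_ae_notMem.1
      ((convex_image_isometry _ (hcv _)).addHaar_frontier volume)
  filter_upwards [hfr] with x hx
  rw [residual, ← add_sub_assoc]
  congr 1
  have hmem : ∀ a, x ∈ (patch S p n).tile Ω a → x ∈ interior ((patch S p n).tile Ω a) :=
    fun a ha => by
      by_contra h
      exact hx a ⟨subset_closure ha, h⟩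
  have hballs : (⋃ q ∈ tilePoints S p n, ball q r) =
      ⋃ a, ball ((patch S p n).point p a) r := by
    rw [tilePoints_eq, biUnion_range]
    rfl
  rw [hballs, ← iUnion_tile_patch, ← sum_indicator_one, ← sum_indicator_one, Finset.mul_sum,
    Finset.mul_sum, ← Finset.sum_sub_distrib, Patch.total, Patch.total, ← Finset.sum_add_distrib]
  · refine Finset.sum_congr rfl fun a _ => ?_
    set y := ((patch S p n).place a).symm x with hy
    have e1 : x ∈ ball ((patch S p n).point p a) r ↔ y ∈ ball (p ((patch S p n).kind a)) r := by
      rw [mem_ball, mem_ball, ← ((patch S p n).place a).dist_map y, hy]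
      simp [Patch.point]
    have e2 : x ∈ (patch S p n).tile Ω a ↔ y ∈ Ω ((patch S p n).kind a) := by
      constructor
      · rintro ⟨z, hz, rfl⟩
        simpa [hy] using hz
      · exact fun h => ⟨y, h, by simp [hy]⟩
    classical
    -- The unit charge smeared over the tile cancels between the two terms, leaving the disc minus
    -- the background on the tile.
    simp only [pointDefect, density, indicator_apply, e1, e2, Pi.one_apply]
    split_ifs <;> ring
  · intro a b ha hb
    by_contra hab
    exact (hdis hab).le_bot ⟨hmem a ha, hmem b hb⟩
  · intro a b ha hb
    by_contra hab
    have h1 := Patch.le_dist_point (by linarith) hr hdis hab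
    have h2 := dist_triangle_left ((patch S p n).point p a) ((patch S p n).point p b) x
    rw [mem_ball] at ha hb
    linarith

theorem tendsto_inv_goldenRatio_pow_smul (x : Plane) :
    Tendsto (fun n : ℕ => Real.goldenRatio⁻¹ ^ n • x) atTop (𝓝 0) := by
  have hφ := Real.goldenRatio_pos
  have h := tendsto_pow_atTop_nhds_zero_of_lt_one (inv_nonneg.2 hφ.le)
    (inv_lt_one_of_one_lt₀ Real.one_lt_goldenRatio)
  simpa using h.smul_const x

/-- As the origin corresponds to an interior point of the first tile, the scaled triangles exhaust
the plane and the background fills it in the limit. -/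
theorem eventually_mem_scaled {p₀ : Plane} {A : Set Plane} (h : p₀ ∈ interior A) (x : Plane) :
    ∀ᶠ n : ℕ in atTop, x ∈ Real.goldenRatio ^ n • (fun x => x - p₀) '' A := by
  have hA : A ∈ 𝓝 (0 + p₀) := by rw [zero_add]; exact mem_interior_iff_mem_nhds.1 h
  filter_upwards [((tendsto_inv_goldenRatio_pow_smul x).add_const p₀).eventually_mem hA] with n hn
  have hφ : Real.goldenRatio ^ n ≠ 0 := pow_ne_zero _ Real.goldenRatio_ne_zero
  rw [mem_smul_set_iff_inv_smul_mem₀ hφ, ← inv_pow]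
  exact ⟨_, hn, add_sub_cancel_right _ _⟩

theorem exists_bound_residual (S : SubstitutionRule Ω) (hcp : ∀ i, IsCompact (Ω i))
    (p : Fin 2 → Plane) :
    ∃ M, 0 ≤ M ∧ ∀ n x, |residual S p n x| ≤ (Real.goldenRatio⁻¹ ^ 4) ^ n * M := by
  obtain ⟨M, hM⟩ := (IsBoundedMeasurable.total (isBoundedMeasurable_density hcp)
    (patch S p 0)).bounded
  refine ⟨M, (abs_nonneg _).trans (hM 0), fun n x => ?_⟩
  have hφ := Real.goldenRatio_pos
  rw [residual, abs_mul, abs_of_nonneg (by positivity)]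
  exact mul_le_mul_of_nonneg_left (hM _) (by positivity)

/-- The charge of the discs around the points of a limit set, minus the background, is the
divergence of a bounded field. -/
theorem exists_primitive_limit (S : SubstitutionRule Ω) (hcv : ∀ i, Convex ℝ (Ω i))
    (hcp : ∀ i, IsCompact (Ω i)) (hpos : ∀ i, 0 < volume.real (Ω i)) {p : Fin 2 → Plane}
    (hp : p 0 ∈ interior (Ω 0)) {r : ℝ} (hr0 : 0 < r) (hr : ∀ i, ball (p i) (2 * r) ⊆ Ω i)
    {ψ : ℕ → ℕ} (hψ : StrictMono ψ) {Λ : Set Plane}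
    (H : ConvergesLocally (fun n => tilePoints S p (ψ n)) Λ) :
    ∃ K, HasBoundedPrimitive univ K fun x =>
      (volume.real (ball (0 : Plane) r))⁻¹ * (⋃ q ∈ Λ, ball q r).indicator 1 x -
        background Ω := by
  obtain ⟨K, -, hK⟩ := exists_primitive_discs S hcv hcp hpos hr0 hr
  have hsep : IsSeparatedBy (2 * r) Λ := H.isSeparatedBy fun n =>
    isSeparatedBy_tilePoints S (by positivity) hr (ψ n)
  obtain ⟨M, hM0, hM⟩ := exists_bound_residual S hcp p
  have hφ := Real.goldenRatio_pos
  have hq1 : Real.goldenRatio⁻¹ ^ 4 < 1 :=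
    pow_lt_one₀ (by positivity) (inv_lt_one_of_one_lt₀ Real.one_lt_goldenRatio) (by norm_num)
  have hind : ∀ (A : Set Plane) (x : Plane), |A.indicator (1 : Plane → ℝ) x| ≤ 1 := fun A x =>
    (norm_indicator_le_norm_self (1 : Plane → ℝ) x).trans (by simp)
  set c := (volume.real (ball (0 : Plane) r))⁻¹
  refine ⟨K, HasBoundedPrimitive.of_tendsto (fun n => hK (ψ n)) fun f hf hc => ?_⟩
  -- Pointwise almost everywhere, the discs converge to those of `Λ`, the triangle fills the plane
  -- and the residual tends to zero; all three are uniformly bounded, so `f` times a constant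
  -- dominates.
  refine tendsto_integral_of_dominated_convergence (fun x => |f x| * (|c| + |background Ω| + M))
    (fun n => ?_) ?_ (fun n => ae_of_all _ fun x => ?_) ?_
  · have h1 : MeasurableSet (⋃ q ∈ tilePoints S p (ψ n), ball q r) :=
      (isOpen_biUnion fun _ _ => isOpen_ball).measurableSet
    have h2 : MeasurableSet (Real.goldenRatio ^ ψ n • (fun x => x - p 0) '' Ω 0) :=
      (((hcp 0).image (by fun_prop)).smul _).measurableSet
    have h3 : Measurable (residual S p (ψ n)) :=
      (((IsBoundedMeasurable.total (isBoundedMeasurable_density hcp) _).comp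
        (measurable_const_smul _)).const_mul _).measurable
    exact (hf.continuous.measurable.mul ((((measurable_one.indicator h1).const_mul c).sub
      ((measurable_one.indicator h2).const_mul _)).sub h3)).aestronglyMeasurable
  · exact ((hf.continuous.integrable_of_hasCompactSupport hc).abs).mul_const _
  · rw [norm_mul, Real.norm_eq_abs, Real.norm_eq_abs]
    refine mul_le_mul_of_nonneg_left ((abs_sub _ _).trans (add_le_add ((abs_sub _ _).trans
      (add_le_add ?_ ?_)) ((hM _ _).trans ?_))) (abs_nonneg _)
    · rw [abs_mul]
      exact mul_le_of_le_one_right (abs_nonneg _) (hind _ _)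
    · rw [abs_mul]
      exact mul_le_of_le_one_right (abs_nonneg _) (hind _ _)
    · exact mul_le_of_le_one_left hM0 (pow_le_one₀ (by positivity) hq1.le)
  · filter_upwards [H.ae_tendsto_indicator (hsep.countable hr0) hr0] with x hx
    refine Tendsto.const_mul _ ?_
    have h2 : Tendsto (fun n => background Ω *
        (Real.goldenRatio ^ ψ n • (fun x => x - p 0) '' Ω 0).indicator (1 : Plane → ℝ) x) atTop
        (𝓝 (background Ω)) := by
      refine tendsto_const_nhds.congr' ?_
      filter_upwards [hψ.tendsto_atTop.eventually (eventually_mem_scaled hp x)] with n hn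
      rw [indicator_of_mem hn, Pi.one_apply, mul_one]
    have h3 : Tendsto (fun n => residual S p (ψ n) x) atTop (𝓝 0) := by
      refine squeeze_zero_norm (fun n => hM (ψ n) x) ?_
      have := ((tendsto_pow_atTop_nhds_zero_of_lt_one (by positivity) hq1).mul_const M).comp
        hψ.tendsto_atTop
      rw [zero_mul] at this
      exact this
    simpa using ((hx.const_mul c).sub h2).sub h3

/-! ### The field of a point charge screened by a disc -/

/-- The field of a point charge at the origin that is screened by a uniformly charged disc. -/
noncomputable def screenedField (r : ℝ) : Plane → Plane :=
  (ball 0 r).indicator fun y => ((r ^ 2)⁻¹ - (‖y‖ ^ 2)⁻¹) • y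

theorem measurable_screenedField (r : ℝ) : Measurable (screenedField r) := by
  refine Measurable.indicator ?_ measurableSet_ball
  fun_prop

theorem screenedField_eq_zero {r : ℝ} {y : Plane} (hy : y ∉ ball 0 r) : screenedField r y = 0 :=
  indicator_of_notMem hy _

/-- Screening only weakens the field of a point charge. At the origin both sides are zero by the
convention for the inverse. -/
theorem norm_screenedField_le {r : ℝ} (y : Plane) : ‖screenedField r y‖ ≤ ‖y‖⁻¹ := by
  by_cases hy : y ∈ ball 0 r
  · rw [screenedField, indicator_of_mem hy, norm_smul]
    rw [mem_ball_zero_iff] at hy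
    rcases (norm_nonneg y).eq_or_lt with h | h
    · simp [← h]
    have hr : 0 < r := h.trans hy
    have h1 : (r ^ 2)⁻¹ ≤ (‖y‖ ^ 2)⁻¹ := by gcongr
    have h2 : 0 ≤ (r ^ 2)⁻¹ := by positivity
    rw [Real.norm_eq_abs, abs_of_nonpos (by linarith)]
    calc -((r ^ 2)⁻¹ - (‖y‖ ^ 2)⁻¹) * ‖y‖ ≤ (‖y‖ ^ 2)⁻¹ * ‖y‖ := by gcongr; linarith
      _ = ‖y‖⁻¹ := by field_simp
  · rw [screenedField_eq_zero hy, norm_zero]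
    positivity

theorem integrableOn_inv_norm_ball (r : ℝ) : IntegrableOn (fun y : Plane => ‖y‖⁻¹) (ball 0 r) := by
  rw [integrableOn_fun_norm_addHaar volume (f := fun s => s⁻¹), finrank_euclideanSpace,
    Fintype.card_fin]
  refine (integrableOn_const (C := (1 : ℝ)) (by simp)).congr_fun (fun y hy => ?_) measurableSet_Ioo
  have : y ≠ 0 := hy.1.ne'
  simp [this]

theorem integrable_screenedField (r : ℝ) : Integrable (screenedField r) := by
  refine (((integrable_indicator_iff measurableSet_ball).2 (integrableOn_inv_norm_ball r))).mono'
    (measurable_screenedField r).aestronglyMeasurable (ae_of_all _ fun y => ?_)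
  by_cases hy : y ∈ ball 0 r
  · rw [indicator_of_mem hy]
    exact norm_screenedField_le y
  · rw [screenedField_eq_zero hy, norm_zero, indicator_of_notMem hy]

theorem volume_real_ball {r : ℝ} (hr : 0 ≤ r) (x : Plane) :
    volume.real (ball x r) = Real.pi * r ^ 2 := by
  rw [Measure.real, EuclideanSpace.volume_ball_fin_two]
  simp [ENNReal.toReal_ofReal hr, Real.pi_pos.le, mul_comm]

/-- Substitution z = tx: the Jacobian contributes t⁻² and the vector x = z/t another t⁻¹. -/
theorem integral_fderiv_dilation {f : Plane → ℝ} (r : ℝ) {t : ℝ} (ht : 0 < t) :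
    ∫ x in ball (0 : Plane) r, fderiv ℝ f (t • x) x =
      ∫ z, (ball (0 : Plane) (t * r)).indicator (fun z => (t ^ 3)⁻¹ * fderiv ℝ f z z) z := by
  rw [← integral_indicator measurableSet_ball]
  have h := Measure.integral_comp_smul_of_nonneg volume
    (fun z => (ball (0 : Plane) (t * r)).indicator (fun z => t⁻¹ * fderiv ℝ f z z) z) t (hR := ht.le)
  rw [finrank_euclideanSpace, Fintype.card_fin, smul_eq_mul, ← integral_const_mul] at h
  refine Eq.trans (integral_congr_ae (ae_of_all _ fun x => ?_))
    (h.trans (integral_congr_ae (ae_of_all _ fun z => ?_)))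
  · have : t • x ∈ ball (0 : Plane) (t * r) ↔ x ∈ ball 0 r := by
      rw [mem_ball_zero_iff, mem_ball_zero_iff, norm_smul, Real.norm_of_nonneg ht.le,
        mul_lt_mul_iff_right₀ ht]
    by_cases hx : x ∈ ball 0 r
    · rw [indicator_of_mem hx, indicator_of_mem (this.2 hx), map_smul, smul_eq_mul,
        inv_mul_cancel_left₀ ht.ne']
    · rw [indicator_of_notMem hx, indicator_of_notMem (mt this.1 hx)]
  · by_cases hz : z ∈ ball 0 (t * r)
    · simp only [indicator_of_mem hz]
      field_simp
    · simp only [indicator_of_notMem hz, mul_zero]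

/-- With s = |z| this is the radial profile that appears when the integral over `t` is carried out
first; it is proportional to the profile of `screenedField`. -/
theorem integral_inv_cube {r s : ℝ} (hr : 0 < r) (hs : 0 < s) :
    ∫ t in Ioc (0 : ℝ) 1, (if s < t * r then (t ^ 3)⁻¹ else 0) =
      if s < r then (r ^ 2 / s ^ 2 - 1) / 2 else 0 := by
  split_ifs with h
  · have hlt : s / r < 1 := (div_lt_one hr).2 h
    have hpos : 0 < s / r := by positivity
    have hi : ∀ t : ℝ, (Ioc 0 1).indicator (fun t => if s < t * r then (t ^ 3)⁻¹ else 0) t =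
        (Ioc (s / r) 1).indicator (fun t => t ^ (-3 : ℤ)) t := fun t => by
      have : s < t * r ↔ s / r < t := (div_lt_iff₀ hr).symm
      simp only [indicator_apply, mem_Ioc, this]
      have e : (t ^ (-3 : ℤ)) = (t ^ 3)⁻¹ := by rw [zpow_neg]; rfl
      rw [e]
      by_cases h1 : s / r < t
      · have : 0 < t := hpos.trans h1
        simp [h1, this]
      · simp [h1]
    rw [← integral_indicator measurableSet_Ioc]
    simp only [hi]
    rw [integral_indicator measurableSet_Ioc, ← intervalIntegral.integral_of_le hlt.le,
      integral_zpow (Or.inr ⟨by norm_num, notMem_uIcc_of_lt hpos one_pos⟩)]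
    norm_num
    field_simp
    ring
  · rw [setIntegral_eq_zero_of_forall_eq_zero]
    intro t ht
    rw [if_neg]
    nlinarith [ht.2]

/-- No integration by parts across the singularity: write f(x) - f(0) as the integral of the
derivative along the ray from 0 to x, integrate over the disc, substitute z = tx and exchange the
integrals. The field is recovered after multiplication by -2/r². -/
theorem integral_fderiv_screenedField {f : Plane → ℝ} (hf : ContDiff ℝ ∞ f)
    (hc : HasCompactSupport f) {r : ℝ} (hr : 0 < r) :
    ∫ x, fderiv ℝ f x (screenedField r x) =
      2 * Real.pi * (f 0 - (volume.real (ball (0 : Plane) r))⁻¹ * ∫ x in ball 0 r, f x) := by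
  have hfc : Continuous fun z => fderiv ℝ f z := hf.continuous_fderiv (by simp)
  obtain ⟨C, hC⟩ := hfc.bounded_above_of_compact_support (hc.fderiv ℝ)
  have hC0 : 0 ≤ C := (norm_nonneg _).trans (hC 0)
  let F : ℝ × Plane → ℝ := fun a =>
    (ball (0 : Plane) (a.1 * r)).indicator (fun z => (a.1 ^ 3)⁻¹ * fderiv ℝ f z z) a.2
  have hFm : Measurable F := by
    have h1 : MeasurableSet {a : ℝ × Plane | ‖a.2‖ < a.1 * r} :=
      measurableSet_lt (by fun_prop) (by fun_prop)
    have h2 : Measurable fun z => fderiv ℝ f z z :=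
      (show Continuous fun z => fderiv ℝ f z z by fun_prop).measurable
    have : F = {a : ℝ × Plane | ‖a.2‖ < a.1 * r}.indicator
        fun a => (a.1 ^ 3)⁻¹ * fderiv ℝ f a.2 a.2 := by
      ext a
      simp only [F, indicator, mem_ball_zero_iff, mem_ofPred_eq]
    rw [this]
    refine Measurable.indicator (Measurable.mul (by fun_prop) (h2.comp measurable_snd)) h1
  have hFb : ∀ t ∈ Ioc (0 : ℝ) 1, ∀ z, ‖F (t, z)‖ ≤
      (ball (0 : Plane) (t * r)).indicator (fun _ => (t ^ 2)⁻¹ * (C * r)) z := by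
    intro t ht z
    by_cases hz : z ∈ ball 0 (t * r)
    · simp only [F, indicator_of_mem hz]
      rw [norm_mul, norm_inv, norm_pow, Real.norm_of_nonneg ht.1.le]
      have h1 : ‖fderiv ℝ f z z‖ ≤ C * (t * r) :=
        (ContinuousLinearMap.le_opNorm _ _).trans (mul_le_mul (hC z)
          (mem_ball_zero_iff.1 hz).le (norm_nonneg _) hC0)
      have ht0 := ht.1
      calc (t ^ 3)⁻¹ * ‖fderiv ℝ f z z‖ ≤ (t ^ 3)⁻¹ * (C * (t * r)) := by gcongr
        _ = _ := by field_simp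
    · simp only [F, indicator_of_notMem hz, norm_zero, le_refl]
  have hFi : ∀ t ∈ Ioc (0 : ℝ) 1, Integrable fun z => F (t, z) := fun t ht =>
    ((integrable_indicator_iff measurableSet_ball).2
      (integrableOn_const measure_ball_lt_top.ne)).mono'
      (hFm.comp measurable_prodMk_left).aestronglyMeasurable (ae_of_all _ (hFb t ht))
  -- The slice at `t` is at most C r t⁻² on a disc of area π r² t², so the factors of `t` cancel and
  -- the slice integrals are bounded.
  have hF : Integrable F ((volume.restrict (Ioc (0 : ℝ) 1)).prod volume) := by
    rw [integrable_prod_iff hFm.aestronglyMeasurable]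
    refine ⟨ae_restrict_of_forall_mem measurableSet_Ioc hFi, ?_⟩
    refine Integrable.of_bound hFm.aestronglyMeasurable.norm.integral_prod_right'
      (C * r * (Real.pi * r ^ 2)) (ae_restrict_of_forall_mem measurableSet_Ioc fun t ht => ?_)
    rw [Real.norm_of_nonneg (integral_nonneg fun _ => norm_nonneg _)]
    refine (integral_mono (hFi t ht).norm ((integrable_indicator_iff measurableSet_ball).2
      (integrableOn_const measure_ball_lt_top.ne)) (hFb t ht)).trans (le_of_eq ?_)
    have ht0 := ht.1
    rw [integral_indicator_const _ measurableSet_ball, volume_real_ball (by positivity),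
      smul_eq_mul]
    field_simp
  have hfi : Integrable f := hf.continuous.integrable_of_hasCompactSupport hc
  have key : ∫ x in ball (0 : Plane) r, (f x - f 0) =
      ∫ z, (ball (0 : Plane) r).indicator (fun z => (r ^ 2 / ‖z‖ ^ 2 - 1) / 2 * fderiv ℝ f z z) z := by
    calc ∫ x in ball (0 : Plane) r, (f x - f 0)
        = ∫ x in ball (0 : Plane) r, ∫ t in Icc (0 : ℝ) 1, fderiv ℝ f (t • x) x := by
          refine integral_congr_ae (ae_of_all _ fun x => ?_)
          have := integral_fderiv_segment hf 0 x
          simpa using this.symm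
      _ = ∫ x in ball (0 : Plane) r, ∫ t in Ioc (0 : ℝ) 1, fderiv ℝ f (t • x) x := by
          simp only [integral_Icc_eq_integral_Ioc]
      _ = ∫ t in Ioc (0 : ℝ) 1, ∫ x in ball (0 : Plane) r, fderiv ℝ f (t • x) x := by
          refine integral_integral_swap ?_
          have hm : Continuous fun a : Plane × ℝ => fderiv ℝ f (a.2 • a.1) a.1 := by fun_prop
          have : IsFiniteMeasure (volume.restrict (ball (0 : Plane) r)) :=
            ⟨by rw [Measure.restrict_apply_univ]; exact measure_ball_lt_top⟩
          refine Integrable.of_bound (C := C * r) hm.aestronglyMeasurable ?_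
          rw [Measure.prod_restrict]
          refine ae_restrict_of_forall_mem (measurableSet_ball.prod measurableSet_Ioc) fun a ha => ?_
          exact (ContinuousLinearMap.le_opNorm _ _).trans (mul_le_mul (hC _)
            (mem_ball_zero_iff.1 ha.1).le (norm_nonneg _) hC0)
      _ = ∫ t in Ioc (0 : ℝ) 1, ∫ z, F (t, z) :=
          setIntegral_congr_fun measurableSet_Ioc fun t ht => integral_fderiv_dilation r ht.1
      _ = ∫ z, ∫ t in Ioc (0 : ℝ) 1, F (t, z) := integral_integral_swap hF
      _ = _ := by
          refine integral_congr_ae ?_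
          filter_upwards [Measure.ae_ne volume (0 : Plane)] with z hz
          have hz' : 0 < ‖z‖ := norm_pos_iff.2 hz
          have h1 : ∀ t, F (t, z) = (if ‖z‖ < t * r then (t ^ 3)⁻¹ else 0) * fderiv ℝ f z z := by
            intro t
            simp only [F, indicator, mem_ball_zero_iff]
            split_ifs <;> simp
          simp only [h1]
          rw [integral_mul_const, integral_inv_cube hr hz']
          simp only [indicator, mem_ball_zero_iff]
          split_ifs <;> simp
  have hlf : ∀ x, fderiv ℝ f x (screenedField r x) = -(2 / r ^ 2) *
      (ball (0 : Plane) r).indicator (fun z => (r ^ 2 / ‖z‖ ^ 2 - 1) / 2 * fderiv ℝ f z z) x := by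
    intro x
    by_cases hx : x ∈ ball 0 r
    · simp only [screenedField, indicator_of_mem hx, map_smul, smul_eq_mul]
      have : (r ^ 2)⁻¹ - (‖x‖ ^ 2)⁻¹ = -(2 / r ^ 2) * ((r ^ 2 / ‖x‖ ^ 2 - 1) / 2) := by
        field_simp
        ring
      rw [this, mul_assoc]
    · simp [screenedField, indicator_of_notMem hx]
  simp only [hlf]
  rw [integral_const_mul, ← key, integral_sub hfi.integrableOn
    (integrableOn_const measure_ball_lt_top.ne), setIntegral_const, volume_real_ball hr.le]
  have := Real.pi_pos
  rw [smul_eq_mul]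
  field_simp
  ring

/-! ### The field of screened charges on a separated set -/

theorem integrable_fderiv_apply_field {f : Plane → ℝ} (hf : ContDiff ℝ ∞ f)
    (hc : HasCompactSupport f) {v : Plane → Plane} (hv : Integrable v) :
    Integrable fun x => fderiv ℝ f x (v x) := by
  simp_rw [fun x => fderiv_apply_eq_sum f x (v x)]
  refine integrable_finsetSum _ fun i _ => ?_
  obtain ⟨C, hC⟩ := (continuous_fderiv_apply hf (EuclideanSpace.single i 1)).bounded_above_of_compact_support
    (hasCompactSupport_fderiv_apply hc _)
  exact ((EuclideanSpace.proj (𝕜 := ℝ) i).integrable_comp hv).bdd_mul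
    (continuous_fderiv_apply hf _).aestronglyMeasurable (ae_of_all _ hC)

theorem integral_fderiv_screenedField_sub {f : Plane → ℝ} (hf : ContDiff ℝ ∞ f)
    (hc : HasCompactSupport f) {r : ℝ} (hr : 0 < r) (q : Plane) :
    ∫ x, fderiv ℝ f x (screenedField r (x - q)) =
      2 * Real.pi * (f q - (volume.real (ball (0 : Plane) r))⁻¹ * ∫ x in ball q r, f x) := by
  have h := integral_fderiv_screenedField (f := fun x => f (x + q))
    (hf.comp (contDiff_id.add contDiff_const))
    (hc.comp_homeomorph (Homeomorph.addRight q)) hr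
  simp only [fderiv_comp_add_right, zero_add] at h
  rw [← integral_sub_right_eq_self _ q] at h
  simp only [sub_add_cancel] at h
  rw [h]
  congr 3
  rw [← integral_indicator measurableSet_ball, ← integral_indicator measurableSet_ball,
    ← integral_sub_right_eq_self _ q]
  refine integral_congr_ae (ae_of_all _ fun x => ?_)
  simp only [indicator, mem_ball, sub_add_cancel, dist_eq_norm, sub_zero]

/-- The sum over the points of `Λ` of the fields of screened charges. -/
noncomputable def latticeField (r : ℝ) (Λ : Set Plane) (x : Plane) : Plane :=
  ∑ᶠ q ∈ Λ, screenedField r (x - q)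

section

variable {r : ℝ} {Λ : Set Plane}

/-- The points of a separated set in a disc. -/
noncomputable def IsSeparatedBy.pointsIn (hΛ : IsSeparatedBy (2 * r) Λ) (hr : 0 < r) (R : ℝ) :
    Finset Plane := (hΛ.finite_inter_ball hr R).toFinset

theorem IsSeparatedBy.mem_pointsIn (hΛ : IsSeparatedBy (2 * r) Λ) (hr : 0 < r) {R : ℝ}
    {q : Plane} : q ∈ hΛ.pointsIn hr R ↔ q ∈ Λ ∧ q ∈ ball 0 R :=
  (Set.Finite.mem_toFinset _)

/-- The sums over `Λ` are `finsum`s, which have the intended value only for finite support;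
boundedness of the support together with separation provides this. -/
theorem IsSeparatedBy.finsum_eq (hΛ : IsSeparatedBy (2 * r) Λ) (hr : 0 < r) {R : ℝ} {E : Type*}
    [AddCommMonoid E] {g : Plane → E} (h : ∀ q ∉ ball 0 R, g q = 0) :
    ∑ᶠ q ∈ Λ, g q = ∑ q ∈ hΛ.pointsIn hr R, g q := by
  refine finsum_mem_eq_sum_of_inter_support_eq _ (Set.ext fun q => ?_)
  simp only [mem_inter_iff, Finset.mem_coe, hΛ.mem_pointsIn hr, Function.mem_support]
  refine ⟨fun hq => ⟨⟨hq.1, ?_⟩, hq.2⟩, fun hq => ⟨hq.1.1, hq.2⟩⟩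
  by_contra h'
  exact hq.2 (h q h')

theorem notMem_ball_of_mem {R : ℝ} {x q : Plane} (hx : x ∈ ball (0 : Plane) R)
    (hq : q ∉ ball (0 : Plane) (R + r)) : x - q ∉ ball (0 : Plane) r := by
  intro h
  rw [mem_ball_zero_iff] at hx h hq
  have := norm_sub_norm_le q x
  rw [norm_sub_rev] at h
  exact hq (by linarith)

theorem latticeField_eq_sum (hΛ : IsSeparatedBy (2 * r) Λ) (hr : 0 < r) {R : ℝ} {x : Plane}
    (hx : x ∈ ball (0 : Plane) R) :
    latticeField r Λ x = ∑ q ∈ hΛ.pointsIn hr (R + r), screenedField r (x - q) :=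
  hΛ.finsum_eq hr fun _ hq => screenedField_eq_zero (notMem_ball_of_mem hx hq)

theorem latticeField_of_mem_ball (hΛ : IsSeparatedBy (2 * r) Λ) {x q : Plane} (hq : q ∈ Λ)
    (hx : x ∈ ball q r) : latticeField r Λ x = screenedField r (x - q) := by
  rw [latticeField, ← finsum_mem_singleton (f := fun q => screenedField r (x - q)) (a := q)]
  refine finsum_mem_inter_support_eq' _ _ _ fun q' hq' => ?_
  have h1 : x ∈ ball q' r := by
    by_contra h
    refine hq' (screenedField_eq_zero fun h' => h ?_)
    rwa [mem_ball_zero_iff, ← dist_eq_norm] at h'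
  rw [mem_singleton_iff]
  exact ⟨fun h => hΛ.eq_of_mem_ball h hq h1 hx, fun h => h ▸ hq⟩

theorem latticeField_of_notMem {x : Plane} (hx : ∀ q ∈ Λ, x ∉ ball q r) :
    latticeField r Λ x = 0 :=
  finsum_mem_eq_zero_of_forall_eq_zero fun q hq => screenedField_eq_zero fun h => hx q hq (by
    rwa [mem_ball_zero_iff, ← dist_eq_norm] at h)

theorem indicator_iUnion_ball_eq_sum (hΛ : IsSeparatedBy (2 * r) Λ) (hr : 0 < r) {R : ℝ}
    {x : Plane} (hx : x ∈ ball (0 : Plane) R) :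
    (⋃ q ∈ Λ, ball q r).indicator (1 : Plane → ℝ) x =
      ∑ q ∈ hΛ.pointsIn hr (R + r), (ball q r).indicator 1 x := by
  by_cases h : x ∈ ⋃ q ∈ Λ, ball q r
  · obtain ⟨q, hq, hxq⟩ := mem_iUnion₂.1 h
    rw [indicator_of_mem h, Finset.sum_eq_single q, indicator_of_mem hxq]
    · exact fun q' hq' hne => indicator_of_notMem (fun hxq' => hne
        (hΛ.eq_of_mem_ball ((hΛ.mem_pointsIn hr).1 hq').1 hq hxq' hxq)) _
    · intro hqF
      exfalso
      refine hqF ((hΛ.mem_pointsIn hr).2 ⟨hq, ?_⟩)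
      by_contra h'
      refine notMem_ball_of_mem hx h' ?_
      rwa [mem_ball_zero_iff, ← dist_eq_norm]
  · rw [indicator_of_notMem h]
    exact (Finset.sum_eq_zero fun q hq => indicator_of_notMem (fun hxq => h
      (mem_iUnion₂.2 ⟨q, ((hΛ.mem_pointsIn hr).1 hq).1, hxq⟩)) _).symm

theorem integrable_screenedField_sub (r : ℝ) (q : Plane) :
    Integrable fun x => screenedField r (x - q) :=
  (integrable_screenedField r).comp_sub_right q

theorem locallyIntegrable_latticeField (hΛ : IsSeparatedBy (2 * r) Λ) (hr : 0 < r) :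
    LocallyIntegrable (latticeField r Λ) := by
  rw [locallyIntegrable_iff]
  intro K hK
  obtain ⟨R, hR⟩ := hK.isBounded.subset_ball (0 : Plane)
  exact IntegrableOn.congr_fun (integrable_finsetSum (hΛ.pointsIn hr (R + r)) fun q _ =>
    integrable_screenedField_sub r q).integrableOn
    (fun x hx => (latticeField_eq_sum hΛ hr (hR hx)).symm) hK.measurableSet

/-- The fields of the screened charges, together with a bounded field for the charge of the discs
and the background, make up an admissible field. -/
theorem isAdmissibleField_add (hΛ : IsSeparatedBy (2 * r) Λ) (hr : 0 < r) {m K : ℝ}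
    {b : Plane → Plane} (hb : IsBoundedPrimitive univ K (fun x => 2 * Real.pi *
      ((volume.real (ball (0 : Plane) r))⁻¹ * (⋃ q ∈ Λ, ball q r).indicator 1 x - m)) b) :
    IsAdmissibleField m Λ fun x => latticeField r Λ x + b x := by
  have hli : LocallyIntegrable fun x => latticeField r Λ x + b x := by
    refine (locallyIntegrable_latticeField hΛ hr).add ?_
    refine (locallyIntegrable_const K).mono hb.measurable.aestronglyMeasurable
      (ae_of_all _ fun x => (hb.norm_le x).trans (le_abs_self K))
  refine ⟨hli, fun A hA hAΛ => ?_, fun f hf hc => ?_⟩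
  · obtain ⟨R, hR⟩ := hA.isBounded.subset_ball (0 : Plane)
    have : IsFiniteMeasure (volume.restrict A) :=
      ⟨by rw [Measure.restrict_apply_univ]; exact hA.measure_lt_top⟩
    -- Only finitely many charges act on the compact set `A`, and their singularities lie outside of
    -- it, so the field is bounded there.
    obtain ⟨B, hB⟩ := hA.exists_bound_of_continuousOn
      (f := fun x => ∑ q ∈ hΛ.pointsIn hr (R + r), ‖x - q‖⁻¹) (by
        refine continuousOn_finsetSum _ fun q hq => ContinuousOn.inv₀ (by fun_prop) fun x hx => ?_
        rw [norm_ne_zero_iff, sub_ne_zero]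
        rintro rfl
        exact hAΛ hx ((hΛ.mem_pointsIn hr).1 hq).1)
    refine MemLp.of_bound (hli.integrableOn_isCompact hA).aestronglyMeasurable (B + K)
      (ae_restrict_of_forall_mem hA.measurableSet fun x hx => ?_)
    refine (norm_add_le _ _).trans (add_le_add ?_ (hb.norm_le x))
    rw [latticeField_eq_sum hΛ hr (hR hx)]
    refine (norm_sum_le _ _).trans (le_trans ?_ ((le_abs_self _).trans (hB x hx)))
    exact Finset.sum_le_sum fun q _ => norm_screenedField_le _
  · obtain ⟨R, hR⟩ := hc.isCompact.isBounded.subset_ball (0 : Plane)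
    -- The margin `r` catches all points whose discs meet the support of `f`.
    set F := hΛ.pointsIn hr (R + r)
    have hfi : Integrable f := hf.continuous.integrable_of_hasCompactSupport hc
    have hf0 : ∀ x ∉ ball (0 : Plane) R, f x = 0 := fun x hx =>
      image_eq_zero_of_notMem_tsupport fun h => hx (hR h)
    have hfd0 : ∀ x ∉ ball (0 : Plane) R, fderiv ℝ f x = 0 := fun x hx =>
      image_eq_zero_of_notMem_tsupport fun h => hx (hR (tsupport_fderiv_subset ℝ h))
    have e1 : ∀ x, fderiv ℝ f x (latticeField r Λ x + b x) =
        ∑ q ∈ F, fderiv ℝ f x (screenedField r (x - q)) + fderiv ℝ f x (b x) := fun x => by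
      by_cases hx : x ∈ ball (0 : Plane) R
      · rw [map_add, latticeField_eq_sum hΛ hr hx, map_sum]
      · simp [hfd0 x hx]
    have hI := fun q => integrable_fderiv_apply_field hf hc (integrable_screenedField_sub r q)
    have e2 : ∀ x, f x * (2 * Real.pi * ((volume.real (ball (0 : Plane) r))⁻¹ *
        (⋃ q ∈ Λ, ball q r).indicator 1 x - m)) = 2 * Real.pi *
        ((volume.real (ball (0 : Plane) r))⁻¹ * ∑ q ∈ F, (ball q r).indicator f x - m * f x) := by
      intro x
      by_cases hx : x ∈ ball (0 : Plane) R
      · rw [indicator_iUnion_ball_eq_sum hΛ hr hx]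
        have : ∑ q ∈ F, (ball q r).indicator f x =
            f x * ∑ q ∈ F, (ball q r).indicator (1 : Plane → ℝ) x := by
          rw [Finset.mul_sum]
          refine Finset.sum_congr rfl fun q _ => ?_
          by_cases h : x ∈ ball q r <;> simp only [indicator_of_mem, indicator_of_notMem, h,
            not_false_eq_true, Pi.one_apply, mul_one, mul_zero]
        rw [this]
        ring
      · have : ∑ q ∈ F, (ball q r).indicator f x = 0 := Finset.sum_eq_zero fun q _ => by
          by_cases h : x ∈ ball q r <;> simp only [indicator_of_mem, indicator_of_notMem, h,
            not_false_eq_true, hf0 x hx]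
        rw [this, hf0 x hx]
        ring
    have hIq := fun q : Plane => hfi.indicator (measurableSet_ball (x := q) (ε := r))
    simp only [e1]
    rw [integral_add (integrable_finsetSum _ fun q _ => hI q) (hb.integrable hf hc),
      integral_finsetSum _ fun q _ => hI q, hb.weak_eq f hf hc]
    simp only [e2, integral_fderiv_screenedField_sub hf hc hr]
    rw [integral_const_mul, integral_sub ((integrable_finsetSum _ fun q _ => hIq q).const_mul _)
      (hfi.const_mul _), integral_const_mul, integral_const_mul,
      integral_finsetSum _ fun q _ => hIq q]
    simp only [integral_indicator measurableSet_ball]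
    rw [hΛ.finsum_eq hr (R := R + r) fun q hq => hf0 q fun h =>
      hq (ball_subset_ball (by linarith) h), ← Finset.mul_sum, Finset.sum_sub_distrib,
      ← Finset.mul_sum]
    ring

end

/-! ### The energy of the field of screened charges -/

/-- A radial profile supported in an annulus. -/
noncomputable def annulusProfile (η r a D : ℝ) (x : Plane) : ℝ :=
  (ball (0 : Plane) r \ ball 0 η).indicator (fun y => a * (‖y‖ ^ 2)⁻¹ + D * ‖y‖⁻¹) x

theorem annulusProfile_nonneg {η r a D : ℝ} (ha : 0 ≤ a) (hD : 0 ≤ D) (x : Plane) :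
    0 ≤ annulusProfile η r a D x :=
  indicator_nonneg (fun _ _ => by positivity) x

theorem annulusProfile_eq (η r a D : ℝ) (x : Plane) : annulusProfile η r a D x =
    (Ico η r).indicator (fun s => a * (s ^ 2)⁻¹ + D * s⁻¹) ‖x‖ := by
  simp only [annulusProfile, indicator, Set.mem_sdiff, mem_ball_zero_iff, mem_Ico, not_lt, and_comm]

theorem integrable_annulusProfile {η : ℝ} (hη : 0 < η) (r a D : ℝ) :
    Integrable (annulusProfile η r a D) := by
  refine (integrable_indicator_iff (measurableSet_ball.diff measurableSet_ball)).2 ?_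
  refine Measure.integrableOn_of_bounded (M := |a| * (η ^ 2)⁻¹ + |D| * η⁻¹)
    ((measure_mono sdiff_subset).trans_lt measure_ball_lt_top).ne ?_
    (ae_restrict_of_forall_mem (measurableSet_ball.diff measurableSet_ball) fun x hx => ?_)
  · exact Measurable.aestronglyMeasurable (by fun_prop)
  · have hx' : η ≤ ‖x‖ := by simpa using hx.2
    have := hη.trans_le hx'
    refine (norm_add_le _ _).trans ?_
    rw [norm_mul, norm_mul, norm_inv, norm_inv, norm_pow, norm_norm, Real.norm_eq_abs,
      Real.norm_eq_abs]
    gcongr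

theorem integral_annulusProfile {η r : ℝ} (hη : 0 < η) (hηr : η ≤ r) (a D : ℝ) :
    ∫ x, annulusProfile η r a D x =
      2 * Real.pi * (a * (Real.log r - Real.log η) + D * (r - η)) := by
  simp only [annulusProfile_eq]
  rw [integral_fun_norm_addHaar volume
    (fun s => (Ico η r).indicator (fun s => a * (s ^ 2)⁻¹ + D * s⁻¹) s), finrank_euclideanSpace,
    Fintype.card_fin, volume_real_ball zero_le_one]
  have hr := hη.trans_le hηr
  have h1 : ∫ y in Ioi (0 : ℝ), y ^ (2 - 1) • (Ico η r).indicator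
      (fun s => a * (s ^ 2)⁻¹ + D * s⁻¹) y = ∫ y in η..r, (a * y⁻¹ + D) := by
    rw [intervalIntegral.integral_of_le hηr, ← integral_Ico_eq_integral_Ioc,
      ← integral_indicator measurableSet_Ioi, ← integral_indicator measurableSet_Ico]
    refine integral_congr_ae (ae_of_all _ fun y => ?_)
    by_cases hy : y ∈ Ico η r
    · have hy0 : 0 < y := hη.trans_le hy.1
      rw [indicator_of_mem (mem_Ioi.2 hy0), indicator_of_mem hy, indicator_of_mem hy, smul_eq_mul]
      field_simp
      norm_num
    · rw [indicator_of_notMem hy]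
      by_cases hy0 : y ∈ Ioi (0 : ℝ)
      · rw [indicator_of_mem hy0, indicator_of_notMem hy, smul_zero]
      · rw [indicator_of_notMem hy0]
  have hii : IntervalIntegrable (fun y : ℝ => y⁻¹) volume η r :=
    intervalIntegrable_inv_iff.2 (Or.inr (notMem_uIcc_of_lt hη hr))
  rw [h1, intervalIntegral.integral_add (hii.const_mul a) (by simp),
    intervalIntegral.integral_const_mul, integral_inv_of_pos hη hr, Real.log_div hr.ne' hη.ne',
    intervalIntegral.integral_const]
  simp only [smul_eq_mul, nsmul_eq_mul]
  push_cast
  ring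

section

variable {r : ℝ} {Λ : Set Plane}

/-- The bounds on a cutoff function that enter the estimate of the energy. -/
structure IsCutoff (C R : ℝ) (f : Plane → ℝ) : Prop where
  nonneg : ∀ x, 0 ≤ f x
  lipschitz : ∀ x y, |f x - f y| ≤ C * ‖x - y‖
  eq_zero : ∀ x ∉ ball (0 : Plane) R, f x = 0
  le : ∀ x, f x ≤ 1 + C

/-- A cutoff is not assumed to be at most 1. In the annulus where it is neither 1 nor 0, the circle
on which it vanishes is at distance at most 1, so the gradient bound gives at most `C` there. -/
theorem IsCutoffFamily.isCutoff {χ : ℝ → Plane → ℝ} (hχ : IsCutoffFamily χ) :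
    ∃ C, 0 ≤ C ∧ ∀ R, 1 < R → IsCutoff C R (χ R) := by
  obtain ⟨C, hC⟩ := hχ
  have hC0 : 0 ≤ C := (norm_nonneg _).trans ((hC 2 (by norm_num)).2.2.1 0)
  refine ⟨C, hC0, fun R hR => ?_⟩
  obtain ⟨hs, h0, hd, h1, hz⟩ := hC R hR
  have hl : ∀ x y, |χ R x - χ R y| ≤ C * ‖x - y‖ := fun x y =>
    Convex.norm_image_sub_le_of_norm_fderiv_le (𝕜 := ℝ)
      (fun x _ => hs.differentiable (by simp) x) (fun x _ => hd x) convex_univ (mem_univ _)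
      (mem_univ _)
  refine ⟨h0, hl, hz, fun x => ?_⟩
  by_cases hx1 : x ∈ ball (0 : Plane) (R - 1)
  · rw [h1 x hx1]; linarith
  by_cases hx : x ∈ ball (0 : Plane) R
  · rw [mem_ball_zero_iff] at hx hx1
    have hxn : 0 < ‖x‖ := by linarith
    have hy : χ R ((R / ‖x‖) • x) = 0 := hz _ (by
      rw [mem_ball_zero_iff, norm_smul, norm_div, norm_norm, div_mul_cancel₀ _ hxn.ne',
        Real.norm_of_nonneg (by linarith)]
      exact lt_irrefl R)
    have h2 := hl x ((R / ‖x‖) • x)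
    rw [hy, sub_zero, abs_of_nonneg (h0 x)] at h2
    have h3 : ‖x - (R / ‖x‖) • x‖ = R - ‖x‖ := by
      rw [show x - (R / ‖x‖) • x = (1 - R / ‖x‖) • x by rw [sub_smul, one_smul], norm_smul,
        Real.norm_of_nonpos (by rw [sub_nonpos, one_le_div hxn]; exact hx.le)]
      field_simp
      ring
    rw [h3] at h2
    nlinarith
  · rw [hz x hx]; linarith

/-- Outside of the small discs, the energy density is bounded by an explicit integrable function. -/
theorem energy_density_le (hΛ : IsSeparatedBy (2 * r) Λ) (hr : 0 < r) {K C R η : ℝ} (hK : 0 ≤ K)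
    (hC : 0 ≤ C) {b : Plane → Plane} (hb : ∀ x, ‖b x‖ ≤ K) {f : Plane → ℝ} (hf : IsCutoff C R f)
    {x : Plane} (hx : x ∈ (⋃ q ∈ Λ, ball q η)ᶜ) :
    f x * ‖latticeField r Λ x + b x‖ ^ 2 ≤
      (ball (0 : Plane) R).indicator (fun _ => (1 + C) * K ^ 2) x +
      ∑ q ∈ hΛ.pointsIn hr (R + r),
        annulusProfile η r (f q) (C + 2 * K * (1 + C)) (x - q) := by
  have hnn : ∀ q ∈ hΛ.pointsIn hr (R + r),
      0 ≤ annulusProfile η r (f q) (C + 2 * K * (1 + C)) (x - q) := fun q _ =>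
    annulusProfile_nonneg (hf.nonneg q) (by positivity) _
  by_cases hxR : x ∈ ball (0 : Plane) R
  · rw [indicator_of_mem hxR]
    by_cases h : ∃ q ∈ Λ, x ∈ ball q r
    · obtain ⟨q, hq, hxq⟩ := h
      have hxq' : x - q ∈ ball (0 : Plane) r := by rwa [mem_ball_zero_iff, ← dist_eq_norm]
      have hqF : q ∈ hΛ.pointsIn hr (R + r) := by
        refine (hΛ.mem_pointsIn hr).2 ⟨hq, ?_⟩
        by_contra h'
        exact notMem_ball_of_mem hxR h' hxq'
      refine le_trans ?_ (add_le_add le_rfl (Finset.single_le_sum hnn hqF))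
      have hxη : x - q ∉ ball (0 : Plane) η := fun h => hx (mem_iUnion₂.2 ⟨q, hq, by
        rwa [mem_ball_zero_iff, ← dist_eq_norm] at h⟩)
      rw [annulusProfile, indicator_of_mem (Set.mem_sdiff _ |>.2 ⟨hxq', hxη⟩), latticeField_of_mem_ball hΛ hq hxq]
      have h1 := norm_screenedField_le (r := r) (x - q)
      have h2 : ‖screenedField r (x - q) + b x‖ ≤ ‖x - q‖⁻¹ + K :=
        (norm_add_le _ _).trans (add_le_add h1 (hb x))
      have h3 : ‖screenedField r (x - q) + b x‖ ^ 2 ≤ (‖x - q‖⁻¹ + K) ^ 2 := by gcongr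
      -- Only the singular term |x - q|⁻² needs the exact weight `f q`, to match π log η f(q). The
      -- Lipschitz error is C|x - q|⁻¹, and the cross term with `b` is at most 2K(1 + C)|x - q|⁻¹;
      -- both are integrable.
      have h4 : f x - f q ≤ C * ‖x - q‖ := (le_abs_self _).trans (hf.lipschitz x q)
      have h5 := hf.le x
      have h6 := hf.nonneg x
      have hρ : 0 ≤ ‖x - q‖⁻¹ := by positivity
      have h7 : ‖x - q‖ * ‖x - q‖⁻¹ ^ 2 = ‖x - q‖⁻¹ := by
        rcases (norm_nonneg (x - q)).eq_or_lt with h | h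
        · simp [← h]
        · field_simp
      have h8 : f x * ‖x - q‖⁻¹ ^ 2 ≤ f q * ‖x - q‖⁻¹ ^ 2 + C * ‖x - q‖⁻¹ := by
        have : (f x - f q) * ‖x - q‖⁻¹ ^ 2 ≤ C * ‖x - q‖ * ‖x - q‖⁻¹ ^ 2 := by gcongr
        rw [mul_assoc, h7] at this
        linarith
      have h9 : f x * (2 * K * ‖x - q‖⁻¹ + K ^ 2) ≤ (1 + C) * (2 * K * ‖x - q‖⁻¹ + K ^ 2) := by
        gcongr
      have h10 : f x * ‖screenedField r (x - q) + b x‖ ^ 2 ≤ f x * (‖x - q‖⁻¹ + K) ^ 2 := by gcongr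
      rw [← inv_pow]
      nlinarith
    · push Not at h
      rw [latticeField_of_notMem h, zero_add]
      have h1 : ‖b x‖ ^ 2 ≤ K ^ 2 := by gcongr; exact hb x
      have h2 : f x * ‖b x‖ ^ 2 ≤ (1 + C) * K ^ 2 :=
        mul_le_mul (hf.le x) h1 (by positivity) (by positivity)
      exact h2.trans (le_add_of_nonneg_right (Finset.sum_nonneg hnn))
  · rw [hf.eq_zero x hxR, indicator_of_notMem hxR, zero_mul, zero_add]
    exact Finset.sum_nonneg hnn

/-- The renormalized energy in a disc is at most proportional to the area of the disc. -/
theorem localEnergy_le (hΛ : IsSeparatedBy (2 * r) Λ) (hr : 0 < r) {K C : ℝ} (hK : 0 ≤ K)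
    (hC : 0 ≤ C) {b : Plane → Plane} (hb : ∀ x, ‖b x‖ ≤ K) :
    ∃ B : ℝ, ∀ R, 1 < R → ∀ f : Plane → ℝ, IsCutoff C R f →
      localEnergy Λ f (fun x => latticeField r Λ x + b x) ≤ ((B * R ^ 2 : ℝ) : EReal) := by
  set D := C + 2 * K * (1 + C) with hD
  have hD0 : 0 ≤ D := by positivity
  set A := Real.pi * ((1 + C) * |Real.log r| + D * r) with hA
  have hπ := Real.pi_pos
  have hA0 : 0 ≤ A := by positivity
  -- The first term is half the energy bound for the bounded field, per R². In the second, `A`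
  -- bounds the renormalized contribution of one point, and its factor bounds the number of points
  -- per R², where R > 1 is used.
  refine ⟨(1 + C) * K ^ 2 * Real.pi / 2 + (1 + 2 * r) ^ 2 / r ^ 2 * A, fun R hR f hf => ?_⟩
  refine limsup_le_of_le (by isBoundedDefault) ?_
  filter_upwards [Ioo_mem_nhdsGT hr] with η hη
  set F := hΛ.pointsIn hr (R + r) with hF
  let G : Plane → ℝ := fun x => (ball (0 : Plane) R).indicator (fun _ => (1 + C) * K ^ 2) x +
      ∑ q ∈ F, annulusProfile η r (f q) D (x - q)
  have hGi1 : Integrable ((ball (0 : Plane) R).indicator fun _ => (1 + C) * K ^ 2) :=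
    (integrable_indicator_iff measurableSet_ball).2 (integrableOn_const measure_ball_lt_top.ne)
  have hGi2 : ∀ q, Integrable fun x => annulusProfile η r (f q) D (x - q) := fun q =>
    (integrable_annulusProfile hη.1 r (f q) D).comp_sub_right q
  have hGi : Integrable G := hGi1.add (integrable_finsetSum _ fun q _ => hGi2 q)
  have hG0 : ∀ x, 0 ≤ G x := fun x => add_nonneg (indicator_nonneg (fun _ _ => by positivity) x)
    (Finset.sum_nonneg fun q _ => annulusProfile_nonneg (hf.nonneg q) hD0 _)
  have hGint : ∫ x, G x = (1 + C) * K ^ 2 * (Real.pi * R ^ 2) +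
      ∑ q ∈ F, 2 * Real.pi * (f q * (Real.log r - Real.log η) + D * (r - η)) := by
    rw [integral_add hGi1 (integrable_finsetSum _ fun q _ => hGi2 q),
      integral_finsetSum _ fun q _ => hGi2 q, integral_indicator_const _ measurableSet_ball,
      volume_real_ball (by linarith), smul_eq_mul, mul_comm]
    congr 1
    refine Finset.sum_congr rfl fun q _ => ?_
    rw [integral_sub_right_eq_self (fun x => annulusProfile η r (f q) D x),
      integral_annulusProfile hη.1 hη.2.le]
  have h1 : ∫⁻ x in (⋃ q ∈ Λ, ball q η)ᶜ,
      ENNReal.ofReal (f x * ‖latticeField r Λ x + b x‖ ^ 2) ≤ ENNReal.ofReal (∫ x, G x) := by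
    rw [ofReal_integral_eq_lintegral_ofReal hGi (ae_of_all _ hG0)]
    refine le_trans (setLIntegral_mono' (isOpen_biUnion fun _ _ => isOpen_ball).measurableSet.compl
      fun x hx => ENNReal.ofReal_le_ofReal (energy_density_le hΛ hr hK hC hb hf hx))
      (setLIntegral_le_lintegral _ _)
  have h2 : (((∫⁻ x in (⋃ q ∈ Λ, ball q η)ᶜ,
      ENNReal.ofReal (f x * ‖latticeField r Λ x + b x‖ ^ 2)) / 2 : ℝ≥0∞) : EReal) ≤
      (((∫ x, G x) / 2 : ℝ) : EReal) := by
    have h3 : (∫⁻ x in (⋃ q ∈ Λ, ball q η)ᶜ,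
      ENNReal.ofReal (f x * ‖latticeField r Λ x + b x‖ ^ 2)) / 2 ≤
        ENNReal.ofReal ((∫ x, G x) / 2) := by
      rw [ENNReal.ofReal_div_of_pos (by norm_num)]
      simpa using ENNReal.div_le_div_right h1 2
    refine (EReal.coe_ennreal_le_coe_ennreal_iff.2 h3).trans (le_of_eq ?_)
    rw [EReal.coe_ennreal_ofReal, max_eq_left]
    exact div_nonneg (integral_nonneg hG0) (by norm_num)
  refine (add_le_add_left h2 _).trans ?_
  rw [← EReal.coe_add, EReal.coe_le_coe_iff, hΛ.finsum_eq hr (R := R + r) fun q hq =>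
    hf.eq_zero q fun h => hq (ball_subset_ball (by linarith) h), hGint]
  have hsum : (∑ q ∈ F, 2 * Real.pi * (f q * (Real.log r - Real.log η) + D * (r - η))) / 2 +
      Real.pi * Real.log η * ∑ q ∈ F, f q ≤ F.card * A := by
    rw [Finset.sum_div, Finset.mul_sum, ← Finset.sum_add_distrib]
    refine (Finset.sum_le_card_nsmul _ _ A fun q _ => ?_).trans (le_of_eq (nsmul_eq_mul _ _))
    -- The renormalization: log η cancels point by point, so the bound holds for every η < r and not
    -- only in the limit.
    have e : 2 * Real.pi * (f q * (Real.log r - Real.log η) + D * (r - η)) / 2 +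
      Real.pi * Real.log η * f q = Real.pi * (f q * Real.log r + D * (r - η)) := by ring
    rw [e, hA]
    have h3 : f q * Real.log r ≤ (1 + C) * |Real.log r| :=
      (mul_le_mul_of_nonneg_left (le_abs_self _) (hf.nonneg q)).trans
        (mul_le_mul_of_nonneg_right (hf.le q) (abs_nonneg _))
    have h4 : D * (r - η) ≤ D * r := mul_le_mul_of_nonneg_left (by linarith [hη.1]) hD0
    exact mul_le_mul_of_nonneg_left (add_le_add h3 h4) hπ.le
  have hcard : (F.card : ℝ) ≤ (1 + 2 * r) ^ 2 / r ^ 2 * R ^ 2 := by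
    have h3 : (F.card : ℝ) * r ^ 2 ≤ (R + r + r) ^ 2 :=
      hΛ.card_le hr (by linarith) fun q hq => (hΛ.mem_pointsIn hr).1 hq
    have h4 : (R + r + r) ^ 2 ≤ ((1 + 2 * r) * R) ^ 2 := by
      have : R + r + r ≤ (1 + 2 * r) * R := by nlinarith
      gcongr
    rw [div_mul_eq_mul_div, le_div_iff₀ (by positivity)]
    linarith
  have hcA := mul_le_mul_of_nonneg_right hcard hA0
  rw [add_div]
  linarith

theorem fieldEnergy_lt_top (hΛ : IsSeparatedBy (2 * r) Λ) (hr : 0 < r) {K : ℝ}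
    {b : Plane → Plane} (hb : ∀ x, ‖b x‖ ≤ K) {χ : ℝ → Plane → ℝ} (hχ : IsCutoffFamily χ) :
    fieldEnergy χ Λ (fun x => latticeField r Λ x + b x) < ⊤ := by
  obtain ⟨C, hC, hcut⟩ := hχ.isCutoff
  obtain ⟨B, hB⟩ := localEnergy_le hΛ hr ((norm_nonneg _).trans (hb 0)) hC hb
  refine lt_of_le_of_lt (limsup_le_of_le (a := ((B / Real.pi : ℝ) : EReal)) (by isBoundedDefault) ?_)
    (EReal.coe_lt_top _)
  filter_upwards [eventually_gt_atTop 1] with R hR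
  have hpos : 0 < Real.pi * R ^ 2 := by have := Real.pi_pos; positivity
  refine (EReal.div_le_div_right_of_nonneg (EReal.coe_nonneg.2 hpos.le)
    (hB R hR _ (hcut R hR))).trans (le_of_eq ?_)
  rw [← EReal.coe_div]
  congr 1
  field_simp

theorem tildeW_lt_top (hΛ : IsSeparatedBy (2 * r) Λ) (hr : 0 < r) {m K : ℝ}
    (H : HasBoundedPrimitive univ K fun x =>
      (volume.real (ball (0 : Plane) r))⁻¹ * (⋃ q ∈ Λ, ball q r).indicator 1 x - m)
    {χ : ℝ → Plane → ℝ} (hχ : IsCutoffFamily χ) : tildeW χ m Λ < ⊤ := by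
  obtain ⟨b, hb⟩ := H.const_mul (2 * Real.pi)
  exact (iInf₂_le _ (isAdmissibleField_add hΛ hr hb)).trans_lt
    (fieldEnergy_lt_top hΛ hr hb.norm_le hχ)

end

/-! ### Triangles -/

theorem mem_convexHull_triple {P Q R x : Plane} :
    x ∈ convexHull ℝ {P, Q, R} ↔ ∃ a b c : ℝ, 0 ≤ a ∧ 0 ≤ b ∧ 0 ≤ c ∧ a + b + c = 1 ∧
      a • P + b • Q + c • R = x := by
  constructor
  · rw [convexHull_insert (insert_nonempty _ _), convexHull_pair, mem_convexJoin]
    rintro ⟨_, rfl, y, ⟨b, c, hb, hc, hbc, rfl⟩, ⟨s, t, hs, ht, hst, rfl⟩⟩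
    refine ⟨s, t * b, t * c, hs, by positivity, by positivity, ?_, ?_⟩
    · linear_combination hst + t * hbc
    · rw [smul_add, smul_smul, smul_smul, add_assoc]
  · rintro ⟨a, b, c, ha, hb, hc, h, rfl⟩
    have := (convex_convexHull ℝ {P, Q, R}).sum_mem (t := Finset.univ) (w := ![a, b, c])
      (z := ![P, Q, R]) (fun i _ => by fin_cases i <;> assumption)
      (by simpa [Fin.sum_univ_three] using h) (fun i _ => subset_convexHull ℝ _ (by
        fin_cases i <;> simp))
    simpa [Fin.sum_univ_three] using this

/-- In barycentric coordinates (a, b, c) the line through P and D is c(1 - s) = bs, and the sign of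
the difference decides the half. -/
theorem convexHull_triple_split {P Q R D : Plane} {s : ℝ} (hs : 0 < s) (hs1 : s < 1)
    (hD : D = (1 - s) • Q + s • R) :
    convexHull ℝ {P, Q, R} = convexHull ℝ {P, Q, D} ∪ convexHull ℝ {P, D, R} := by
  have h1s : 0 < 1 - s := by linarith
  ext x
  simp only [mem_union, mem_convexHull_triple]
  constructor
  · rintro ⟨a, b, c, ha, hb, hc, h, rfl⟩
    rcases le_total (c * (1 - s)) (b * s) with h' | h'
    · refine Or.inl ⟨a, b - c * (1 - s) / s, c / s, ha, ?_, by positivity, ?_, ?_⟩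
      · rw [sub_nonneg, div_le_iff₀ hs]; exact h'
      · field_simp
        linear_combination s * h
      · rw [hD]
        match_scalars <;> field_simp <;> ring
    · refine Or.inr ⟨a, b / (1 - s), c - b * s / (1 - s), ha, by positivity, ?_, ?_, ?_⟩
      · rw [sub_nonneg, div_le_iff₀ h1s]; exact h'
      · field_simp
        linear_combination (1 - s) * h
      · rw [hD]
        match_scalars <;> field_simp <;> ring
  · rintro (⟨a, b, c, ha, hb, hc, h, rfl⟩ | ⟨a, b, c, ha, hb, hc, h, rfl⟩)
    · refine ⟨a, b + c * (1 - s), c * s, ha, by positivity, by positivity,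
        by linear_combination h, ?_⟩
      rw [hD]
      module
    · refine ⟨a, b * (1 - s), c + b * s, ha, by positivity, by positivity,
        by linear_combination h, ?_⟩
      rw [hD]
      module

/-- A common interior point could be moved slightly in the direction `n` within `U`, which would
make its inner product strictly positive. -/
theorem disjoint_interior_of_halfplanes {U V : Set Plane} {n P : Plane} (hn : n ≠ 0)
    (hU : ∀ x ∈ U, inner ℝ n (x - P) ≤ 0) (hV : ∀ x ∈ V, 0 ≤ inner ℝ n (x - P)) :
    Disjoint (interior U) (interior V) := by
  rw [Set.disjoint_left]
  intro x hxU hxV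
  have hc : Continuous fun ε : ℝ => x + ε • n := by fun_prop
  have h1 : ∀ᶠ ε in 𝓝[>] (0 : ℝ), x + ε • n ∈ interior U :=
    nhdsWithin_le_nhds (hc.continuousAt.eventually_mem
      (isOpen_interior.mem_nhds (by simpa using hxU)))
  obtain ⟨ε, hε, hε0⟩ := (h1.and self_mem_nhdsWithin).exists
  have h2 := hU _ (interior_subset hε)
  have h3 := hV _ (interior_subset hxV)
  rw [show x + ε • n - P = (x - P) + ε • n by abel, inner_add_right, inner_smul_right,
    real_inner_self_eq_norm_sq] at h2
  have h4 : 0 < ε * ‖n‖ ^ 2 := by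
    have := norm_pos_iff.2 hn
    have : 0 < ε := hε0
    positivity
  linarith

theorem inner_le_of_mem_convexHull_triple {n P A B x : Plane} (hA : inner ℝ n (A - P) ≤ 0)
    (hB : inner ℝ n (B - P) ≤ 0) (hx : x ∈ convexHull ℝ {P, A, B}) : inner ℝ n (x - P) ≤ 0 := by
  obtain ⟨a, b, c, ha, hb, hc, h, rfl⟩ := mem_convexHull_triple.1 hx
  have : a • P + b • A + c • B - P = b • (A - P) + c • (B - P) := by
    rw [show a = 1 - b - c by linarith]
    module
  rw [this, inner_add_right, inner_smul_right, inner_smul_right]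
  nlinarith

/-- The cut lies on a line with normal `n`, obtained by a quarter turn of `D - P`. As `D` lies
between `Q` and `R`, these are on opposite sides; which side is which depends on the orientation,
hence the two cases. -/
theorem disjoint_interior_split {P Q R D : Plane} {s : ℝ} (hs : 0 < s) (hs1 : s < 1)
    (hD : D = (1 - s) • Q + s • R) (hDP : D ≠ P) :
    Disjoint (interior (convexHull ℝ {P, Q, D})) (interior (convexHull ℝ {P, D, R})) := by
  set n : Plane := !₂[-((D - P) 1), (D - P) 0] with hn
  have hn0 : n ≠ 0 := by
    intro h
    have h0 := congrArg (fun v : Plane => v 0) h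
    have h1 := congrArg (fun v : Plane => v 1) h
    simp only [hn] at h0 h1
    apply hDP
    rw [← sub_eq_zero]
    ext i
    fin_cases i
    · simpa using h1
    · simp at h0 ⊢
      linarith
  have hnD : inner ℝ n (D - P) = 0 := by
    simp [hn, PiLp.inner_apply]
    ring
  have hQR : (1 - s) * inner ℝ n (Q - P) + s * inner ℝ n (R - P) = 0 := by
    rw [← hnD, hD, ← inner_smul_right, ← inner_smul_right, ← inner_add_right]
    congr 1
    module
  rcases le_total (inner ℝ n (Q - P)) 0 with h | h
  · have hR : inner ℝ (-n) (R - P) ≤ 0 := by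
      rw [inner_neg_left]
      nlinarith
    refine disjoint_interior_of_halfplanes hn0
      (fun x hx => inner_le_of_mem_convexHull_triple h hnD.le hx) fun x hx => ?_
    have := inner_le_of_mem_convexHull_triple (n := -n) (by rw [inner_neg_left, hnD, neg_zero]) hR hx
    rw [inner_neg_left] at this
    linarith
  · have hR : inner ℝ n (R - P) ≤ 0 := by nlinarith
    refine (disjoint_interior_of_halfplanes hn0
      (fun x hx => inner_le_of_mem_convexHull_triple hnD.le hR hx) fun x hx => ?_).symm
    have := inner_le_of_mem_convexHull_triple (n := -n) (A := Q) (by rw [inner_neg_left]; linarith)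
      (by rw [inner_neg_left, hnD, neg_zero]) hx
    rw [inner_neg_left] at this
    linarith

/-- Stewart's theorem; it gives the length of the cut in the dissections below. -/
theorem dist_sq_combination (P Q R : Plane) (s : ℝ) :
    dist P ((1 - s) • Q + s • R) ^ 2 =
      (1 - s) * dist P Q ^ 2 + s * dist P R ^ 2 - s * (1 - s) * dist Q R ^ 2 := by
  simp only [dist_eq_norm]
  have h1 : P - ((1 - s) • Q + s • R) = (1 - s) • (P - Q) + s • (P - R) := by module
  have h2 : Q - R = (P - R) - (P - Q) := by abel
  rw [h1, h2, norm_add_sq_real, norm_sub_sq_real (P - R) (P - Q), norm_smul, norm_smul, mul_pow, mul_pow,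
    inner_smul_left, inner_smul_right, Real.norm_eq_abs, Real.norm_eq_abs, sq_abs, sq_abs,
    real_inner_comm (P - Q) (P - R)]
  simp only [conj_trivial]
  ring

theorem dist_combination_left (Q R : Plane) {s : ℝ} (hs : 0 ≤ s) :
    dist Q ((1 - s) • Q + s • R) = s * dist Q R := by
  rw [dist_eq_norm, dist_eq_norm, show Q - ((1 - s) • Q + s • R) = s • (Q - R) by module,
    norm_smul, Real.norm_of_nonneg hs]

theorem dist_combination_right (Q R : Plane) {s : ℝ} (hs : s ≤ 1) :
    dist ((1 - s) • Q + s • R) R = (1 - s) * dist Q R := by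
  rw [dist_eq_norm, dist_eq_norm, show (1 - s) • Q + s • R - R = (1 - s) • (Q - R) by module,
    norm_smul, Real.norm_of_nonneg (by linarith)]

/-! ### Golden dissections and existence of the substitution rules -/

/-- `T` is the union of `U` and `V`, which do not overlap. -/
def IsDissection (T U V : Set Plane) : Prop := T = U ∪ V ∧ Disjoint (interior U) (interior V)

theorem triple_rotate (A B C : Plane) : ({A, B, C} : Set Plane) = {B, C, A} := by
  rw [insert_comm, pair_comm A C]

/-- Cut from a base vertex `C` to the point `D` of the opposite leg at distance `l` from the apex.
Then `CD` also has length `l`, and both pieces are isosceles. -/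
theorem exists_dissection_acute {T : Set Plane} {l : ℝ} (hl : 0 < l)
    (hT : IsTriangleWithSides T (Real.goldenRatio * l) (Real.goldenRatio * l) l) :
    ∃ U V, IsTriangleWithSides U l l (Real.goldenRatio⁻¹ * l) ∧
      IsTriangleWithSides V l l (Real.goldenRatio * l) ∧ IsDissection T U V := by
  obtain ⟨A, B, C, hAB, hAC, hBC, rfl⟩ := hT
  have hφ := Real.goldenRatio_sq
  have hφ1 := Real.one_lt_goldenRatio
  have hφ0 := Real.goldenRatio_pos
  have hinv : Real.goldenRatio⁻¹ = Real.goldenRatio - 1 :=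
    inv_eq_of_mul_eq_one_right (by linear_combination hφ)
  have hφ2 := Real.goldenRatio_lt_two
  rw [hinv]
  set φ := Real.goldenRatio
  set D := (1 - (φ - 1)) • A + (φ - 1) • B with hD
  have hDA : dist A D = l := by
    rw [hD, dist_combination_left _ _ (by linarith), hAB]
    linear_combination l * hφ
  have hDB : dist D B = (φ - 1) * l := by
    rw [hD, dist_combination_right _ _ (by linarith), hAB]
    linear_combination -l * hφ
  have hCD : dist C D = l := by
    have := dist_sq_combination C A B (φ - 1)
    rw [← hD, dist_comm C A, dist_comm C B, hAC, hBC, hAB] at this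
    refine (sq_eq_sq₀ dist_nonneg hl.le).1 (this.trans ?_)
    linear_combination (l ^ 2 * (φ ^ 2 - 3 * φ + 2)) * hφ
  refine ⟨convexHull ℝ {C, D, B}, convexHull ℝ {C, A, D}, ⟨C, D, B, hCD, ?_, hDB, rfl⟩,
    ⟨D, C, A, ?_, ?_, ?_, ?_⟩, ?_, ?_⟩
  · rw [dist_comm, hBC]
  · rw [dist_comm, hCD]
  · rw [dist_comm, hDA]
  · rw [dist_comm, hAC]
  · rw [← triple_rotate, triple_rotate, triple_rotate]
  · rw [union_comm, ← convexHull_triple_split (by linarith) (by linarith) hD, ← triple_rotate]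
  · exact (disjoint_interior_split (by linarith) (by linarith) hD fun h => by
      rw [h, dist_self] at hCD
      exact hl.ne hCD).symm

/-- Cut from the apex to the point that divides the base in the golden section, at distance φl from
one end and `l` from the other; the cut has length `l`. -/
theorem exists_dissection_obtuse {T : Set Plane} {l : ℝ} (hl : 0 < l)
    (hT : IsTriangleWithSides T (Real.goldenRatio * l) (Real.goldenRatio * l)
      (Real.goldenRatio ^ 2 * l)) :
    ∃ U V, IsTriangleWithSides U (Real.goldenRatio * l) (Real.goldenRatio * l) l ∧
      IsTriangleWithSides V l l (Real.goldenRatio * l) ∧ IsDissection T U V := by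
  obtain ⟨A, B, C, hAB, hAC, hBC, rfl⟩ := hT
  have hφ := Real.goldenRatio_sq
  have hφ1 := Real.one_lt_goldenRatio
  have hφ0 := Real.goldenRatio_pos
  have hφ2 := Real.goldenRatio_lt_two
  set φ := Real.goldenRatio
  set D := (1 - (φ - 1)) • B + (φ - 1) • C with hD
  have hBD : dist B D = φ * l := by
    rw [hD, dist_combination_left _ _ (by linarith), hBC]
    linear_combination l * φ * hφ
  have hDC : dist D C = l := by
    rw [hD, dist_combination_right _ _ (by linarith), hBC]
    linear_combination l * (1 - φ) * hφ
  have hAD : dist A D = l := by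
    have := dist_sq_combination A B C (φ - 1)
    rw [← hD, hAC, hBC, hAB] at this
    refine (sq_eq_sq₀ dist_nonneg hl.le).1 (this.trans ?_)
    linear_combination (l ^ 2 * (φ ^ 4 - 2 * φ ^ 3 + φ ^ 2 - φ + 1)) * hφ
  refine ⟨convexHull ℝ {A, B, D}, convexHull ℝ {A, D, C}, ⟨B, A, D, ?_, hBD, hAD, ?_⟩,
    ⟨D, A, C, ?_, hDC, hAC, ?_⟩, ?_, ?_⟩
  · rw [dist_comm, hAB]
  · rw [insert_comm]
  · rw [dist_comm, hAD]
  · rw [insert_comm]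
  · exact convexHull_triple_split (by linarith) (by linarith) hD
  · exact disjoint_interior_split (by linarith) (by linarith) hD fun h => by
      rw [h, dist_self] at hAD
      exact hl.ne hAD

theorem linearIndependent_pair_of_gram_ne_zero {u v : Plane}
    (h : ‖u‖ ^ 2 * ‖v‖ ^ 2 - inner ℝ u v ^ 2 ≠ 0) : LinearIndependent ℝ ![u, v] := by
  rw [LinearIndependent.pair_iff]
  intro s t hst
  have h1 := congrArg (fun x => inner ℝ u x) hst
  have h2 := congrArg (fun x => inner ℝ v x) hst
  simp only [inner_add_right, inner_smul_right, real_inner_self_eq_norm_sq, inner_zero_right,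
    real_inner_comm u v] at h1 h2
  constructor
  · apply (mul_eq_zero.1 (_ : s * (‖u‖ ^ 2 * ‖v‖ ^ 2 - inner ℝ u v ^ 2) = 0)).resolve_right h
    linear_combination ‖v‖ ^ 2 * h1 - inner ℝ u v * h2
  · apply (mul_eq_zero.1 (_ : t * (‖u‖ ^ 2 * ‖v‖ ^ 2 - inner ℝ u v ^ 2) = 0)).resolve_right h
    linear_combination ‖u‖ ^ 2 * h2 - inner ℝ u v * h1

/-- Pairs of independent vectors with the same Gram matrix are related by a linear isometry. -/
theorem exists_linearIsometryEquiv {u v u' v' : Plane} (hu : ‖u‖ = ‖u'‖) (hv : ‖v‖ = ‖v'‖)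
    (huv : inner ℝ u v = inner ℝ u' v') (h : ‖u‖ ^ 2 * ‖v‖ ^ 2 - inner ℝ u v ^ 2 ≠ 0) :
    ∃ L : Plane ≃ₗᵢ[ℝ] Plane, L u = u' ∧ L v = v' := by
  let B := basisOfLinearIndependentOfCardEqFinrank (linearIndependent_pair_of_gram_ne_zero h)
    (by simp)
  have hB0 : B 0 = u := by simp [B]
  have hB1 : B 1 = v := by simp [B]
  let L : Plane →ₗ[ℝ] Plane := B.constr ℝ ![u', v']
  have hL0 : L u = u' := by rw [← hB0]; simp [L, B.constr_basis]
  have hL1 : L v = v' := by rw [← hB1]; simp [L, B.constr_basis]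
  have hn : ∀ x, ‖L x‖ = ‖x‖ := fun x => by
    have hx : x = B.repr x 0 • u + B.repr x 1 • v := by
      conv_lhs => rw [← B.sum_repr x]
      rw [Fin.sum_univ_two, hB0, hB1]
    rw [← sq_eq_sq₀ (norm_nonneg _) (norm_nonneg _), hx, map_add, map_smul, map_smul, hL0, hL1,
      norm_add_sq_real, norm_add_sq_real]
    simp only [norm_smul, inner_smul_left, inner_smul_right, hu, hv, huv]
  let L' : Plane →ₗᵢ[ℝ] Plane := ⟨L, hn⟩
  exact ⟨L'.toLinearIsometryEquiv rfl, hL0, hL1⟩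

/-- Congruent isosceles triangles are related by an isometry of the plane. -/
theorem exists_isometry_image_eq {T T' : Set Plane} {a c : ℝ} (hc : 0 < c) (hca : c < 2 * a)
    (hT : IsTriangleWithSides T a a c) (hT' : IsTriangleWithSides T' a a c) :
    ∃ g : Plane ≃ᵃⁱ[ℝ] Plane, g '' T = T' := by
  obtain ⟨A, B, C, hAB, hAC, hBC, rfl⟩ := hT
  obtain ⟨A', B', C', hAB', hAC', hBC', rfl⟩ := hT'
  have hinner : ∀ A B C : Plane, dist A B = a → dist A C = a → dist B C = c →
      inner ℝ (B - A) (C - A) = a ^ 2 - c ^ 2 / 2 := by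
    intro A B C h1 h2 h3
    rw [dist_comm, dist_eq_norm] at h1 h2
    rw [dist_eq_norm, show B - C = (B - A) - (C - A) by abel] at h3
    have := norm_sub_sq_real (B - A) (C - A)
    rw [h1, h2, h3] at this
    linarith
  have hn : ∀ A B : Plane, dist A B = a → ‖B - A‖ = a := fun A B h => by
    rw [← dist_eq_norm, dist_comm, h]
  obtain ⟨L, hLB, hLC⟩ := exists_linearIsometryEquiv (u := B - A) (v := C - A) (u' := B' - A')
    (v' := C' - A') (by rw [hn _ _ hAB, hn _ _ hAB']) (by rw [hn _ _ hAC, hn _ _ hAC'])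
    (by rw [hinner _ _ _ hAB hAC hBC, hinner _ _ _ hAB' hAC' hBC']) (by
      rw [hn _ _ hAB, hn _ _ hAC, hinner _ _ _ hAB hAC hBC]
      have : a ^ 2 * a ^ 2 - (a ^ 2 - c ^ 2 / 2) ^ 2 = c ^ 2 * ((2 * a - c) * (2 * a + c)) / 4 := by
        ring
      rw [this]
      have h1 : 0 < 2 * a - c := by linarith
      have h2 : 0 < 2 * a + c := by linarith
      positivity)
  let g : Plane ≃ᵃⁱ[ℝ] Plane := L.toAffineIsometryEquiv.trans
    (AffineIsometryEquiv.vaddConst ℝ (A' - L A))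
  have hg : ∀ x, g x = L (x - A) + A' := fun x => by
    simp [g]
    abel
  refine ⟨g, ?_⟩
  have himg : g '' convexHull ℝ {A, B, C} = convexHull ℝ (g '' {A, B, C}) :=
    g.toAffineEquiv.toAffineMap.image_convexHull _
  rw [himg, image_insert_eq, image_pair, hg, hg, hg, hLB, hLC]
  simp

theorem IsTriangleWithSides.smul {T : Set Plane} {a b c s : ℝ} (hs : 0 ≤ s)
    (hT : IsTriangleWithSides T a b c) : IsTriangleWithSides (s • T) (s * a) (s * b) (s * c) := by
  obtain ⟨A, B, C, rfl, rfl, rfl, rfl⟩ := hT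
  refine ⟨s • A, s • B, s • C, ?_, ?_, ?_, ?_⟩
  · rw [dist_smul₀, Real.norm_of_nonneg hs]
  · rw [dist_smul₀, Real.norm_of_nonneg hs]
  · rw [dist_smul₀, Real.norm_of_nonneg hs]
  · rw [← convexHull_smul, smul_set_insert, smul_set_insert, smul_set_singleton]

theorem IsTriangleWithSides.convex {T : Set Plane} {a b c : ℝ} (hT : IsTriangleWithSides T a b c) :
    Convex ℝ T := by
  obtain ⟨A, B, C, -, -, -, rfl⟩ := hT
  exact convex_convexHull ℝ _

theorem IsTriangleWithSides.isCompact {T : Set Plane} {a b c : ℝ}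
    (hT : IsTriangleWithSides T a b c) : IsCompact T := by
  obtain ⟨A, B, C, -, -, -, rfl⟩ := hT
  exact (toFinite _).isCompact_convexHull ℝ

/-- A set is congruent to the tile of kind `i`. -/
def IsCopy (Ω : Fin 2 → Set Plane) (i : Fin 2) (T : Set Plane) : Prop :=
  ∃ g : Plane ≃ᵃⁱ[ℝ] Plane, g '' Ω i = T

theorem exists_rule_of_dissections {U V X Y Z : Set Plane}
    (h₀ : IsDissection (Real.goldenRatio • Ω 0) U V) (hU : IsCopy Ω 0 U) (hV : IsCopy Ω 1 V)
    (h₁ : Real.goldenRatio • Ω 1 = X ∪ Y ∪ Z) (hXY : Disjoint (interior X) (interior Y))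
    (hXZ : Disjoint (interior X) (interior Z)) (hYZ : Disjoint (interior Y) (interior Z))
    (hX : IsCopy Ω 0 X) (hY : IsCopy Ω 1 Y) (hZ : IsCopy Ω 1 Z) :
    Nonempty (SubstitutionRule Ω) := by
  obtain ⟨u, rfl⟩ := hU
  obtain ⟨v, rfl⟩ := hV
  obtain ⟨x, rfl⟩ := hX
  obtain ⟨y, rfl⟩ := hY
  obtain ⟨z, rfl⟩ := hZ
  have key : ∀ i : Fin 2, ∃ place : Fin (i.val + 2) → (Plane ≃ᵃⁱ[ℝ] Plane),
      Real.goldenRatio • Ω i = ⋃ k, place k '' Ω (pieceKind k) ∧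
      ∀ k l, k ≠ l → Disjoint (interior (place k '' Ω (pieceKind k)))
        (interior (place l '' Ω (pieceKind l))) := by
    intro i
    fin_cases i
    · refine ⟨![u, v], ?_, ?_⟩
      · ext w
        rw [mem_iUnion]
        simp [Fin.exists_fin_two, pieceKind, h₀.1]
      · intro k l hkl
        fin_cases k <;> fin_cases l
        · exact (hkl rfl).elim
        · exact h₀.2
        · exact h₀.2.symm
        · exact (hkl rfl).elim
    · refine ⟨![x, y, z], ?_, ?_⟩
      · ext w
        rw [mem_iUnion]
        simp [Fin.exists_fin_succ, pieceKind, h₁, or_assoc]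
      · intro k l hkl
        fin_cases k <;> fin_cases l
        · exact (hkl rfl).elim
        · exact hXY
        · exact hXZ
        · exact hXY.symm
        · exact (hkl rfl).elim
        · exact hYZ
        · exact hXZ.symm
        · exact hYZ.symm
        · exact (hkl rfl).elim
  choose place hcover hdis using key
  exact ⟨⟨place, hcover, hdis⟩⟩

/-- In either pair the smaller scaled tile needs one golden cut. The larger one needs two: one piece
of the first cut is already a copy of the second tile, and the other piece is cut again. -/
theorem nonempty_substitutionRule (hΩ : IsRobinsonPair Ω) : Nonempty (SubstitutionRule Ω) := by
  have hφ := Real.goldenRatio_sq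
  have hφ1 := Real.one_lt_goldenRatio
  have hφ0 := Real.goldenRatio_pos
  have hφ2 := Real.goldenRatio_lt_two
  have hφi : 0 < Real.goldenRatio⁻¹ := inv_pos.2 hφ0
  have hφi1 : Real.goldenRatio⁻¹ < 1 := inv_lt_one_of_one_lt₀ hφ1
  rcases hΩ with ⟨h0, h1⟩ | ⟨h0, h1⟩
  · have h0' := h0.smul hφ0.le
    have h1' := h1.smul hφ0.le
    obtain ⟨U, V, hU, hV, hUV⟩ := exists_dissection_obtuse one_pos
      (T := Real.goldenRatio • Ω 0) (by convert h0' using 1; ring)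
    obtain ⟨X, Y, hX, hY, hXY⟩ := exists_dissection_acute hφ0
      (T := Real.goldenRatio • Ω 1) (by convert h1' using 1; ring)
    obtain ⟨Z, W, hZ, hW, hZW⟩ := exists_dissection_obtuse one_pos (T := Y)
      (by convert hY using 1 <;> ring)
    have c0 : ∀ T, IsTriangleWithSides T 1 1 Real.goldenRatio → IsCopy Ω 0 T := fun T hT =>
      exists_isometry_image_eq hφ0 (by linarith) h0 hT
    have c1 : ∀ T, IsTriangleWithSides T Real.goldenRatio Real.goldenRatio 1 → IsCopy Ω 1 T :=
      fun T hT => exists_isometry_image_eq one_pos (by linarith) h1 hT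
    rw [mul_one] at hU hV hZ hW
    rw [inv_mul_cancel₀ hφ0.ne'] at hX
    refine exists_rule_of_dissections (U := V) (V := U) (X := W) (Y := Z) (Z := X)
      ⟨by rw [hUV.1, union_comm], hUV.2.symm⟩ (c0 _ hV) (c1 _ hU) ?_ hZW.2.symm ?_ ?_
      (c0 _ hW) (c1 _ hZ) (c1 _ hX)
    · rw [hXY.1, hZW.1, union_comm X, union_comm W]
    · exact (hXY.2.mono_right (interior_mono (by rw [hZW.1]; exact subset_union_right))).symm
    · exact (hXY.2.mono_right (interior_mono (by rw [hZW.1]; exact subset_union_left))).symm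
  · have h0' := h0.smul hφ0.le
    have h1' := h1.smul hφ0.le
    rw [mul_inv_cancel₀ hφ0.ne'] at h0'
    obtain ⟨U, V, hU, hV, hUV⟩ := exists_dissection_acute one_pos
      (T := Real.goldenRatio • Ω 0) h0'
    obtain ⟨X, Y, hX, hY, hXY⟩ := exists_dissection_obtuse one_pos
      (T := Real.goldenRatio • Ω 1) (by convert h1' using 1; ring)
    obtain ⟨Z, W, hZ, hW, hZW⟩ := exists_dissection_acute one_pos (T := X) hX
    have c0 : ∀ T, IsTriangleWithSides T 1 1 Real.goldenRatio⁻¹ → IsCopy Ω 0 T := fun T hT =>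
      exists_isometry_image_eq hφi (by linarith) h0 hT
    have c1 : ∀ T, IsTriangleWithSides T 1 1 Real.goldenRatio → IsCopy Ω 1 T :=
      fun T hT => exists_isometry_image_eq hφ0 (by linarith) h1 hT
    rw [mul_one] at hU hV hY hZ hW
    refine exists_rule_of_dissections (X := Z) (Y := W) (Z := Y) hUV (c0 _ hU) (c1 _ hV) ?_
      hZW.2 ?_ ?_ (c0 _ hZ) (c1 _ hW) (c1 _ hY)
    · rw [hXY.1, hZW.1]
    · exact hXY.2.mono_left (interior_mono (by rw [hZW.1]; exact subset_union_left))
    · exact hXY.2.mono_left (interior_mono (by rw [hZW.1]; exact subset_union_right))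

theorem IsRobinsonPair.convex (hΩ : IsRobinsonPair Ω) (i : Fin 2) : Convex ℝ (Ω i) := by
  rcases hΩ with ⟨h0, h1⟩ | ⟨h0, h1⟩ <;> fin_cases i
  exacts [h0.convex, h1.convex, h0.convex, h1.convex]

theorem IsRobinsonPair.isCompact (hΩ : IsRobinsonPair Ω) (i : Fin 2) : IsCompact (Ω i) := by
  rcases hΩ with ⟨h0, h1⟩ | ⟨h0, h1⟩ <;> fin_cases i
  exacts [h0.isCompact, h1.isCompact, h0.isCompact, h1.isCompact]

end PenroseLattice

/-! ### Conclusion -/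

open PenroseLattice
theorem mainTheorem7 (Ω : Fin 2 → Set Plane) (hΩ : IsRobinsonPair Ω) :
    Nonempty (SubstitutionRule Ω) ∧
    ∀ (S : SubstitutionRule Ω) (p : Fin 2 → Plane), (∀ i, p i ∈ interior (Ω i)) →
      (∃ (ψ : ℕ → ℕ) (Λ : Set Plane), StrictMono ψ ∧
        ConvergesLocally (fun n => tilePoints S p (ψ n)) Λ) ∧
      ∀ (ψ : ℕ → ℕ) (Λ : Set Plane), StrictMono ψ →
        ConvergesLocally (fun n => tilePoints S p (ψ n)) Λ →
        IsUniformSet Λ ∧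
        ∀ χ : ℝ → Plane → ℝ, IsCutoffFamily χ →
          tildeW χ
            ((1 + Real.goldenRatio) /
              (volume.real (Ω 0) + Real.goldenRatio * volume.real (Ω 1))) Λ < ⊤ := by
  refine ⟨nonempty_substitutionRule hΩ, fun S p hp =>
    ⟨exists_subseq_convergesLocally _, fun ψ Λ hψ hΛ => ?_⟩⟩
  have hpos : ∀ i, 0 < volume.real (Ω i) := fun i => ENNReal.toReal_pos
    (Measure.measure_pos_of_nonempty_interior _ ⟨_, hp i⟩).ne' (hΩ.isCompact i).measure_lt_top.ne
  -- Twice the radius inside the tile keeps points of different tiles at distance at least 2r, so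
  -- that the screening discs of radius `r` are disjoint, with `r` independent of `n`.
  have hr : ∃ r > 0, ∀ i, ball (p i) (2 * r) ⊆ Ω i := by
    choose ε hε h using fun i => Metric.mem_nhds_iff.1 (mem_interior_iff_mem_nhds.1 (hp i))
    refine ⟨min (ε 0) (ε 1) / 2, half_pos (lt_min (hε 0) (hε 1)), fun i => ?_⟩
    refine (ball_subset_ball ?_).trans (h i)
    rw [mul_div_cancel₀ _ two_ne_zero]
    fin_cases i
    exacts [min_le_left _ _, min_le_right _ _]
  obtain ⟨r, hr0, hr⟩ := hr
  have hsep : IsSeparatedBy (2 * r) Λ := hΛ.isSeparatedBy fun n =>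
    isSeparatedBy_tilePoints S (by positivity) hr (ψ n)
  refine ⟨⟨2 * r, by positivity, hsep⟩, fun χ hχ => ?_⟩
  obtain ⟨K, hK⟩ := exists_primitive_limit S hΩ.convex hΩ.isCompact hpos (hp 0) hr0 hr hψ hΛ
  exact tildeW_lt_top hsep hr0 hK hχ
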